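/- Let $0<\beta\le 1<\alpha\le 2$ and $a>0$. For $b\in\mathbb C$ consider the fractional difference equation $$\Delta^{\alpha}x(t)+a\,\Delta^{\beta}x(t+\alpha-\beta-1)=(b-1)\,x(t+\alpha-2),\qquad t\in\{2-\alpha,\,3-\alpha,\,4-\alpha,\dots\},\tag{1}$$ for $x:\mathbb N_0\to\mathbb C$ with initial values $x(0),x(1)$. Here $\Delta^{\mu}x=\Delta^{-(m-\mu)}(\Delta^{m}x)$, $m=\lceil\mu\rceil$, is the Caputo-like difference, $\Delta^m$ is the $m$-th forward difference, and for $\nu\ge 0$ and $n\in\mathbb N_0$ $$(\Delta^{-\nu}y)(\nu+n)=\sum_{s=0}^{n}\binom{n-s+\nu-1}{n-s}y(s)$$ is the fractional sum (the identity if $\nu=0$). Call (1) stable if its zero solution is Lyapunov stable with respect to the initial values $(x(0),x(1))$, unstable if it is not, and asymptotically stable if it is stable and every solution with sufficiently small initial values tends to $0$. Let $\gamma=(\gamma_1,\gamma_2):[0,2\pi]\to\mathbb R^2$ be the boundary curve $$\gamma_1(\theta)=\left(2\sin\tfrac\theta2\right)^{\alpha}\cos\!\left(\tfrac{\alpha\pi}2+\theta\left(2-\tfrac\alpha2\right)\right)+a\left(2\sin\tfrac\theta2\right)^{\beta}\cos\!\left(\tfrac{\beta\pi}2+\theta\left(1-\tfrac\beta2\right)\right)+1,$$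 $$\gamma_2(\theta)=\left(2\sin\tfrac\theta2\right)^{\alpha}\sin\!\left(\tfrac{\alpha\pi}2+\theta\left(2-\tfrac\alpha2\right)\right)+a\left(2\sin\tfrac\theta2\right)^{\beta}\sin\!\left(\tfrac{\beta\pi}2+\theta\left(1-\tfrac\beta2\right)\right),$$ and put $$a_1=2^{\alpha-\beta},\qquad a_2=\frac{2^{\alpha-\beta}(\alpha-4)}{\beta-2}.$$ Then: 1. $\gamma(0)=\gamma(\pi)$ if and only if $a=a_1$. 2. $\gamma$ is differentiable at $\pi$, and $\gamma'(\pi)=0$ if and only if $a=a_2$. Moreover $a_1<a_2$. 3. The stable region vanishes at $a_2$: if $a\ge a_2$, then (1) is not asymptotically stable for any $b\in\mathbb C$; if $a>a_2$, then (1) is unstable for every $b\in\mathbb C$. 4. If $0<a<a_2$, then $\gamma_2$ has exactly one zero $\theta_0$ in $(0,\pi)$, and the set of real $b$ for which (1) is asymptotically stable is the non-empty open interval $(\gamma_1(\theta_0),R)$, whose right endpoint is $$R=\begin{cases}1,&0<a<a_1,\\ 1+2^{\alpha}-a\,2^{\beta},&a_1\le a<a_2.\end{cases}$$ -/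

import Mathlib

open Filter Topology

noncomputable section

/-- The binomial kernel `C(k + ν - 1, k) = ν (ν + 1) ⋯ (ν + k - 1) / k!` of the fractional sum. -/
def fracKernel (ν : ℝ) (k : ℕ) : ℝ :=
  ∏ j ∈ Finset.range k, ((ν + j) / (j + 1))

/-- For `ν > 0` the kernel is `Γ(k + ν) / (Γ(ν) Γ(k + 1))`. -/
theorem fracKernel_eq_Gamma {ν : ℝ} (hν : 0 < ν) (k : ℕ) :
    fracKernel ν k = 1 / Real.Gamma ν * (Real.Gamma (k + ν) / Real.Gamma (k + 1)) := by
  induction k with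
  | zero => simp [fracKernel, (Real.Gamma_pos_of_pos hν).ne']
  | succ k ih =>
    have h1 : Real.Gamma ((k : ℝ) + 1 + ν) = (k + ν) * Real.Gamma (k + ν) := by
      rw [← Real.Gamma_add_one (by positivity)]
      ring_nf
    have h2 : Real.Gamma ((k : ℝ) + 1 + 1) = (k + 1) * Real.Gamma (k + 1) :=
      Real.Gamma_add_one (by positivity)
    have h3 : Real.Gamma ((k : ℝ) + 1) ≠ 0 := (Real.Gamma_pos_of_pos (by positivity)).ne'
    have h4 : Real.Gamma ν ≠ 0 := (Real.Gamma_pos_of_pos hν).ne'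
    have h5 : (k : ℝ) + 1 ≠ 0 := by positivity
    unfold fracKernel at ih ⊢
    rw [Finset.prod_range_succ, ih]
    push_cast
    rw [h1, h2]
    field_simp
    ring

/-- The fractional sum of order `ν ≥ 0` of a sequence `y` on `ℕ`:
`fracSum ν y n` is the value `(Δ^{-ν} y)(t)` at `t = ν + n`. -/
def fracSum (ν : ℝ) (y : ℕ → ℂ) (n : ℕ) : ℂ :=
  ∑ s ∈ Finset.range (n + 1), (fracKernel ν (n - s) : ℂ) * y s

/-- The fractional sum of order `0` is the identity. -/
theorem fracSum_zero (y : ℕ → ℂ) (n : ℕ) : fracSum 0 y n = y n := by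
  unfold fracSum
  rw [Finset.sum_range_succ, Finset.sum_eq_zero, zero_add]
  · simp [fracKernel]
  · intro s hs
    have hs' : 0 < n - s := Nat.sub_pos_of_lt (Finset.mem_range.mp hs)
    have h : fracKernel 0 (n - s) = 0 :=
      Finset.prod_eq_zero (Finset.mem_range.mpr hs') (by simp)
    simp [h]

/-- The Caputo-like difference of order `μ > 0`, with `m = ⌈μ⌉`:
`caputoDiff μ x n` is the value `(Δ^μ x)(t) = (Δ^{-(m-μ)} (Δ^m x))(t)` at `t = m - μ + n`.
For integer `μ` it is the usual forward difference `Δ^μ`. -/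
def caputoDiff (μ : ℝ) (x : ℕ → ℂ) (n : ℕ) : ℂ :=
  fracSum (⌈μ⌉₊ - μ) ((fwdDiff (1 : ℕ))^[⌈μ⌉₊] x) n

/-- `x` solves `Δ^α x(t) + a Δ^β x(t + α - β - 1) = (b - 1) x(t + α - 2)` for all
`t = 2 - α + n`, `n ∈ ℕ`, where `0 < β ≤ 1 < α ≤ 2`.
Note that `t + α - β - 1 = 1 - β + n` and `t + α - 2 = n`. -/
def IsSolution (α β a : ℝ) (b : ℂ) (x : ℕ → ℂ) : Prop :=
  ∀ n : ℕ, caputoDiff α x n + (a : ℂ) * caputoDiff β x n = (b - 1) * x n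

/-- Lyapunov stability of the zero solution with respect to the initial data `(x 0, x 1)`. -/
def IsStableSystem (α β a : ℝ) (b : ℂ) : Prop :=
  ∀ ε : ℝ, 0 < ε → ∃ δ : ℝ, 0 < δ ∧ ∀ x : ℕ → ℂ, IsSolution α β a b x →
    ‖x 0‖ < δ → ‖x 1‖ < δ → ∀ n, ‖x n‖ < ε

/-- Asymptotic stability of the zero solution: it is stable and attractive. -/
def IsAsympStableSystem (α β a : ℝ) (b : ℂ) : Prop :=
  IsStableSystem α β a b ∧
    ∃ δ : ℝ, 0 < δ ∧ ∀ x : ℕ → ℂ, IsSolution α β a b x →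
      ‖x 0‖ < δ → ‖x 1‖ < δ → Tendsto x atTop (𝓝 0)

/-- The real part of the boundary curve. -/
def gammaRe (α β a θ : ℝ) : ℝ :=
  2 ^ α * Real.sin (θ / 2) ^ α * Real.cos (α * Real.pi / 2 + θ * (2 - α / 2)) +
    a * 2 ^ β * Real.sin (θ / 2) ^ β * Real.cos (β * Real.pi / 2 + θ * (1 - β / 2)) + 1

/-- The imaginary part of the boundary curve. -/
def gammaIm (α β a θ : ℝ) : ℝ :=
  2 ^ α * Real.sin (θ / 2) ^ α * Real.sin (α * Real.pi / 2 + θ * (2 - α / 2)) +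
    a * 2 ^ β * Real.sin (θ / 2) ^ β * Real.sin (β * Real.pi / 2 + θ * (1 - β / 2))

/-- The boundary curve `γ`, for `θ ∈ [0, 2π]`. -/
def gammaCurve (α β a : ℝ) (θ : ℝ) : ℝ × ℝ :=
  (gammaRe α β a θ, gammaIm α β a θ)

/-- The first bifurcation value. -/
def bifOne (α β : ℝ) : ℝ := 2 ^ (α - β)

/-- The second bifurcation value. -/
def bifTwo (α β : ℝ) : ℝ := 2 ^ (α - β) * (α - 4) / (β - 2)

end

/-! The generating function of the kernel of order `ν` is `(1 - w) ^ (-ν)`, so the equation for `x`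
becomes the identity `charSeries * x = dataSeries` of formal power series (`isSolution_iff`), with
symbol `charFun`, that is `(1 - w)^α + a w (1 - w)^β - (b - 1) w²`. Stability is governed by its
zeros in the closed unit disc. A zero in the open disc excludes stability, because the generating
function of a bounded solution converges there. A zero `w ≠ 1` on the circle excludes convergence to
`0`, by an Abel mean argument. For `b = 1`, where the zero is `w = 1`, constants are solutions.
Conversely, if there are no zeros in the closed disc, a Wiener-type argument inverts convolution by
the coefficients on null sequences, which gives boundedness and decay together
(`isAsympStableSystem_of_charFun_ne_zero`).

At `w = -exp (i δ)` the function `charFun` vanishes exactly when `b - 1 = arcRe + i arcIm`; with `δ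
= π - θ` this is the curve `γ`. Zeros in the open disc can appear or disappear along a connected set
of parameters only if a zero passes through the circle (`hasInnerZero_of_isPreconnected`), so it
suffices to know where the curve lies and to find one decided parameter in each region.

Write `u = 2 - α/2` and `v = 1 - β/2`. For `0 < δ < π` the curve is real exactly when `a = arcCoeff
α β δ`. On `(0, π/u)` this coefficient decreases strictly, and for positive `a` there is no real
point in `[π/u, π)`. Its limit at `δ = 0` is `2^(α-β) u / v = a₂`, which explains the threshold.

For `0 < a < a₂` there is thus one crossing. To its left, zeros in the disc are inherited from large
`|b|`; beyond the right endpoint the intermediate value theorem on `(0, 1)` or `(-1, 0)` gives one.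
The region between is connected as `a` varies, and it contains parameters with `a = a₁/2` and `b`
just below `1`, where zeros are excluded directly.

For `a ≥ a₂` the curve turns monotonically around `1` (`angular_velocity_pos`), so a ray from `1`
meets it at most once. Both ends of the ray carry inner zeros: near `b = 1` because `a > a₁`, and
far away because `|b|` is large. Hence inner zeros exist everywhere off the curve. On the curve
there is a circle zero, and for `a > a₂` the sign of the radial derivative of the boundary map
forces an inner zero as well. -/

/-! ### Fractional kernels: recurrences, generating function, decay and summability. -/

theorem fracKernel_zero_right (ν : ℝ) : fracKernel ν 0 = 1 := by
  simp [fracKernel]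

theorem fracKernel_succ (ν : ℝ) (k : ℕ) :
    fracKernel ν (k + 1) = fracKernel ν k * ((ν + k) / (k + 1)) := by
  rw [fracKernel, Finset.prod_range_succ, ← fracKernel]

theorem mul_fracKernel_eq (ν : ℝ) (k : ℕ) :
    (ν - 1) * fracKernel ν k = (ν - 1 + k) * fracKernel (ν - 1) k := by
  induction k with
  | zero => simp [fracKernel_zero_right]
  | succ k ih =>
    rw [fracKernel_succ, fracKernel_succ, ← mul_assoc, ih]
    push_cast
    ring

/-- Pascal's rule for the kernel. -/
theorem fracKernel_succ_sub (ν : ℝ) (k : ℕ) :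
    fracKernel ν (k + 1) - fracKernel ν k = fracKernel (ν - 1) (k + 1) := by
  have h := mul_fracKernel_eq ν k
  rw [fracKernel_succ, fracKernel_succ]
  field_simp
  linear_combination h

theorem fracKernel_eq_choose (ν : ℝ) (k : ℕ) :
    (fracKernel ν k : ℂ) = Ring.choose ((ν : ℂ) + k - 1) k := by
  rw [Ring.choose_eq_smul, Polynomial.descPochhammer_smeval_eq_ascPochhammer,
    Polynomial.ascPochhammer_smeval_eq_eval]
  have h1 : (ν : ℂ) + k - 1 - k + 1 = ν := by ring
  rw [h1]
  induction k with
  | zero => simp [fracKernel_zero_right]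
  | succ k ih =>
    rw [fracKernel_succ, ascPochhammer_succ_eval, Nat.factorial_succ]
    push_cast
    rw [ih (by ring)]
    have h2 : ((k : ℂ) + 1) ≠ 0 := Nat.cast_add_one_ne_zero k
    have h3 : ((k.factorial : ℂ)) ≠ 0 := Nat.cast_ne_zero.mpr k.factorial_ne_zero
    simp only [smul_eq_mul]
    field_simp

/-- The generating function of the kernel of order `ν` is `(1 - w) ^ (-ν)`. -/
theorem hasSum_fracKernel (ν : ℝ) {w : ℂ} (hw : ‖w‖ < 1) :
    HasSum (fun k => (fracKernel ν k : ℂ) * w ^ k) ((1 - w) ^ (-ν : ℂ)) := by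
  have h := (Complex.one_div_one_sub_cpow_hasFPowerSeriesOnBall_zero (ν : ℂ)).hasSum
    (y := w) (by rw [← ENNReal.ofReal_one, Metric.eball_ofReal]; simpa using hw)
  simp only [zero_add, FormalMultilinearSeries.ofScalars_apply_eq, smul_eq_mul, one_div,
    ← Complex.cpow_neg] at h
  simpa only [fracKernel_eq_choose] using h

/-- A kernel of order in `[0, 1)` is nonnegative. -/
theorem fracKernel_nonneg {ν : ℝ} (hν : 0 ≤ ν) (k : ℕ) : 0 ≤ fracKernel ν k :=
  Finset.prod_nonneg fun j _ => by positivity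

theorem fracKernel_antitone {ν : ℝ} (h0 : 0 ≤ ν) (h1 : ν ≤ 1) : Antitone (fracKernel ν) := by
  refine antitone_nat_of_succ_le fun k => ?_
  rw [fracKernel_succ]
  refine mul_le_of_le_one_right (fracKernel_nonneg h0 k) ?_
  rw [div_le_one (by positivity)]
  linarith

/-- Each factor is `1 - (1 - ν)/(j + 1) ≤ exp (-(1 - ν)/(j + 1))`, so divergence of the harmonic
series drives the product to zero. -/
theorem tendsto_fracKernel {ν : ℝ} (h0 : 0 ≤ ν) (h1 : ν < 1) :
    Tendsto (fracKernel ν) atTop (𝓝 0) := by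
  have hle : ∀ k, fracKernel ν k ≤
      Real.exp (-(1 - ν) * ∑ j ∈ Finset.range k, (1 / ((j : ℝ) + 1))) := by
    intro k
    rw [Finset.mul_sum, Real.exp_sum]
    refine Finset.prod_le_prod (fun j _ => by positivity) fun j _ => ?_
    refine le_trans (le_of_eq ?_) (Real.add_one_le_exp _)
    field_simp
    ring
  refine squeeze_zero (fracKernel_nonneg h0) hle ?_
  refine Real.tendsto_exp_atBot.comp ?_
  exact Real.tendsto_sum_range_one_div_nat_succ_atTop.const_mul_atTop_of_neg (by linarith)

theorem summable_abs_succ_sub_of_antitone {u : ℕ → ℝ} (hu : Antitone u) {c : ℝ}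
    (hc : ∀ n, c ≤ u n) : Summable fun n => |u (n + 1) - u n| := by
  refine summable_of_sum_range_le (c := u 0 - c) (fun n => abs_nonneg _) fun n => ?_
  have : ∀ k, |u (k + 1) - u k| = -(u (k + 1) - u k) := fun k =>
    abs_of_nonpos (by linarith [hu (Nat.le_succ k)])
  simp only [this, Finset.sum_neg_distrib, Finset.sum_range_sub]
  linarith [hc n]

theorem fracKernel_succ_nonpos {ν : ℝ} (h0 : -1 ≤ ν) (h1 : ν ≤ 0) (k : ℕ) :
    fracKernel ν (k + 1) ≤ 0 := by
  induction k with
  | zero => simpa [fracKernel] using h1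
  | succ k ih =>
    rw [fracKernel_succ]
    refine mul_nonpos_of_nonpos_of_nonneg ih (div_nonneg ?_ (by positivity))
    push_cast
    linarith [(Nat.cast_nonneg k : (0 : ℝ) ≤ k)]

/-- By Pascal's rule the kernel of order `-ν` consists of the increments of the kernel of order `1 -
ν`. The latter is eventually monotone and bounded, so the increments telescope. -/
theorem summable_abs_fracKernel_neg {ν : ℝ} (h0 : 0 < ν) (h2 : ν ≤ 2) :
    Summable fun k => |fracKernel (-ν) k| := by
  rw [← summable_nat_add_iff 1]
  rcases le_or_gt ν 1 with h1 | h1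
  · have h := summable_abs_succ_sub_of_antitone
      (fracKernel_antitone (ν := 1 - ν) (by linarith) (by linarith)) (fracKernel_nonneg (by linarith))
    simpa [fracKernel_succ_sub] using h
  -- For `ν > 1` the kernel of order `1 - ν` starts at `1`, then is nonpositive and increasing.
  -- Monotonicity holds only from index one on, hence a second index is dropped.
  · rw [← summable_nat_add_iff 1]
    have hn : ∀ k, fracKernel (1 - ν) (k + 1) ≤ 0 :=
      fracKernel_succ_nonpos (by linarith) (by linarith)
    have ha : Antitone fun k => -fracKernel (1 - ν) (k + 1) := by
      refine antitone_nat_of_succ_le fun k => ?_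
      rw [fracKernel_succ _ (k + 1), ← neg_mul]
      refine mul_le_of_le_one_right (by linarith [hn k]) ?_
      rw [div_le_one (by positivity)]
      linarith
    have h := summable_abs_succ_sub_of_antitone ha (c := 0) fun k => by linarith [hn k]
    refine h.congr fun k => ?_
    have := fracKernel_succ_sub (1 - ν) (k + 1)
    rw [show 1 - ν - 1 = -ν by ring] at this
    rw [← this, ← abs_neg]
    congr 1
    ring

/-! ### The equation as an identity of formal power series. -/

/-- The kernel of order `ν` as a formal power series. -/
noncomputable def kernelSeries (ν : ℝ) : PowerSeries ℂ :=
  PowerSeries.mk fun k => (fracKernel ν k : ℂ)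

theorem fracSum_eq_coeff (ν : ℝ) (y : ℕ → ℂ) (n : ℕ) :
    fracSum ν y n = PowerSeries.coeff n (kernelSeries ν * PowerSeries.mk y) := by
  rw [mul_comm, PowerSeries.coeff_mul, Finset.Nat.sum_antidiagonal_eq_sum_range_succ_mk]
  simp [fracSum, kernelSeries, mul_comm]

theorem constantCoeff_kernelSeries (ν : ℝ) :
    PowerSeries.constantCoeff (kernelSeries ν) = 1 := by
  rw [← PowerSeries.coeff_zero_eq_constantCoeff_apply, kernelSeries, PowerSeries.coeff_mk,
    fracKernel_zero_right, Complex.ofReal_one]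

theorem kernelSeries_sub_one (ν : ℝ) :
    kernelSeries ν * (1 - PowerSeries.X) = kernelSeries (ν - 1) := by
  ext n
  rw [mul_sub, mul_one, map_sub]
  cases n with
  | zero => simp [kernelSeries, fracKernel_zero_right]
  | succ n =>
    rw [PowerSeries.coeff_succ_mul_X]
    simp only [kernelSeries, PowerSeries.coeff_mk]
    rw [← fracKernel_succ_sub]
    push_cast
    rfl

theorem X_mul_mk_fwdDiff (x : ℕ → ℂ) :
    PowerSeries.X * PowerSeries.mk (fwdDiff (1 : ℕ) x) =
      (1 - PowerSeries.X) * PowerSeries.mk x - PowerSeries.C (x 0) := by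
  ext n
  rw [sub_mul, one_mul, map_sub, map_sub]
  cases n with
  | zero => simp
  | succ n =>
    rw [PowerSeries.coeff_succ_X_mul, PowerSeries.coeff_succ_X_mul]
    simp [fwdDiff]

/-- The characteristic power series of the equation. -/
noncomputable def charSeries (α β a : ℝ) (b : ℂ) : PowerSeries ℂ :=
  kernelSeries (-α) + PowerSeries.C (a : ℂ) * PowerSeries.X * kernelSeries (-β) -
    PowerSeries.C (b - 1) * PowerSeries.X ^ 2

/-- The power series collecting the contribution of the initial data `(p, q)`. -/
noncomputable def dataSeries (α β a : ℝ) (p q : ℂ) : PowerSeries ℂ :=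
  kernelSeries (2 - α) * (PowerSeries.C p + PowerSeries.C (q - 2 * p) * PowerSeries.X) +
    PowerSeries.C (a * p) * (PowerSeries.X * kernelSeries (1 - β))

/-- After multiplication by `X²`, `X_mul_mk_fwdDiff` turns each forward difference into a factor `1
- X` and an initial value. The factors `1 - X` lower the kernel orders `2 - α` and `1 - β` to `-α`
and `-β`; the initial values form `dataSeries`. -/
theorem isSolution_iff {α β a : ℝ} (hβ₀ : 0 < β) (hβ₁ : β ≤ 1) (hα₁ : 1 < α) (hα₂ : α ≤ 2)
    (b : ℂ) (x : ℕ → ℂ) :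
    IsSolution α β a b x ↔
      charSeries α β a b * PowerSeries.mk x = dataSeries α β a (x 0) (x 1) := by
  have hα : ⌈α⌉₊ = 2 := by
    rw [Nat.ceil_eq_iff (by norm_num)]
    constructor <;> norm_num <;> assumption
  have hβ : ⌈β⌉₊ = 1 := by
    rw [Nat.ceil_eq_iff (by norm_num)]
    constructor <;> norm_num <;> assumption
  have h1 : IsSolution α β a b x ↔
      kernelSeries (2 - α) * PowerSeries.mk (fwdDiff (1 : ℕ) (fwdDiff (1 : ℕ) x)) +
        PowerSeries.C (a : ℂ) * (kernelSeries (1 - β) * PowerSeries.mk (fwdDiff (1 : ℕ) x)) =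
      PowerSeries.C (b - 1) * PowerSeries.mk x := by
    rw [PowerSeries.ext_iff]
    refine forall_congr' fun n => ?_
    rw [map_add, PowerSeries.coeff_C_mul, PowerSeries.coeff_C_mul, ← fracSum_eq_coeff,
      ← fracSum_eq_coeff]
    simp only [caputoDiff, hα, hβ, Function.iterate_succ, Function.iterate_zero,
      Function.comp_apply, id_eq, Nat.cast_ofNat, Nat.cast_one, PowerSeries.coeff_mk]
  have e1 := X_mul_mk_fwdDiff x
  have e2 := X_mul_mk_fwdDiff (fwdDiff (1 : ℕ) x)
  have k1 := kernelSeries_sub_one (2 - α)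
  have k2 := kernelSeries_sub_one (2 - α - 1)
  have k3 := kernelSeries_sub_one (1 - β)
  rw [← k1, show 2 - α - 1 - 1 = -α by ring] at k2
  rw [show 1 - β - 1 = -β by ring] at k3
  have hX : (PowerSeries.X : PowerSeries ℂ) ^ 2 ≠ 0 := pow_ne_zero _ PowerSeries.X_ne_zero
  rw [h1, ← mul_right_inj' hX, charSeries, dataSeries, ← k2, ← k3]
  have h0 : fwdDiff (1 : ℕ) x 0 = x 1 - x 0 := by simp [fwdDiff]
  rw [h0] at e2
  simp only [map_sub, map_mul, map_one, map_ofNat] at e1 e2 ⊢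
  have key : ∀ A B C' D : PowerSeries ℂ, A - B = C' - D → (A = B ↔ C' = D) := by
    intro A B C' D h
    rw [← sub_eq_zero, h, sub_eq_zero]
  apply key
  linear_combination (PowerSeries.X * kernelSeries (2 - α)) * e2 +
    (PowerSeries.C (a : ℂ) * PowerSeries.X * kernelSeries (1 - β) +
     kernelSeries (2 - α) * (1 - PowerSeries.X)) * e1

theorem constantCoeff_charSeries (α β a : ℝ) (b : ℂ) :
    PowerSeries.constantCoeff (charSeries α β a b) = 1 := by
  simp [charSeries, constantCoeff_kernelSeries]

/-- Supplies the test solutions for both instability criteria. The characteristic series has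
constant term `1`, so it can be inverted formally. -/
theorem exists_isSolution {α β a : ℝ} (hβ₀ : 0 < β) (hβ₁ : β ≤ 1) (hα₁ : 1 < α) (hα₂ : α ≤ 2)
    (b q : ℂ) : ∃ x : ℕ → ℂ, IsSolution α β a b x ∧ x 0 = 0 ∧ x 1 = q := by
  have hc := constantCoeff_charSeries α β a b
  have hne : PowerSeries.constantCoeff (charSeries α β a b) ≠ 0 := by rw [hc]; exact one_ne_zero
  set S := (charSeries α β a b)⁻¹ * dataSeries α β a 0 q with hS
  have hS' : S = PowerSeries.X *
      (PowerSeries.C q * kernelSeries (2 - α) * (charSeries α β a b)⁻¹) := by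
    rw [hS, dataSeries]
    simp
    ring
  have h0 : PowerSeries.coeff 0 S = 0 := by
    rw [hS', PowerSeries.coeff_zero_X_mul]
  have h1 : PowerSeries.coeff 1 S = q := by
    rw [hS']
    refine (PowerSeries.coeff_succ_X_mul 0 _).trans ?_
    rw [PowerSeries.coeff_zero_eq_constantCoeff_apply, map_mul, map_mul,
      PowerSeries.constantCoeff_inv, hc, constantCoeff_kernelSeries]
    simp
  refine ⟨fun n => PowerSeries.coeff n S, ?_, h0, h1⟩
  have hm : (PowerSeries.mk fun n => PowerSeries.coeff n S) = S := by ext; simp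
  rw [isSolution_iff hβ₀ hβ₁ hα₁ hα₂, hm, h0, h1, hS, ← mul_assoc,
    PowerSeries.mul_inv_cancel _ hne, one_mul]

/-! ### Convergence of the series and the characteristic function on the closed disc. -/

/-- The formal power series `p` converges at `w` to `s`. -/
def SeriesHasSum (p : PowerSeries ℂ) (w s : ℂ) : Prop :=
  HasSum (fun k => PowerSeries.coeff k p * w ^ k) s

namespace SeriesHasSum

variable {p q : PowerSeries ℂ} {w s t : ℂ}

theorem add (hp : SeriesHasSum p w s) (hq : SeriesHasSum q w t) :
    SeriesHasSum (p + q) w (s + t) := by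
  simpa [SeriesHasSum, add_mul] using HasSum.add hp hq

theorem sub (hp : SeriesHasSum p w s) (hq : SeriesHasSum q w t) :
    SeriesHasSum (p - q) w (s - t) := by
  simpa [SeriesHasSum, sub_mul] using HasSum.sub hp hq

theorem C_mul (c : ℂ) (hp : SeriesHasSum p w s) :
    SeriesHasSum (PowerSeries.C c * p) w (c * s) := by
  simpa [SeriesHasSum, mul_assoc] using HasSum.mul_left c hp

theorem one (w : ℂ) : SeriesHasSum 1 w 1 := by
  have h : (fun k => PowerSeries.coeff k (1 : PowerSeries ℂ) * w ^ k) =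
      fun k => if k = 0 then (1 : ℂ) else 0 := by
    ext k
    rcases eq_or_ne k 0 with rfl | hk <;> simp [PowerSeries.coeff_one, *]
  rw [SeriesHasSum, h]
  exact hasSum_ite_eq 0 1

theorem X_mul (hp : SeriesHasSum p w s) : SeriesHasSum (PowerSeries.X * p) w (w * s) := by
  have h := HasSum.mul_left w hp
  rw [SeriesHasSum, ← hasSum_nat_add_iff' 1]
  simp only [Finset.range_one, Finset.sum_singleton, PowerSeries.coeff_zero_X_mul, zero_mul,
    sub_zero, PowerSeries.coeff_succ_X_mul]
  exact h.congr_fun fun k => by ring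

theorem unique (hp : SeriesHasSum p w s) (hp' : SeriesHasSum p w t) : s = t :=
  HasSum.unique hp hp'

theorem mul (hp : SeriesHasSum p w s) (hq : SeriesHasSum q w t)
    (hp' : Summable fun k => ‖PowerSeries.coeff k p * w ^ k‖)
    (hq' : Summable fun k => ‖PowerSeries.coeff k q * w ^ k‖) :
    SeriesHasSum (p * q) w (s * t) := by
  have h := (summable_norm_sum_mul_antidiagonal_of_summable_norm hp' hq').of_norm.hasSum
  rw [← tsum_mul_tsum_eq_tsum_sum_antidiagonal_of_summable_norm hp' hq', hp.tsum_eq,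
    hq.tsum_eq] at h
  refine h.congr_fun fun n => ?_
  rw [PowerSeries.coeff_mul, Finset.sum_mul]
  refine Finset.sum_congr rfl fun kl hkl => ?_
  rw [← Finset.HasAntidiagonal.mem_antidiagonal.mp hkl]
  ring

end SeriesHasSum

theorem seriesHasSum_kernelSeries (ν : ℝ) {w : ℂ} (hw : ‖w‖ < 1) :
    SeriesHasSum (kernelSeries ν) w ((1 - w) ^ (-ν : ℂ)) := by
  simpa [SeriesHasSum, kernelSeries] using hasSum_fracKernel ν hw

/-- The characteristic function of the equation. -/
noncomputable def charFun (α β a : ℝ) (b w : ℂ) : ℂ :=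
  (1 - w) ^ (α : ℂ) + a * (w * (1 - w) ^ (β : ℂ)) - (b - 1) * w ^ 2

theorem seriesHasSum_charSeries_of_norm_lt (α β a : ℝ) (b : ℂ) {w : ℂ} (hw : ‖w‖ < 1) :
    SeriesHasSum (charSeries α β a b) w (charFun α β a b w) := by
  have h1 := seriesHasSum_kernelSeries (-α) hw
  have h2 := ((seriesHasSum_kernelSeries (-β) hw).X_mul).C_mul a
  have h3 := ((SeriesHasSum.one w).X_mul.X_mul).C_mul (b - 1)
  have h := (h1.add h2).sub h3
  convert h using 1
  · rw [charSeries]; ring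
  · rw [charFun]; push_cast; ring_nf

theorem summable_norm_coeff_X_mul {p : PowerSeries ℂ}
    (hp : Summable fun k => ‖PowerSeries.coeff k p‖) :
    Summable fun k => ‖PowerSeries.coeff k (PowerSeries.X * p)‖ := by
  rw [← summable_nat_add_iff 1]
  simpa [PowerSeries.coeff_succ_X_mul] using hp

theorem summable_norm_coeff_kernelSeries_neg {ν : ℝ} (h0 : 0 < ν) (h2 : ν ≤ 2) :
    Summable fun k => ‖PowerSeries.coeff k (kernelSeries (-ν))‖ := by
  simpa [kernelSeries] using summable_abs_fracKernel_neg h0 h2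

theorem summable_norm_coeff_charSeries {α β : ℝ} (hβ₀ : 0 < β) (hβ₁ : β ≤ 1) (hα₁ : 1 < α)
    (hα₂ : α ≤ 2) (a : ℝ) (b : ℂ) :
    Summable fun k => ‖PowerSeries.coeff k (charSeries α β a b)‖ := by
  have h1 := summable_norm_coeff_kernelSeries_neg (ν := α) (by linarith) hα₂
  have h2 := (summable_norm_coeff_X_mul
    (summable_norm_coeff_kernelSeries_neg hβ₀ (by linarith))).mul_left ‖(a : ℂ)‖
  have h4 : Summable fun k => ‖PowerSeries.coeff k (1 : PowerSeries ℂ)‖ := by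
    refine summable_of_ne_finset_zero (s := {0}) fun k hk => ?_
    rw [Finset.mem_singleton] at hk
    simp [PowerSeries.coeff_one, hk]
  have h3 := (summable_norm_coeff_X_mul (summable_norm_coeff_X_mul h4)).mul_left ‖b - 1‖
  refine ((h1.add h2).add h3).of_nonneg_of_le (fun k => norm_nonneg _) fun k => ?_
  have : charSeries α β a b = kernelSeries (-α) +
      PowerSeries.C (a : ℂ) * (PowerSeries.X * kernelSeries (-β)) -
      PowerSeries.C (b - 1) * (PowerSeries.X * (PowerSeries.X * 1)) := by
    rw [charSeries]; ring
  rw [this, map_sub, map_add, PowerSeries.coeff_C_mul, PowerSeries.coeff_C_mul, ← norm_mul,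
    ← norm_mul]
  exact (norm_sub_le _ _).trans (by gcongr; exact norm_add_le _ _)

theorem continuousOn_one_sub_cpow {ν : ℝ} (h0 : 0 < ν) :
    ContinuousOn (fun w : ℂ => (1 - w) ^ (ν : ℂ)) (Metric.closedBall 0 1) := by
  intro w hw
  have hw' : w.re ≤ 1 := (Complex.re_le_norm w).trans (by simpa using hw)
  refine ContinuousAt.continuousWithinAt ?_
  refine ContinuousAt.comp (f := fun w : ℂ => 1 - w) (g := fun z : ℂ => z ^ (ν : ℂ)) ?_
    (by fun_prop)
  exact Complex.continuousAt_cpow_const_of_re_pos (Or.inl (by simpa using hw')) (by simpa using h0)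

/-- Continuity holds jointly in `(a, b, w)` and up to the circle. The point `w = 1` is included
because both exponents are positive, although `charFun` need not be differentiable there. -/
theorem continuousOn_charFun_uncurry {α β : ℝ} (hα : 0 < α) (hβ : 0 < β) :
    ContinuousOn (fun p : (ℝ × ℂ) × ℂ => charFun α β p.1.1 p.1.2 p.2)
      (Set.univ ×ˢ Metric.closedBall 0 1) := by
  have h : ∀ {ν : ℝ}, 0 < ν → ContinuousOn (fun p : (ℝ × ℂ) × ℂ => (1 - p.2) ^ (ν : ℂ))
      (Set.univ ×ˢ Metric.closedBall 0 1) := fun hν =>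
    (continuousOn_one_sub_cpow hν).comp (by fun_prop) fun p hp => hp.2
  have h1 := h hα
  have h2 := h hβ
  unfold charFun
  fun_prop

theorem continuousOn_charFun {α β : ℝ} (hα : 0 < α) (hβ : 0 < β) (a : ℝ) (b : ℂ) :
    ContinuousOn (charFun α β a b) (Metric.closedBall 0 1) :=
  (continuousOn_charFun_uncurry hα hβ).comp (f := fun w => ((a, b), w)) (by fun_prop)
    fun w hw => ⟨trivial, hw⟩

theorem one_sub_mem_slitPlane {w : ℂ} (hw : ‖w‖ ≤ 1) (hw1 : w ≠ 1) : 1 - w ∈ Complex.slitPlane := by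
  have h := Complex.re_le_norm w
  rcases (h.trans hw).lt_or_eq with h1 | h1
  · exact Or.inl (by simpa using h1)
  · refine Or.inr fun h2 => hw1 ?_
    have h3 : w.im = 0 := by simpa using h2
    exact Complex.ext (by simpa using h1) (by simpa using h3)

theorem differentiableAt_charFun (α β a : ℝ) (b : ℂ) {w : ℂ} (hw : ‖w‖ ≤ 1) (hw1 : w ≠ 1) :
    DifferentiableAt ℂ (charFun α β a b) w := by
  have h : ∀ ν : ℝ, DifferentiableAt ℂ (fun w : ℂ => (1 - w) ^ (ν : ℂ)) w := fun ν =>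
    DifferentiableAt.cpow_const (by fun_prop) (one_sub_mem_slitPlane hw hw1)
  have h1 := h α
  have h2 := h β
  unfold charFun
  fun_prop

/-- The coefficients are absolutely summable, so the sum is continuous on the closed disc. It agrees
with `charFun` on the open disc, hence on its closure. -/
theorem seriesHasSum_charSeries {α β : ℝ} (hβ₀ : 0 < β) (hβ₁ : β ≤ 1) (hα₁ : 1 < α)
    (hα₂ : α ≤ 2) (a : ℝ) (b : ℂ) {w : ℂ} (hw : ‖w‖ ≤ 1) :
    SeriesHasSum (charSeries α β a b) w (charFun α β a b w) := by
  have hs := summable_norm_coeff_charSeries hβ₀ hβ₁ hα₁ hα₂ a b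
  have hle : ∀ (k : ℕ), ∀ w ∈ Metric.closedBall (0 : ℂ) 1,
      ‖PowerSeries.coeff k (charSeries α β a b) * w ^ k‖ ≤
        ‖PowerSeries.coeff k (charSeries α β a b)‖ := fun k w hw => by
    rw [norm_mul, norm_pow]
    exact mul_le_of_le_one_right (norm_nonneg _)
      (pow_le_one₀ (norm_nonneg _) (by simpa using hw))
  have hc := continuousOn_tsum (fun k => by fun_prop) hs hle
  have heq : Set.EqOn (fun w => ∑' k, PowerSeries.coeff k (charSeries α β a b) * w ^ k)
      (charFun α β a b) (Metric.ball 0 1) := fun w hw =>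
    (seriesHasSum_charSeries_of_norm_lt α β a b (by simpa using hw)).tsum_eq
  have hw' : w ∈ Metric.closedBall (0 : ℂ) 1 := by simpa using hw
  have := heq.of_subset_closure hc (continuousOn_charFun (by linarith) hβ₀ a b)
    Metric.ball_subset_closedBall (closure_ball (0 : ℂ) one_ne_zero).ge hw'
  rw [SeriesHasSum, ← this]
  exact (Summable.of_norm_bounded hs fun k => hle k w hw').hasSum

/-! ### A Wiener-type inversion of convolution operators on null sequences. -/

/-- The right shift on sequences tending to zero. -/
noncomputable def rightShift : ZeroAtInftyContinuousMap ℕ ℂ →L[ℂ] ZeroAtInftyContinuousMap ℕ ℂ :=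
  LinearMap.mkContinuous
    { toFun := fun f =>
        { toFun := fun n => Nat.casesOn n 0 fun k => f k
          continuous_toFun := continuous_of_discreteTopology
          zero_at_infty' := by
            rw [cocompact_eq_atTop (α := ℕ), ← tendsto_add_atTop_iff_nat 1]
            exact cocompact_eq_atTop (α := ℕ) ▸ f.zero_at_infty' }
      map_add' := fun f g => by
        ext n
        cases n <;> simp
      map_smul' := fun c f => by
        ext n
        cases n <;> simp }
    1 fun f => by
      rw [one_mul, ← ZeroAtInftyContinuousMap.norm_toBCF_eq_norm,
        BoundedContinuousFunction.norm_le (norm_nonneg _)]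
      rintro (_ | n)
      · simp
      · rw [← ZeroAtInftyContinuousMap.norm_toBCF_eq_norm]
        exact f.toBCF.norm_coe_le_norm n

theorem rightShift_apply_zero (f : ZeroAtInftyContinuousMap ℕ ℂ) : rightShift f 0 = 0 := rfl

theorem rightShift_apply_succ (f : ZeroAtInftyContinuousMap ℕ ℂ) (n : ℕ) :
    rightShift f (n + 1) = f n := rfl

theorem norm_rightShift_le : ‖rightShift‖ ≤ 1 :=
  LinearMap.mkContinuous_norm_le _ zero_le_one _

theorem rightShift_pow_apply (f : ZeroAtInftyContinuousMap ℕ ℂ) (k n : ℕ) :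
    (rightShift ^ k) f n = if k ≤ n then f (n - k) else 0 := by
  induction k generalizing n with
  | zero => simp
  | succ k ih =>
    rw [pow_succ', mul_apply_eq_comp]
    cases n with
    | zero => simp [rightShift_apply_zero]
    | succ n => rw [rightShift_apply_succ, ih]; simp

/-- An absolutely convergent power series without zeros in the closed unit disc is invertible at
every element of norm at most one of a commutative Banach algebra. -/
theorem exists_hasSum_isUnit {A : Type*} [NormedCommRing A] [NormedAlgebra ℂ A] [CompleteSpace A]
    [NormOneClass A] {s : A} (hs : ‖s‖ ≤ 1) {q : ℕ → ℂ} (hq : Summable fun k => ‖q k‖)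
    (h0 : ∀ w : ℂ, ‖w‖ ≤ 1 → ∑' k, q k * w ^ k ≠ 0) :
    ∃ t : A, HasSum (fun k => q k • s ^ k) t ∧ IsUnit t := by
  have hsum : Summable fun k => q k • s ^ k := by
    refine Summable.of_norm_bounded hq fun k => ?_
    rw [norm_smul]
    exact mul_le_of_le_one_right (norm_nonneg _)
      ((norm_pow_le s k).trans (pow_le_one₀ (norm_nonneg _) hs))
  refine ⟨_, hsum.hasSum, by_contra fun hu => ?_⟩
  -- Gelfand theory: a non-unit is killed by some character `φ`. Characters are contractive, so `φ
  -- s` lies in the closed disc, and `φ t` is the scalar series at `φ s`, which is nonzero by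
  -- assumption.
  obtain ⟨φ, hφ⟩ := WeakDual.CharacterSpace.exists_apply_eq_zero hu
  refine h0 (φ s) ((AlgHom.norm_apply_le_self φ s).trans hs) ?_
  rw [hsum.map_tsum φ (map_continuous φ)] at hφ
  simpa using hφ

/-- Functional calculus inverse of a contraction. -/
theorem exists_right_inverse_tsum {E : Type*} [NormedAddCommGroup E] [NormedSpace ℂ E]
    [CompleteSpace E] [Nontrivial E] {S : E →L[ℂ] E} (hS : ‖S‖ ≤ 1) {q : ℕ → ℂ}
    (hq : Summable fun k => ‖q k‖) (h0 : ∀ w : ℂ, ‖w‖ ≤ 1 → ∑' k, q k * w ^ k ≠ 0) :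
    ∃ T V : E →L[ℂ] E, HasSum (fun k => q k • S ^ k) T ∧ T * V = 1 := by
  -- The closed subalgebra generated by `S` is commutative, which makes characters available.
  let A := Algebra.elemental ℂ S
  let : NormedCommRing A := { (inferInstance : NormedRing A) with mul_comm := mul_comm }
  let s : A := ⟨S, Algebra.elemental.self_mem ℂ S⟩
  have hs : ‖s‖ ≤ 1 := hS
  have : NormOneClass A := ⟨norm_one (α := E →L[ℂ] E)⟩
  obtain ⟨t, ht, hu⟩ := exists_hasSum_isUnit hs hq h0
  obtain ⟨V, hV⟩ := hu.exists_right_inv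
  exact ⟨t.1, V.1, ht.map A.val continuous_subtype_val, congrArg Subtype.val hV⟩

/-- Convolution by an absolutely summable sequence whose generating function has no zeros in the
closed unit disc is surjective on null sequences, with bounded preimages. -/
theorem exists_convolution_inverse {q : ℕ → ℂ} (hq : Summable fun k => ‖q k‖)
    (h0 : ∀ w : ℂ, ‖w‖ ≤ 1 → ∑' k, q k * w ^ k ≠ 0) :
    ∃ C : ℝ, 0 ≤ C ∧ ∀ f : ZeroAtInftyContinuousMap ℕ ℂ, ∃ y : ZeroAtInftyContinuousMap ℕ ℂ,
      ‖y‖ ≤ C * ‖f‖ ∧ PowerSeries.mk q * PowerSeries.mk y = PowerSeries.mk f := by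
  have : Nontrivial (ZeroAtInftyContinuousMap ℕ ℂ) := by
    refine ⟨⟨{ toFun := fun n => if n = 0 then 1 else 0
               continuous_toFun := continuous_of_discreteTopology
               zero_at_infty' := ?_ }, 0, fun h => ?_⟩⟩
    · rw [cocompact_eq_atTop]
      refine tendsto_const_nhds.congr' ?_
      filter_upwards [eventually_gt_atTop 0] with n hn
      simp [hn.ne']
    · simpa using DFunLike.congr_fun h 0
  obtain ⟨T, V, hT, hTV⟩ := exists_right_inverse_tsum norm_rightShift_le hq h0
  refine ⟨‖V‖, norm_nonneg _, fun f => ⟨V f, V.le_opNorm f, ?_⟩⟩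
  ext n
  let ev : ZeroAtInftyContinuousMap ℕ ℂ →+ ℂ :=
    { toFun := fun g => g n, map_zero' := rfl, map_add' := fun _ _ => rfl }
  have hev : Continuous ev := by
    refine LipschitzWith.continuous (K := 1) (LipschitzWith.of_dist_le_mul fun g h => ?_)
    rw [NNReal.coe_one, one_mul]
    exact (BoundedContinuousFunction.dist_coe_le_dist (f := g.toBCF) (g := h.toBCF) n)
  -- Evaluation of `T (V f) = f` at `n`: the power `rightShift ^ k` contributes `V f (n - k)` for `k
  -- ≤ n` and `0` otherwise, so the operator series becomes the finite Cauchy product.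
  have h2 := (hT.mapL (ContinuousLinearMap.apply ℂ _ (V f))).map ev hev
  have h3 : ev (ContinuousLinearMap.apply ℂ _ (V f) T) = f n :=
    congrArg (fun T : ZeroAtInftyContinuousMap ℕ ℂ →L[ℂ] ZeroAtInftyContinuousMap ℕ ℂ => T f n) hTV
  rw [h3] at h2
  have h4 : HasSum (fun k => q k • if k ≤ n then V f (n - k) else 0)
      (∑ k ∈ Finset.range n.succ, q k * V f (n - k)) := by
    have h := hasSum_sum_of_ne_finset_zero (L := SummationFilter.unconditional ℕ)
      (f := fun k => q k • if k ≤ n then V f (n - k) else 0) (s := Finset.range n.succ)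
      fun k hk => by
        rw [if_neg (fun h => hk (Finset.mem_range.mpr (Nat.lt_succ_iff.mpr h))), smul_zero]
    convert! h using 1
    refine Finset.sum_congr rfl fun k hk => ?_
    rw [if_pos (Nat.lt_succ_iff.mp (Finset.mem_range.mp hk)), smul_eq_mul]
  rw [PowerSeries.coeff_mul, Finset.Nat.sum_antidiagonal_eq_sum_range_succ_mk]
  simp only [PowerSeries.coeff_mk]
  refine h4.unique (h2.congr_fun fun k => ?_)
  rw [← rightShift_pow_apply]
  rfl

/-! ### Zeros in the closed disc exclude asymptotic stability. -/

theorem summable_norm_coeff_mul_pow {p : PowerSeries ℂ} {C : ℝ}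
    (hp : ∀ k, ‖PowerSeries.coeff k p‖ ≤ C) {w : ℂ} (hw : ‖w‖ < 1) :
    Summable fun k => ‖PowerSeries.coeff k p * w ^ k‖ := by
  refine ((summable_geometric_of_lt_one (norm_nonneg w) hw).mul_left C).of_nonneg_of_le
    (fun k => norm_nonneg _) fun k => ?_
  rw [norm_mul, norm_pow]
  exact mul_le_mul_of_nonneg_right (hp k) (by positivity)

theorem charFun_mul_tsum_eq {α β a : ℝ} (hβ₀ : 0 < β) (hβ₁ : β ≤ 1) (hα₁ : 1 < α) (hα₂ : α ≤ 2)
    {b : ℂ} {x : ℕ → ℂ} (hx : IsSolution α β a b x) (hx0 : x 0 = 0) {C : ℝ}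
    (hC : ∀ n, ‖x n‖ ≤ C) {w : ℂ} (hw : ‖w‖ < 1) :
    charFun α β a b w * ∑' n, x n * w ^ n = x 1 * (w * (1 - w) ^ ((α : ℂ) - 2)) := by
  rw [isSolution_iff hβ₀ hβ₁ hα₁ hα₂, hx0] at hx
  have h1 := seriesHasSum_charSeries_of_norm_lt α β a b hw
  have hs := summable_norm_coeff_mul_pow (p := PowerSeries.mk x) (by simpa using hC) hw
  have h2 : SeriesHasSum (PowerSeries.mk x) w (∑' n, x n * w ^ n) := by
    simpa [SeriesHasSum] using hs.of_norm.hasSum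
  have hq := summable_norm_coeff_charSeries hβ₀ hβ₁ hα₁ hα₂ a b
  have h3 := h1.mul h2 (summable_norm_coeff_mul_pow (C := ∑' k, ‖PowerSeries.coeff k
    (charSeries α β a b)‖) (fun k => hq.le_tsum k fun _ _ => norm_nonneg _) hw) hs
  have h4 := ((seriesHasSum_kernelSeries (2 - α) hw).X_mul).C_mul (x 1)
  have h5 : dataSeries α β a 0 (x 1) =
      PowerSeries.C (x 1) * (PowerSeries.X * kernelSeries (2 - α)) := by
    rw [dataSeries]; simp; ring
  rw [hx, h5] at h3
  rw [h3.unique h4]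
  push_cast
  ring_nf

/-- Stability would make the solution with data `(0, δ/2)` bounded. At the zero `w` the left side of
`charFun_mul_tsum_eq` vanishes, while the right side does not, since `w ≠ 0` and `w ≠ 1`. -/
theorem not_isStableSystem_of_charFun_eq_zero {α β a : ℝ} (hβ₀ : 0 < β) (hβ₁ : β ≤ 1)
    (hα₁ : 1 < α) (hα₂ : α ≤ 2) {b w : ℂ} (hw : ‖w‖ < 1) (h0 : charFun α β a b w = 0) :
    ¬ IsStableSystem α β a b := by
  intro hst
  obtain ⟨δ, hδ, h⟩ := hst 1 one_pos
  obtain ⟨x, hx, hx0, hx1⟩ := exists_isSolution (a := a) hβ₀ hβ₁ hα₁ hα₂ b ((δ / 2 : ℝ) : ℂ)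
  have hb := h x hx (by simpa [hx0]) (by
    rw [hx1, Complex.norm_real, Real.norm_of_nonneg (by linarith)]; linarith)
  have h1 := charFun_mul_tsum_eq hβ₀ hβ₁ hα₁ hα₂ hx hx0 (fun n => (hb n).le) hw
  rw [h0, zero_mul, hx1] at h1
  have hw0 : w ≠ 0 := by
    rintro rfl
    simp [charFun] at h0
  have hw1 : 1 - w ≠ 0 := fun h => by
    rw [← sub_eq_zero.mp h] at hw
    simp at hw
  have hδ' : ((δ / 2 : ℝ) : ℂ) ≠ 0 := Complex.ofReal_ne_zero.mpr (by linarith)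
  exact mul_ne_zero hδ' (mul_ne_zero hw0 (by rw [Complex.cpow_ne_zero_iff]; exact Or.inl hw1)) h1.symm

/-- Abel means of a null sequence. -/
theorem tendsto_one_sub_mul_tsum_of_tendsto_zero {x : ℕ → ℂ} (hx : Tendsto x atTop (𝓝 0)) {w : ℂ}
    (hw : ‖w‖ = 1) :
    Tendsto (fun r : ℝ => ((1 - r : ℝ) : ℂ) * ∑' n, x n * (r * w) ^ n) (𝓝[<] 1) (𝓝 0) := by
  rw [NormedAddGroup.tendsto_nhds_zero]
  intro ε hε
  -- The first `N` terms contribute at most `(1 - r) M`, which vanishes in the limit. The tail is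
  -- dominated by `ε/2` times a geometric series, which `1 - r` normalizes to `ε/2`.
  obtain ⟨N, hN⟩ := eventually_atTop.mp
    ((NormedAddGroup.tendsto_nhds_zero.mp hx) (ε / 2) (by linarith))
  set M : ℝ := ∑ n ∈ Finset.range N, ‖x n‖ with hM
  have hM0 : 0 ≤ M := Finset.sum_nonneg fun _ _ => norm_nonneg _
  have hlim : Tendsto (fun r : ℝ => (1 - r) * M + ε / 2) (𝓝[<] 1) (𝓝 (ε / 2)) := by
    have : Tendsto (fun r : ℝ => (1 - r) * M + ε / 2) (𝓝 1) (𝓝 ((1 - 1) * M + ε / 2)) :=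
      Continuous.tendsto (by fun_prop) 1
    simpa using this.mono_left nhdsWithin_le_nhds
  filter_upwards [hlim.eventually_lt_const (show ε / 2 < ε by linarith), self_mem_nhdsWithin,
    mem_nhdsWithin_of_mem_nhds (lt_mem_nhds (show (0 : ℝ) < 1 by norm_num))] with r hr hr1 hr0
  have hr1' : r < 1 := hr1
  have hg := summable_geometric_of_lt_one hr0.le hr1'
  have hle : ∀ n, ‖x n * (r * w) ^ n‖ ≤ (if n ∈ Finset.range N then ‖x n‖ else 0) + ε / 2 * r ^ n := by
    intro n
    rw [norm_mul, norm_pow, norm_mul, hw, mul_one, Complex.norm_real, Real.norm_of_nonneg hr0.le]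
    split_ifs with hn
    · have := mul_le_of_le_one_right (norm_nonneg (x n)) (pow_le_one₀ hr0.le hr1'.le (n := n))
      have : 0 ≤ ε / 2 * r ^ n := by positivity
      linarith
    · rw [zero_add]
      exact mul_le_mul_of_nonneg_right (hN n (by simpa using hn)).le (by positivity)
  have hs1 : HasSum (fun n => if n ∈ Finset.range N then ‖x n‖ else 0) M := by
    have := hasSum_sum_of_ne_finset_zero (L := SummationFilter.unconditional ℕ)
      (f := fun n => if n ∈ Finset.range N then ‖x n‖ else 0) (s := Finset.range N)
      (fun n hn => if_neg hn)
    rwa [Finset.sum_congr rfl fun n hn => if_pos hn] at this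
  have hs2 := hs1.add ((hasSum_geometric_of_lt_one hr0.le hr1').mul_left (ε / 2))
  have hs3 : ‖∑' n, x n * (r * w) ^ n‖ ≤ M + ε / 2 * (1 - r)⁻¹ := tsum_of_norm_bounded hs2 hle
  rw [norm_mul, Complex.norm_real, Real.norm_of_nonneg (by linarith)]
  refine lt_of_le_of_lt (mul_le_mul_of_nonneg_left hs3 (by linarith)) (lt_of_eq_of_lt ?_ hr)
  have : 1 - r ≠ 0 := by linarith
  field_simp

/-- Along the radius to a circle zero, `charFun / (1 - r)` has a finite limit by differentiability,
while `1 - r` times the generating function of a null solution tends to `0`. Their product is the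
transformed initial data, whose limit is nonzero. -/
theorem not_isAsympStableSystem_of_charFun_eq_zero {α β a : ℝ} (hβ₀ : 0 < β) (hβ₁ : β ≤ 1)
    (hα₁ : 1 < α) (hα₂ : α ≤ 2) {b w : ℂ} (hw : ‖w‖ ≤ 1) (hw1 : w ≠ 1)
    (h0 : charFun α β a b w = 0) : ¬ IsAsympStableSystem α β a b := by
  rintro ⟨hst, δ, hδ, h⟩
  rcases hw.lt_or_eq with hw | hw
  · exact not_isStableSystem_of_charFun_eq_zero hβ₀ hβ₁ hα₁ hα₂ hw h0 hst
  obtain ⟨x, hx, hx0, hx1⟩ := exists_isSolution (a := a) hβ₀ hβ₁ hα₁ hα₂ b ((δ / 2 : ℝ) : ℂ)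
  have hlim := h x hx (by simpa [hx0]) (by
    rw [hx1, Complex.norm_real, Real.norm_of_nonneg (by linarith)]; linarith)
  obtain ⟨C, hC⟩ := hlim.norm.bddAbove_range
  have hC' : ∀ n, ‖x n‖ ≤ C := fun n => hC ⟨n, rfl⟩
  have habel := tendsto_one_sub_mul_tsum_of_tendsto_zero hlim hw
  have hw0 : w ≠ 0 := by
    rintro rfl
    simp at hw
  have hsl := one_sub_mem_slitPlane hw.le hw1
  have hδ' : ((δ / 2 : ℝ) : ℂ) ≠ 0 := Complex.ofReal_ne_zero.mpr (by linarith)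
  have hray : Tendsto (fun r : ℝ => (r : ℂ) * w) (𝓝[<] 1) (𝓝 w) := by
    have : Tendsto (fun r : ℝ => (r : ℂ) * w) (𝓝 1) (𝓝 (((1 : ℝ) : ℂ) * w)) :=
      Continuous.tendsto (by fun_prop) 1
    simpa using this.mono_left nhdsWithin_le_nhds
  have hslope : Tendsto (fun r : ℝ => ((1 - r : ℝ) : ℂ)⁻¹ * charFun α β a b (r * w)) (𝓝[<] 1)
      (𝓝 (-(deriv (charFun α β a b) w * w))) := by
    have hd : HasDerivAt (fun r : ℝ => charFun α β a b (r * w)) (deriv (charFun α β a b) w * w)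
        1 := by
      have h1 : HasDerivAt (charFun α β a b) (deriv (charFun α β a b) w) (((1 : ℝ) : ℂ) * w) := by
        rw [Complex.ofReal_one, one_mul]
        exact (differentiableAt_charFun α β a b hw.le hw1).hasDerivAt
      have h2 : HasDerivAt (fun z : ℂ => z * w) w ((1 : ℝ) : ℂ) := by
        simpa using (hasDerivAt_id ((1 : ℝ) : ℂ)).mul_const w
      exact (HasDerivAt.comp (h := fun z : ℂ => z * w) _ h1 h2).comp_ofReal
    have h3 := (hasDerivAt_iff_tendsto_slope.mp hd).neg.mono_left
      (nhdsWithin_mono 1 (fun r (hr : r < 1) => ne_of_lt hr))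
    refine h3.congr' ?_
    filter_upwards [self_mem_nhdsWithin] with r hr
    rw [slope_def_module]
    simp only [Complex.ofReal_one, one_mul, h0, sub_zero, Complex.real_smul]
    rw [← neg_mul, ← Complex.ofReal_neg, ← inv_neg, neg_sub, Complex.ofReal_inv]
  have hprod := hslope.mul habel
  rw [mul_zero] at hprod
  have hN : Tendsto (fun r : ℝ => x 1 * ((r * w) * (1 - r * w) ^ ((α : ℂ) - 2))) (𝓝[<] 1)
      (𝓝 (x 1 * (w * (1 - w) ^ ((α : ℂ) - 2)))) := by
    refine Tendsto.const_mul _ (hray.mul ?_)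
    exact (continuousAt_cpow_const hsl).tendsto.comp (tendsto_const_nhds.sub hray)
  have heq := tendsto_nhds_unique (hprod.congr' ?_) hN
  · rw [hx1] at heq
    refine mul_ne_zero hδ' (mul_ne_zero hw0 ?_) heq.symm
    rw [Complex.cpow_ne_zero_iff]
    exact Or.inl (Complex.slitPlane_ne_zero hsl)
  · filter_upwards [self_mem_nhdsWithin,
      mem_nhdsWithin_of_mem_nhds (lt_mem_nhds (show (0 : ℝ) < 1 by norm_num))] with r hr1 hr0
    have hr1' : r < 1 := hr1
    rw [← charFun_mul_tsum_eq hβ₀ hβ₁ hα₁ hα₂ hx hx0 hC' (w := r * w)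
      (by rw [norm_mul, hw, mul_one, Complex.norm_real, Real.norm_of_nonneg hr0.le]; exact hr1')]
    have : ((1 - r : ℝ) : ℂ) ≠ 0 := Complex.ofReal_ne_zero.mpr (by linarith)
    field_simp

/-- For `b = 1` every constant sequence is a solution. This settles the circle zero `w = 1`, which
the Abel argument leaves out. -/
theorem not_isAsympStableSystem_one {α β a : ℝ} (hβ₀ : 0 < β) (hα₁ : 1 < α) :
    ¬ IsAsympStableSystem α β a 1 := by
  rintro ⟨-, δ, hδ, h⟩
  have hc : ∀ μ : ℝ, 0 < μ → ∀ n, caputoDiff μ (fun _ => ((δ / 2 : ℝ) : ℂ)) n = 0 := by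
    intro μ hμ n
    obtain ⟨m, hm⟩ := Nat.exists_eq_succ_of_ne_zero (Nat.ceil_pos.mpr hμ).ne'
    have h0 : fwdDiff (1 : ℕ) (fun _ : ℕ => ((δ / 2 : ℝ) : ℂ)) = fun _ => 0 := by
      ext; simp [fwdDiff]
    have h1 : ∀ k, (fwdDiff (1 : ℕ))^[k] (fun _ : ℕ => (0 : ℂ)) = fun _ => 0 := by
      intro k
      induction k with
      | zero => rfl
      | succ k ih => rw [Function.iterate_succ_apply', ih]; ext; simp [fwdDiff]
    rw [caputoDiff, hm, Function.iterate_succ_apply, h0, h1]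
    simp [fracSum]
  have hn : ‖((δ / 2 : ℝ) : ℂ)‖ < δ := by
    rw [Complex.norm_real, Real.norm_of_nonneg (by linarith)]; linarith
  have := h (fun _ => ((δ / 2 : ℝ) : ℂ)) (fun n => by
    rw [hc α (by linarith), hc β hβ₀]; simp) hn hn
  have h2 := tendsto_nhds_unique this tendsto_const_nhds
  exact (Complex.ofReal_ne_zero.mpr (show δ / 2 ≠ 0 by linarith)) h2.symm

/-! ### Absence of zeros implies asymptotic stability. -/

/-- The kernels of orders `2 - α` and `1 - β`, both in `[0, 1)`, tend to zero but need not be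
summable. This is why convolution is inverted on null sequences rather than on summable ones. -/
theorem exists_null_sequence_dataSeries {α β : ℝ} (hβ₀ : 0 < β) (hβ₁ : β ≤ 1)
    (hα₁ : 1 < α) (hα₂ : α ≤ 2) (a : ℝ) :
    ∃ K : ℝ, 0 < K ∧ ∀ p q : ℂ, ∃ f : ZeroAtInftyContinuousMap ℕ ℂ,
      ‖f‖ ≤ K * (‖p‖ + ‖q‖) ∧ PowerSeries.mk f = dataSeries α β a p q := by
  set u : ℕ → ℝ := fracKernel (2 - α)
  set v : ℕ → ℝ := fracKernel (1 - β)
  have hu0 : ∀ n, ‖(u n : ℂ)‖ ≤ 1 := fun n => by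
    rw [Complex.norm_real, Real.norm_of_nonneg (fracKernel_nonneg (by linarith) n)]
    exact (fracKernel_antitone (by linarith) (by linarith) (Nat.zero_le n)).trans
      (fracKernel_zero_right _).le
  have hv0 : ∀ n, ‖(v n : ℂ)‖ ≤ 1 := fun n => by
    rw [Complex.norm_real, Real.norm_of_nonneg (fracKernel_nonneg (by linarith) n)]
    exact (fracKernel_antitone (by linarith) (by linarith) (Nat.zero_le n)).trans
      (fracKernel_zero_right _).le
  have hu : Tendsto (fun n => (u n : ℂ)) atTop (𝓝 0) := by
    rw [← Complex.ofReal_zero]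
    have h := tendsto_fracKernel (ν := 2 - α) (by linarith) (by linarith)
    exact (Complex.continuous_ofReal.tendsto 0).comp h
  have hv : Tendsto (fun n => (v n : ℂ)) atTop (𝓝 0) := by
    rw [← Complex.ofReal_zero]
    have h := tendsto_fracKernel (ν := 1 - β) (by linarith) (by linarith)
    exact (Complex.continuous_ofReal.tendsto 0).comp h
  refine ⟨3 + |a|, by positivity, fun p q => ?_⟩
  have hcoeff : ∀ n, PowerSeries.coeff (n + 1) (dataSeries α β a p q) =
      p * u (n + 1) + (q - 2 * p) * u n + a * p * v n := by
    intro n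
    have : dataSeries α β a p q = PowerSeries.C p * kernelSeries (2 - α) +
        PowerSeries.C (q - 2 * p) * (PowerSeries.X * kernelSeries (2 - α)) +
        PowerSeries.C (a * p) * (PowerSeries.X * kernelSeries (1 - β)) := by
      rw [dataSeries]; ring
    rw [this, map_add, map_add, PowerSeries.coeff_C_mul, PowerSeries.coeff_C_mul,
      PowerSeries.coeff_C_mul, PowerSeries.coeff_succ_X_mul, PowerSeries.coeff_succ_X_mul]
    simp [kernelSeries, u, v]
  have h0 : PowerSeries.coeff 0 (dataSeries α β a p q) = p := by
    simp [dataSeries, constantCoeff_kernelSeries]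
  have hlim : Tendsto (fun n => PowerSeries.coeff n (dataSeries α β a p q)) atTop (𝓝 0) := by
    rw [← tendsto_add_atTop_iff_nat 1]
    simp only [hcoeff]
    have := (((tendsto_add_atTop_iff_nat 1).mpr hu).const_mul p).add
      (hu.const_mul (q - 2 * p)) |>.add (hv.const_mul (a * p))
    simpa using this
  refine ⟨{ toFun := fun n => PowerSeries.coeff n (dataSeries α β a p q)
            continuous_toFun := continuous_of_discreteTopology
            zero_at_infty' := by rwa [cocompact_eq_atTop (α := ℕ)] }, ?_, by ext; simp⟩
  rw [← ZeroAtInftyContinuousMap.norm_toBCF_eq_norm,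
    BoundedContinuousFunction.norm_le (by positivity)]
  have hp := norm_nonneg p
  have hq := norm_nonneg q
  have ha := abs_nonneg a
  rintro (_ | n)
  · change ‖PowerSeries.coeff 0 (dataSeries α β a p q)‖ ≤ _
    rw [h0]
    nlinarith [mul_nonneg ha hp, mul_nonneg ha hq]
  · change ‖PowerSeries.coeff (n + 1) (dataSeries α β a p q)‖ ≤ _
    rw [hcoeff]
    have h1 : ‖p * (u (n + 1) : ℂ)‖ ≤ ‖p‖ := by
      rw [norm_mul]; exact mul_le_of_le_one_right hp (hu0 _)
    have h2 : ‖(q - 2 * p) * (u n : ℂ)‖ ≤ ‖q‖ + 2 * ‖p‖ := by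
      rw [norm_mul]
      refine (mul_le_of_le_one_right (norm_nonneg _) (hu0 _)).trans ((norm_sub_le _ _).trans ?_)
      simp
    have h3 : ‖(a : ℂ) * p * (v n : ℂ)‖ ≤ |a| * ‖p‖ := by
      rw [norm_mul, norm_mul, Complex.norm_real, Real.norm_eq_abs]
      exact mul_le_of_le_one_right (by positivity) (hv0 _)
    refine (norm_add₃_le).trans ?_
    nlinarith [mul_nonneg ha hp, mul_nonneg ha hq]

/-- If the characteristic function has no zeros in the closed unit disc, the equation is
asymptotically stable. -/
theorem isAsympStableSystem_of_charFun_ne_zero {α β a : ℝ} (hβ₀ : 0 < β) (hβ₁ : β ≤ 1)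
    (hα₁ : 1 < α) (hα₂ : α ≤ 2) {b : ℂ} (h : ∀ w : ℂ, ‖w‖ ≤ 1 → charFun α β a b w ≠ 0) :
    IsAsympStableSystem α β a b := by
  have hq := summable_norm_coeff_charSeries hβ₀ hβ₁ hα₁ hα₂ a b
  obtain ⟨C, hC, hinv⟩ := exists_convolution_inverse hq fun w hw => by
    rw [(seriesHasSum_charSeries hβ₀ hβ₁ hα₁ hα₂ a b hw).tsum_eq]
    exact h w hw
  obtain ⟨K, hK, hdata⟩ := exists_null_sequence_dataSeries hβ₀ hβ₁ hα₁ hα₂ a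
  have key : ∀ x : ℕ → ℂ, IsSolution α β a b x →
      (∀ n, ‖x n‖ ≤ C * (K * (‖x 0‖ + ‖x 1‖))) ∧ Tendsto x atTop (𝓝 0) := by
    intro x hx
    rw [isSolution_iff hβ₀ hβ₁ hα₁ hα₂] at hx
    obtain ⟨f, hf, hfd⟩ := hdata (x 0) (x 1)
    obtain ⟨y, hy, hyf⟩ := hinv f
    have hm : (PowerSeries.mk fun k => PowerSeries.coeff k (charSeries α β a b)) =
        charSeries α β a b := by ext; simp
    rw [hfd, ← hx, hm] at hyf
    have hne : charSeries α β a b ≠ 0 := fun h0 => by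
      have := constantCoeff_charSeries α β a b
      simp [h0] at this
    have hxy : x = y := by
      ext n
      have := congrArg (PowerSeries.coeff n) (mul_left_cancel₀ hne hyf)
      simpa using this.symm
    constructor
    · intro n
      rw [hxy]
      refine (y.toBCF.norm_coe_le_norm n).trans ?_
      rw [ZeroAtInftyContinuousMap.norm_toBCF_eq_norm, ← hxy]
      exact hy.trans (mul_le_mul_of_nonneg_left hf hC)
    · rw [hxy, ← cocompact_eq_atTop (α := ℕ)]
      exact y.zero_at_infty'
  -- The summand `1` keeps the denominator positive, as `C` may be zero; the factor `2` splits `ε`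
  -- between the two initial values.
  refine ⟨fun ε hε => ⟨ε / (2 * (C * K + 1)), by positivity, fun x hx h0 h1 n => ?_⟩,
    1, one_pos, fun x hx _ _ => (key x hx).2⟩
  refine ((key x hx).1 n).trans_lt ?_
  have hD : 0 < C * K + 1 := by positivity
  have h2 : ‖x 0‖ + ‖x 1‖ < ε / (C * K + 1) := by
    have : ε / (C * K + 1) = ε / (2 * (C * K + 1)) + ε / (2 * (C * K + 1)) := by field_simp; norm_num
    linarith
  calc C * (K * (‖x 0‖ + ‖x 1‖)) = (C * K) * (‖x 0‖ + ‖x 1‖) := by ring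
    _ ≤ (C * K + 1) * (‖x 0‖ + ‖x 1‖) := by gcongr; linarith
    _ < (C * K + 1) * (ε / (C * K + 1)) := by gcongr
    _ = ε := by field_simp

/-! ### Zeros of analytic families on the disc under change of parameters. -/

section Persistence

variable {T : Type*} [TopologicalSpace T] {f : T → ℂ → ℂ}

theorem eventually_eq_on_ball_of_eventually_eq {g h : ℂ → ℂ}
    (hg : DifferentiableOn ℂ g (Metric.ball 0 1)) (hh : DifferentiableOn ℂ h (Metric.ball 0 1))
    {w₀ : ℂ} (hw₀ : w₀ ∈ Metric.ball (0 : ℂ) 1) (he : ∀ᶠ z in 𝓝 w₀, g z = h z) :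
    Set.EqOn g h (Metric.ball 0 1) :=
  (hg.analyticOnNhd Metric.isOpen_ball).eqOn_of_preconnected_of_eventuallyEq
    (hh.analyticOnNhd Metric.isOpen_ball) (convex_ball (0 : ℂ) 1).isPreconnected hw₀ he

/-- Zeros in the open disc persist under small changes of the parameter. -/
theorem eventually_exists_zero (hcont : ContinuousOn (Function.uncurry f)
      (Set.univ ×ˢ Metric.closedBall 0 1))
    (hd : ∀ t, DifferentiableOn ℂ (f t) (Metric.ball 0 1)) {t₀ : T} (hne : f t₀ 0 ≠ 0) {w₀ : ℂ}
    (hw₀ : ‖w₀‖ < 1) (h0 : f t₀ w₀ = 0) :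
    ∀ᶠ t in 𝓝 t₀, ∃ w, ‖w‖ < 1 ∧ f t w = 0 := by
  have hw₀' : w₀ ∈ Metric.ball (0 : ℂ) 1 := by simpa using hw₀
  have hiso : ∀ᶠ z in 𝓝[≠] w₀, f t₀ z ≠ 0 := by
    rcases ((hd t₀).analyticOnNhd Metric.isOpen_ball w₀ hw₀').eventually_eq_zero_or_eventually_ne_zero
      with h | h
    · exact absurd (eventually_eq_on_ball_of_eventually_eq (hd t₀) (differentiableOn_const 0) hw₀' h
        (Metric.mem_ball_self one_pos)) hne
    · exact h
  rw [eventually_nhdsWithin_iff] at hiso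
  obtain ⟨r, hr, hrsub⟩ := Metric.nhds_basis_closedBall.mem_iff.mp
    (hiso.and (Metric.isOpen_ball.mem_nhds hw₀'))
  have hsph : ∀ z ∈ Metric.sphere w₀ r, f t₀ z ≠ 0 := fun z hz =>
    (hrsub (Metric.sphere_subset_closedBall hz)).1 (fun h => by
      rw [Set.mem_singleton_iff.mp h] at hz
      simp at hz
      exact hr.ne hz)
  have hball : Metric.closedBall w₀ r ⊆ Metric.ball 0 1 := fun z hz => (hrsub hz).2
  have hc : ContinuousOn (f t₀) (Metric.closedBall w₀ r) := ((hd t₀).mono hball).continuousOn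
  obtain ⟨z₁, hz₁, hmin⟩ := (isCompact_sphere w₀ r).exists_isMinOn
    (NormedSpace.sphere_nonempty.mpr hr.le) (hc.mono Metric.sphere_subset_closedBall).norm
  set m := ‖f t₀ z₁‖ with hm
  have hmpos : 0 < m := norm_pos_iff.mpr (hsph z₁ hz₁)
  -- With `|f t₀| ≥ m` on the circle around `w₀`, a perturbation below `m/4` leaves `|f t z - f t
  -- w₀| ≥ m/2` there. The quantitative open mapping theorem then covers the disc of radius `m/4`
  -- around `f t w₀`, and this disc contains `0`.
  have hunif : ∀ᶠ t in 𝓝 t₀, ∀ z ∈ Metric.closedBall w₀ r, ‖f t z - f t₀ z‖ < m / 4 := by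
    refine (isCompact_closedBall w₀ r).eventually_forall_of_forall_eventually fun z hz => ?_
    have h1 : ContinuousAt (Function.uncurry f) (t₀, z) :=
      hcont.continuousAt (prod_mem_nhds univ_mem
        (mem_of_superset (Metric.isOpen_ball.mem_nhds (hball hz)) Metric.ball_subset_closedBall))
    have h2 : ContinuousAt (fun p : T × ℂ => f t₀ p.2) (t₀, z) :=
      ContinuousAt.comp (g := f t₀) (((hd t₀).differentiableAt
        (Metric.isOpen_ball.mem_nhds (hball hz))).continuousAt) continuousAt_snd
    have h3 := (h1.sub h2).norm
    refine h3.eventually_lt continuousAt_const ?_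
    simpa [Function.uncurry] using hmpos
  filter_upwards [hunif] with t ht
  have hw₀t : ‖f t w₀‖ < m / 4 := by
    simpa [h0] using ht w₀ (Metric.mem_closedBall_self hr.le)
  have hlow : ∀ z ∈ Metric.sphere w₀ r, m / 2 ≤ ‖f t z - f t w₀‖ := by
    intro z hz
    have h1 := ht z (Metric.sphere_subset_closedBall hz)
    have h2 : m ≤ ‖f t₀ z‖ := hmin hz
    have h3 : ‖f t₀ z‖ ≤ ‖f t z - f t w₀‖ + ‖f t w₀‖ + ‖f t z - f t₀ z‖ := by
      have : f t₀ z = (f t z - f t w₀) + f t w₀ - (f t z - f t₀ z) := by ring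
      calc ‖f t₀ z‖ = ‖(f t z - f t w₀) + f t w₀ - (f t z - f t₀ z)‖ := by rw [← this]
        _ ≤ _ := (norm_sub_le _ _).trans (by gcongr; exact norm_add_le _ _)
    linarith
  have hdc : DiffContOnCl ℂ (f t) (Metric.ball w₀ r) :=
    ((hd t).mono (by rw [closure_ball _ hr.ne']; exact hball)).diffContOnCl
  have hfreq : ∃ᶠ z in 𝓝 w₀, f t z ≠ f t w₀ := by
    intro hcon
    have := eventually_eq_on_ball_of_eventually_eq (hd t) (differentiableOn_const (f t w₀)) hw₀'
      (hcon.mono fun z hz => not_not.mp hz) (hball (Metric.sphere_subset_closedBall hz₁))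
    have h1 := hlow z₁ hz₁
    rw [this, sub_self, norm_zero] at h1
    linarith
  obtain ⟨w, hw, hw0⟩ := hdc.ball_subset_image_closedBall hr hlow hfreq
    (show (0 : ℂ) ∈ _ by rw [mem_ball_iff_norm, zero_sub, norm_neg]; linarith)
  exact ⟨w, by simpa using hball hw, hw0⟩

/-- The absence of zeros in the closed disc persists under small changes of the parameter. -/
theorem eventually_forall_ne_zero (hcont : ContinuousOn (Function.uncurry f)
      (Set.univ ×ˢ Metric.closedBall 0 1)) {t₀ : T} (h : ∀ w, ‖w‖ ≤ 1 → f t₀ w ≠ 0) :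
    ∀ᶠ t in 𝓝 t₀, ∀ w, ‖w‖ ≤ 1 → f t w ≠ 0 := by
  have := (isCompact_closedBall (0 : ℂ) 1).eventually_forall_of_forall_eventually (x₀ := t₀)
    (P := fun t w => w ∈ Metric.closedBall (0 : ℂ) 1 → f t w ≠ 0) fun z hz => by
      have h1 := (hcont (t₀, z) ⟨trivial, hz⟩).eventually_ne (h z (by simpa using hz))
      rw [eventually_nhdsWithin_iff] at h1
      filter_upwards [h1] with p hp hp2
      exact hp ⟨trivial, hp2⟩
  filter_upwards [this] with t ht w hw
  exact ht w (by simpa using hw) (by simpa using hw)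

/-- Along a connected family without zeros on the unit circle, zeros in the open disc either always
exist or never exist. -/
theorem exists_zero_of_preconnected [PreconnectedSpace T] (hcont : ContinuousOn (Function.uncurry f)
      (Set.univ ×ˢ Metric.closedBall 0 1))
    (hd : ∀ t, DifferentiableOn ℂ (f t) (Metric.ball 0 1)) (hne : ∀ t, f t 0 ≠ 0)
    (hcirc : ∀ t w, ‖w‖ = 1 → f t w ≠ 0) {t₀ : T} (h₀ : ∃ w, ‖w‖ < 1 ∧ f t₀ w = 0) (t : T) :
    ∃ w, ‖w‖ < 1 ∧ f t w = 0 := by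
  -- The set of parameters with an inner zero is clopen: inner zeros persist, and without circle
  -- zeros the absence of inner zeros means absence on the whole compact disc, which persists too.
  have hopen : IsOpen {t | ∃ w, ‖w‖ < 1 ∧ f t w = 0} := by
    rw [isOpen_iff_mem_nhds]
    rintro t ⟨w, hw, h0⟩
    exact eventually_exists_zero hcont hd (hne t) hw h0
  have hclosed : IsClosed {t | ∃ w, ‖w‖ < 1 ∧ f t w = 0} := by
    rw [← isOpen_compl_iff, isOpen_iff_mem_nhds]
    intro t ht
    have : ∀ w, ‖w‖ ≤ 1 → f t w ≠ 0 := fun w hw h0 => by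
      rcases hw.lt_or_eq with hw | hw
      · exact ht ⟨w, hw, h0⟩
      · exact hcirc t w hw h0
    filter_upwards [eventually_forall_ne_zero hcont this] with s hs
    rintro ⟨w, hw, h0⟩
    exact hs w hw.le h0
  have := IsClopen.eq_univ ⟨hclosed, hopen⟩ ⟨t₀, h₀⟩
  exact (this ▸ Set.mem_univ t : t ∈ {t | ∃ w, ‖w‖ < 1 ∧ f t w = 0})

end Persistence

/-! ### Inner zeros: transport along connected parameter sets and existence for large `b`. -/

/-- The characteristic function has a zero in the open unit disc. -/
def HasInnerZero (α β a : ℝ) (b : ℂ) : Prop :=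
  ∃ w : ℂ, ‖w‖ < 1 ∧ charFun α β a b w = 0

theorem charFun_zero (α β a : ℝ) (b : ℂ) : charFun α β a b 0 = 1 := by
  simp [charFun]

theorem charFun_one {α β : ℝ} (hα : 0 < α) (hβ : 0 < β) (a : ℝ) (b : ℂ) :
    charFun α β a b 1 = 1 - b := by
  simp [charFun, hα.ne', hβ.ne']

theorem differentiableOn_charFun (α β a : ℝ) (b : ℂ) :
    DifferentiableOn ℂ (charFun α β a b) (Metric.ball 0 1) := fun w hw => by
  rw [mem_ball_zero_iff] at hw
  exact (differentiableAt_charFun α β a b hw.le (by rintro rfl; simp at hw)).differentiableWithinAt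

theorem hasInnerZero_of_isPreconnected {α β : ℝ} (hα : 0 < α) (hβ : 0 < β) {S : Set (ℝ × ℂ)}
    (hS : IsPreconnected S) (hcirc : ∀ p ∈ S, ∀ w, ‖w‖ = 1 → charFun α β p.1 p.2 w ≠ 0)
    {p q : ℝ × ℂ} (hp : p ∈ S) (hq : q ∈ S) (h : HasInnerZero α β p.1 p.2) :
    HasInnerZero α β q.1 q.2 := by
  have := Subtype.preconnectedSpace hS
  have hcont : ContinuousOn (Function.uncurry fun (t : S) w => charFun α β t.1.1 t.1.2 w)
      (Set.univ ×ˢ Metric.closedBall 0 1) :=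
    (continuousOn_charFun_uncurry hα hβ).comp (f := fun x : S × ℂ => (x.1.1, x.2))
      (by fun_prop) fun x hx => ⟨trivial, hx.2⟩
  exact exists_zero_of_preconnected hcont (fun t => differentiableOn_charFun α β t.1.1 t.1.2)
    (fun t => by rw [charFun_zero]; exact one_ne_zero) (fun t w hw => hcirc t.1 t.2 w hw)
    (t₀ := ⟨p, hp⟩) h ⟨q, hq⟩

theorem eventually_hasInnerZero {α β : ℝ} (hα : 0 < α) (hβ : 0 < β) {a : ℝ} {b : ℂ}
    (h : HasInnerZero α β a b) : ∀ᶠ b' in 𝓝 b, HasInnerZero α β a b' := by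
  obtain ⟨w, hw, h0⟩ := h
  have hcont : ContinuousOn (Function.uncurry fun b w => charFun α β a b w)
      (Set.univ ×ˢ Metric.closedBall 0 1) :=
    (continuousOn_charFun_uncurry hα hβ).comp (f := fun x : ℂ × ℂ => ((a, x.1), x.2))
      (by fun_prop) fun x hx => ⟨trivial, hx.2⟩
  exact eventually_exists_zero hcont (differentiableOn_charFun α β a)
    (by rw [charFun_zero]; exact one_ne_zero) hw h0

/-- For large `b` there is a zero in the open unit disc. -/
theorem exists_hasInnerZero_of_lt_norm (α β a : ℝ) :
    ∃ M : ℝ, ∀ b : ℂ, M < ‖b‖ → HasInnerZero α β a b := by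
  have hQ : AnalyticAt ℂ (charFun α β a 1) 0 :=
    (differentiableOn_charFun α β a 1).analyticAt (Metric.ball_mem_nhds 0 one_pos)
  have hQ0 : charFun α β a 1 0 ≠ 0 := by rw [charFun_zero]; exact one_ne_zero
  have hne : ∀ᶠ w in 𝓝 (0 : ℂ), charFun α β a 1 w ≠ 0 := hQ.continuousAt.eventually_ne hQ0
  -- A zero for `b` is a solution of `H w = 1/(b - 1)`. The nonconstant analytic function `H`
  -- vanishes at `0` and is open there, so it attains all small values.
  set H : ℂ → ℂ := fun w => w ^ 2 / charFun α β a 1 w with hH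
  have hHan : AnalyticAt ℂ H 0 := (analyticAt_id.pow 2).div hQ hQ0
  have hH0 : H 0 = 0 := by simp [hH]
  have hU : {w : ℂ | ‖w‖ < 1 ∧ charFun α β a 1 w ≠ 0} ∈ 𝓝 (0 : ℂ) := by
    filter_upwards [hne, Metric.ball_mem_nhds (0 : ℂ) one_pos] with w h1 h2
    exact ⟨by simpa using h2, h1⟩
  rcases hHan.eventually_constant_or_nhds_le_map_nhds with h | h
  · exfalso
    have h2 : ∀ᶠ w in 𝓝[≠] (0 : ℂ), False := by
      filter_upwards [nhdsWithin_le_nhds h, nhdsWithin_le_nhds hne, self_mem_nhdsWithin]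
        with w h1 h2 h3
      rw [hH0] at h1
      exact (div_ne_zero (pow_ne_zero 2 h3) h2) h1
    exact h2.exists.elim fun _ h3 => h3
  · obtain ⟨ε, hε, hsub⟩ := Metric.mem_nhds_iff.mp (h (image_mem_map hU))
    rw [hH0] at hsub
    refine ⟨1 + 1 / ε, fun b hb => ?_⟩
    have hb1 : 1 / ε < ‖b - 1‖ := by
      have := norm_sub_norm_le b 1
      rw [norm_one] at this
      linarith
    have hb0 : 0 < ‖b - 1‖ := (by positivity : 0 < 1 / ε).trans hb1
    obtain ⟨w, ⟨hw, hQw⟩, hwb⟩ := hsub (show (b - 1)⁻¹ ∈ Metric.ball (0 : ℂ) ε by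
      rw [mem_ball_zero_iff, norm_inv]
      exact inv_lt_of_inv_lt₀ hε (by rwa [← one_div]))
    refine ⟨w, hw, ?_⟩
    have hbne : b - 1 ≠ 0 := norm_pos_iff.mp hb0
    have h1 : w ^ 2 / charFun α β a 1 w = (b - 1)⁻¹ := hwb
    rw [div_eq_iff hQw, eq_inv_mul_iff_mul_eq₀ hbne] at h1
    have h2 : charFun α β a b w = charFun α β a 1 w - (b - 1) * w ^ 2 := by
      simp only [charFun]; ring
    rw [h2, h1, sub_self]

/-! ### A local argument at a zero on the unit circle. -/

/-- If a map moves points just inside the unit circle radially outwards from the origin near `w₀`,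
then it omits there the values on the segment from `0` to `f w₀`. -/
theorem eventually_ne_of_re_neg {f : ℂ → ℂ} {f' w₀ : ℂ} (hf : HasDerivAt f f' w₀) (hw₀ : ‖w₀‖ = 1)
    (hneg : (w₀ * f' / f w₀).re < 0) :
    ∀ᶠ w in 𝓝 w₀, ‖w‖ < 1 → ∀ τ : ℝ, 0 < τ → f w ≠ (1 - τ) * f w₀ := by
  have hg : f w₀ ≠ 0 := fun h => by simp [h] at hneg
  have hw0 : w₀ ≠ 0 := fun h => by simp [h] at hw₀
  set κ := w₀ * f' / f w₀ with hκ
  set ρ := -κ.re with hρ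
  have hρ0 : 0 < ρ := by linarith
  have hk : ρ ≤ ‖κ‖ := by
    have := Complex.abs_re_le_norm κ
    rw [abs_of_neg hneg] at this
    exact this
  have hlo := (hasDerivAt_iff_isLittleO.mp hf).def
    (show 0 < ρ / 4 * ‖f w₀‖ by have := norm_pos_iff.mpr hg; positivity)
  filter_upwards [hlo] with w hw hw1 τ hτ heq
  set ζ := (w - w₀) / w₀ with hζ
  have hζn : ‖w - w₀‖ = ‖ζ‖ := by rw [hζ, norm_div, hw₀, div_one]
  set e := (f w - f w₀ - (w - w₀) • f') / f w₀ with he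
  have hen : ‖e‖ ≤ ρ / 4 * ‖ζ‖ := by
    rw [he, norm_div, div_le_iff₀ (norm_pos_iff.mpr hg), ← hζn]
    linarith
  -- With `w = w₀ (1 + ζ)`, linearization gives `κ ζ = -τ` up to an error, so `Re ζ ≈ τ ρ / |κ|² >
  -- 0`. But `|w| < 1` forces `Re ζ < 0`. The margin `ρ/4` keeps the error too small to change the
  -- sign, because `ρ ≤ |κ|`.
  have hid : κ * ζ = -(τ : ℂ) - e := by
    rw [he, heq, hκ, hζ, smul_eq_mul]
    field_simp
    ring
  have hre : ζ.re < 0 := by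
    have h1 : ‖1 + ζ‖ = ‖w‖ := by
      have : w = w₀ * (1 + ζ) := by rw [hζ]; field_simp; ring
      rw [this, norm_mul, hw₀, one_mul]
    have h2 := Complex.re_le_norm (1 + ζ)
    simp at h2
    linarith
  have h1 : ‖κ‖ ^ 2 * ζ.re = τ * ρ - ((starRingEnd ℂ) κ * e).re := by
    have : (starRingEnd ℂ) κ * (κ * ζ) = ((‖κ‖ ^ 2 : ℝ) : ℂ) * ζ := by
      rw [← mul_assoc, mul_comm ((starRingEnd ℂ) κ), Complex.mul_conj, Complex.normSq_eq_norm_sq]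
    have h2 := congrArg Complex.re this
    rw [Complex.re_ofReal_mul, hid, mul_sub, Complex.sub_re] at h2
    rw [← h2, hρ]
    simp
    ring
  have h2 : ((starRingEnd ℂ) κ * e).re ≤ ‖κ‖ * (ρ / 4 * ‖ζ‖) := by
    refine (Complex.re_le_norm _).trans ?_
    rw [norm_mul, RCLike.norm_conj]
    gcongr
  have h3 : ‖κ‖ * ‖ζ‖ ≤ τ + ρ / 4 * ‖ζ‖ := by
    rw [← norm_mul, hid]
    refine (norm_sub_le _ _).trans ?_
    rw [norm_neg, Complex.norm_real, Real.norm_of_nonneg hτ.le]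
    linarith
  have hz := norm_nonneg ζ
  have h4 : 0 < ‖κ‖ ^ 2 := by have := hρ0.trans_le hk; positivity
  have h5 : ‖κ‖ ^ 2 * ζ.re < 0 := mul_neg_of_pos_of_neg h4 hre
  have h6 : (‖κ‖ * ‖ζ‖ - ρ / 4 * ‖ζ‖) * ρ ≤ τ * ρ := by
    gcongr; linarith
  have h7 : ρ * (ρ * ‖ζ‖) ≤ ‖κ‖ * (ρ * ‖ζ‖) := by gcongr
  have h8 : 0 ≤ ‖κ‖ * (ρ * ‖ζ‖) := by positivity
  nlinarith

/-! ### The boundary curve in the angle `δ = π - θ`. -/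

/-- The power `|1 - w| ^ μ` at the point `w = -exp (i δ)` of the unit circle. -/
noncomputable def chordPow (μ δ : ℝ) : ℝ :=
  (2 * Real.cos (δ / 2)) ^ μ

/-- Real part of the boundary curve relative to `1`, in terms of the angle `δ = π - θ`. -/
noncomputable def arcRe (α β a δ : ℝ) : ℝ :=
  chordPow α δ * Real.cos ((2 - α / 2) * δ) - a * chordPow β δ * Real.cos ((1 - β / 2) * δ)

/-- Imaginary part of the boundary curve, in terms of the angle `δ = π - θ`. -/
noncomputable def arcIm (α β a δ : ℝ) : ℝ :=
  a * chordPow β δ * Real.sin ((1 - β / 2) * δ) - chordPow α δ * Real.sin ((2 - α / 2) * δ)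

theorem two_mul_cos_half_pos {δ : ℝ} (h : |δ| < Real.pi) : 0 < 2 * Real.cos (δ / 2) := by
  rw [abs_lt] at h
  exact mul_pos two_pos (Real.cos_pos_of_mem_Ioo ⟨by linarith, by linarith⟩)

theorem gammaRe_pi_sub (α β a : ℝ) {δ : ℝ} (h : |δ| ≤ Real.pi) :
    gammaRe α β a (Real.pi - δ) = 1 + arcRe α β a δ := by
  rw [abs_le] at h
  have hc : 0 ≤ Real.cos (δ / 2) := Real.cos_nonneg_of_mem_Icc ⟨by linarith, by linarith⟩
  have h1 : Real.sin ((Real.pi - δ) / 2) = Real.cos (δ / 2) := by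
    rw [← Real.sin_pi_div_two_sub]; ring_nf
  have h2 : α * Real.pi / 2 + (Real.pi - δ) * (2 - α / 2) = 2 * Real.pi - (2 - α / 2) * δ := by ring
  have h3 : β * Real.pi / 2 + (Real.pi - δ) * (1 - β / 2) = Real.pi - (1 - β / 2) * δ := by ring
  rw [gammaRe, arcRe, h1, h2, h3, Real.cos_two_pi_sub, Real.cos_pi_sub, chordPow, chordPow,
    Real.mul_rpow two_pos.le hc, Real.mul_rpow two_pos.le hc]
  ring

theorem gammaIm_pi_sub (α β a : ℝ) {δ : ℝ} (h : |δ| ≤ Real.pi) :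
    gammaIm α β a (Real.pi - δ) = arcIm α β a δ := by
  rw [abs_le] at h
  have hc : 0 ≤ Real.cos (δ / 2) := Real.cos_nonneg_of_mem_Icc ⟨by linarith, by linarith⟩
  have h1 : Real.sin ((Real.pi - δ) / 2) = Real.cos (δ / 2) := by
    rw [← Real.sin_pi_div_two_sub]; ring_nf
  have h2 : α * Real.pi / 2 + (Real.pi - δ) * (2 - α / 2) = 2 * Real.pi - (2 - α / 2) * δ := by ring
  have h3 : β * Real.pi / 2 + (Real.pi - δ) * (1 - β / 2) = Real.pi - (1 - β / 2) * δ := by ring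
  rw [gammaIm, arcIm, h1, h2, h3, Real.sin_two_pi_sub, Real.sin_pi_sub, chordPow, chordPow,
    Real.mul_rpow two_pos.le hc, Real.mul_rpow two_pos.le hc]
  ring

/-- The half-angle form `1 + exp (i δ) = 2 cos (δ/2) exp (i δ/2)` has argument in `(-π/2, π/2)`, so
the principal power multiplies the argument by `μ`. -/
theorem one_add_exp_cpow (μ : ℝ) {δ : ℝ} (h : |δ| < Real.pi) :
    (1 - -Complex.exp (δ * Complex.I)) ^ (μ : ℂ) =
      chordPow μ δ * Complex.exp ((μ * δ / 2 : ℝ) * Complex.I) := by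
  have hr := two_mul_cos_half_pos h
  have h1 : 1 - -Complex.exp (δ * Complex.I) =
      ((2 * Real.cos (δ / 2) : ℝ) : ℂ) * Complex.exp ((δ / 2 : ℝ) * Complex.I) := by
    have h2 : Complex.exp (δ * Complex.I) =
        Complex.exp ((δ / 2 : ℝ) * Complex.I) * Complex.exp ((δ / 2 : ℝ) * Complex.I) := by
      rw [← Complex.exp_add]; push_cast; ring_nf
    have h3 : Complex.exp (-((δ / 2 : ℝ) : ℂ) * Complex.I) *
        Complex.exp ((δ / 2 : ℝ) * Complex.I) = 1 := by
      rw [← Complex.exp_add]; simp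
    rw [Complex.ofReal_mul, Complex.ofReal_cos, Complex.cos]
    push_cast at h2 h3 ⊢
    linear_combination h2 - h3
  rw [abs_lt] at h
  have hl : Complex.log (Complex.exp ((δ / 2 : ℝ) * Complex.I)) = (δ / 2 : ℝ) * Complex.I :=
    Complex.log_exp (by simp; linarith) (by simp; linarith)
  rw [h1, Complex.cpow_def_of_ne_zero (mul_ne_zero (by exact_mod_cast hr.ne') (Complex.exp_ne_zero _)),
    Complex.log_ofReal_mul hr (Complex.exp_ne_zero _), hl, chordPow, Real.rpow_def_of_pos hr,
    Complex.ofReal_exp, ← Complex.exp_add]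
  push_cast
  ring_nf

/-- On the circle, `charFun` is the unimodular factor `w²` times the displacement from `b - 1` to
the curve. Zeros on the circle therefore correspond to values of `b` on the curve. -/
theorem charFun_neg_exp (α β a : ℝ) (b : ℂ) {δ : ℝ} (h : |δ| < Real.pi) :
    charFun α β a b (-Complex.exp (δ * Complex.I)) = Complex.exp ((2 * δ : ℝ) * Complex.I) *
      (arcRe α β a δ + arcIm α β a δ * Complex.I - (b - 1)) := by
  have e : ∀ x : ℝ, (Real.cos x : ℂ) - Real.sin x * Complex.I = Complex.exp (-x * Complex.I) := by
    intro x
    rw [neg_mul, ← mul_neg, ← neg_mul_eq_mul_neg, ← neg_mul, Complex.exp_mul_I]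
    simp [sub_eq_add_neg]
  have h1 : (arcRe α β a δ + arcIm α β a δ * Complex.I : ℂ) =
      chordPow α δ * Complex.exp (-((2 - α / 2) * δ : ℝ) * Complex.I) -
        a * chordPow β δ * Complex.exp (-((1 - β / 2) * δ : ℝ) * Complex.I) := by
    rw [← e, ← e, arcRe, arcIm]
    simp only [Complex.ofReal_mul, Complex.ofReal_sub]
    ring
  have e1 : Complex.exp ((α * δ / 2 : ℝ) * Complex.I) = Complex.exp ((2 * δ : ℝ) * Complex.I) *
      Complex.exp (-((2 - α / 2) * δ : ℝ) * Complex.I) := by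
    rw [← Complex.exp_add]; push_cast; ring_nf
  have e2 : Complex.exp (δ * Complex.I) * Complex.exp ((β * δ / 2 : ℝ) * Complex.I) =
      Complex.exp ((2 * δ : ℝ) * Complex.I) *
      Complex.exp (-((1 - β / 2) * δ : ℝ) * Complex.I) := by
    rw [← Complex.exp_add, ← Complex.exp_add]; push_cast; ring_nf
  have e3 : Complex.exp ((2 * δ : ℝ) * Complex.I) =
      Complex.exp (δ * Complex.I) * Complex.exp (δ * Complex.I) := by
    rw [← Complex.exp_add]; push_cast; ring_nf
  rw [charFun, one_add_exp_cpow α h, one_add_exp_cpow β h, h1]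
  linear_combination (chordPow α δ : ℂ) * e1 - a * chordPow β δ * e2 + (b - 1) * e3

theorem exists_eq_neg_exp {w : ℂ} (hw : ‖w‖ = 1) (hw1 : w ≠ 1) :
    ∃ δ : ℝ, |δ| < Real.pi ∧ w = -Complex.exp (δ * Complex.I) := by
  refine ⟨(-w).arg, ?_, ?_⟩
  · rw [abs_lt]
    refine ⟨Complex.neg_pi_lt_arg _, (Complex.arg_le_pi _).lt_of_ne fun h => hw1 ?_⟩
    have := Complex.norm_mul_exp_arg_mul_I (-w)
    rw [norm_neg, hw, h, Complex.exp_pi_mul_I] at this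
    simp at this
    exact this.symm
  · have := Complex.norm_mul_exp_arg_mul_I (-w)
    rw [norm_neg, hw, Complex.ofReal_one, one_mul] at this
    rw [this, neg_neg]

theorem charFun_neg_exp_eq_zero_iff (α β a : ℝ) (b : ℂ) {δ : ℝ} (h : |δ| < Real.pi) :
    charFun α β a b (-Complex.exp (δ * Complex.I)) = 0 ↔
      arcRe α β a δ = (b - 1).re ∧ arcIm α β a δ = (b - 1).im := by
  rw [charFun_neg_exp α β a b h, mul_eq_zero, or_iff_right (Complex.exp_ne_zero _), sub_eq_zero,
    Complex.ext_iff]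
  simp

theorem arcRe_neg (α β a δ : ℝ) : arcRe α β a (-δ) = arcRe α β a δ := by
  simp [arcRe, chordPow, neg_div]

theorem arcIm_neg (α β a δ : ℝ) : arcIm α β a (-δ) = -arcIm α β a δ := by
  simp [arcIm, chordPow, neg_div]
  ring

theorem arcIm_zero (α β a : ℝ) : arcIm α β a 0 = 0 := by
  simp [arcIm]

theorem arcRe_zero (α β a : ℝ) : arcRe α β a 0 = 2 ^ α - a * 2 ^ β := by
  simp [arcRe, chordPow]

theorem continuous_chordPow {μ : ℝ} (hμ : 0 ≤ μ) : Continuous (chordPow μ) := by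
  unfold chordPow
  exact Continuous.rpow_const (by fun_prop) fun _ => Or.inr hμ

theorem chordPow_split (α β : ℝ) {δ : ℝ} (h : |δ| < Real.pi) :
    chordPow α δ = chordPow β δ * chordPow (α - β) δ := by
  rw [chordPow, chordPow, chordPow, ← Real.rpow_add (two_mul_cos_half_pos h)]
  ring_nf

theorem chordPow_pos (μ : ℝ) {δ : ℝ} (h : |δ| < Real.pi) : 0 < chordPow μ δ :=
  Real.rpow_pos_of_pos (two_mul_cos_half_pos h) μ

theorem chordPow_strictAntiOn {μ : ℝ} (hμ : 0 < μ) :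
    StrictAntiOn (chordPow μ) (Set.Icc 0 Real.pi) := by
  intro x hx y hy hxy
  refine Real.rpow_lt_rpow ?_ ?_ hμ
  · exact mul_nonneg two_pos.le (Real.cos_nonneg_of_mem_Icc
      ⟨by linarith [hy.1, Real.pi_pos], by linarith [hy.2]⟩)
  · have := Real.cos_lt_cos_of_nonneg_of_le_pi (x := x / 2) (y := y / 2) (by linarith [hx.1])
      (by linarith [hy.2, Real.pi_pos]) (by linarith)
    linarith

theorem chordPow_zero_right (μ : ℝ) : chordPow μ 0 = 2 ^ μ := by
  simp [chordPow]

/-! ### Real points of the boundary curve. -/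

section Trigonometry

variable {α β a δ : ℝ}

theorem arcIm_eq (h : |δ| < Real.pi) : arcIm α β a δ = chordPow β δ *
    (a * Real.sin ((1 - β / 2) * δ) - chordPow (α - β) δ * Real.sin ((2 - α / 2) * δ)) := by
  rw [arcIm, chordPow_split α β h]; ring

theorem arcRe_eq (h : |δ| < Real.pi) : arcRe α β a δ = chordPow β δ *
    (chordPow (α - β) δ * Real.cos ((2 - α / 2) * δ) - a * Real.cos ((1 - β / 2) * δ)) := by
  rw [arcRe, chordPow_split α β h]; ring

theorem sin_lower_pos (hβ₀ : 0 < β) (hβ₁ : β ≤ 1) (h0 : 0 < δ) (h1 : δ ≤ Real.pi) :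
    0 < Real.sin ((1 - β / 2) * δ) := by
  refine Real.sin_pos_of_pos_of_lt_pi (mul_pos (by linarith) h0) ?_
  calc (1 - β / 2) * δ < 1 * δ := by gcongr; linarith
    _ ≤ Real.pi := by linarith

theorem sin_upper_pos (hα₂ : α ≤ 2) (h0 : 0 < δ) (h1 : δ < Real.pi / (2 - α / 2)) :
    0 < Real.sin ((2 - α / 2) * δ) := by
  have hu : 0 < 2 - α / 2 := by linarith
  refine Real.sin_pos_of_pos_of_lt_pi (mul_pos hu h0) ?_
  rwa [lt_div_iff₀ hu, mul_comm] at h1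

theorem sin_upper_nonpos (hα₁ : 1 < α) (hα₂ : α ≤ 2) (h0 : Real.pi / (2 - α / 2) ≤ δ)
    (h1 : δ < Real.pi) : Real.sin ((2 - α / 2) * δ) ≤ 0 := by
  have hu : 0 < 2 - α / 2 := by linarith
  rw [div_le_iff₀ hu, mul_comm] at h0
  have h2 : (2 - α / 2) * δ ≤ 2 * Real.pi := by
    have := Real.pi_pos
    nlinarith
  have := Real.sin_nonpos_of_nonpos_of_neg_pi_le (x := (2 - α / 2) * δ - 2 * Real.pi)
    (by linarith) (by linarith)
  rwa [Real.sin_sub_two_pi] at this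

theorem pi_div_le (hα₂ : α ≤ 2) : Real.pi / (2 - α / 2) ≤ Real.pi :=
  div_le_self Real.pi_pos.le (by linarith)

/-- Comparison of slopes of the sine function. -/
theorem mul_sin_lt_mul_sin (hβ₀ : 0 < β) (hβ₁ : β ≤ 1) (hα₁ : 1 < α) (hα₂ : α ≤ 2)
    (h0 : 0 < δ) (h1 : δ < Real.pi) :
    (1 - β / 2) * Real.sin ((2 - α / 2) * δ) < (2 - α / 2) * Real.sin ((1 - β / 2) * δ) := by
  have hu : 0 < 2 - α / 2 := by linarith
  have hv : 0 < 1 - β / 2 := by linarith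
  have hvs := sin_lower_pos hβ₀ hβ₁ h0 h1.le
  rcases lt_or_ge δ (Real.pi / (2 - α / 2)) with h | h
  · have h2 : (2 - α / 2) * δ < Real.pi := by rwa [lt_div_iff₀ hu, mul_comm] at h
    have hb : 0 < (1 - β / 2) / (2 - α / 2) := by positivity
    have hb1 : 0 < 1 - (1 - β / 2) / (2 - α / 2) := by
      rw [sub_pos, div_lt_one hu]; linarith
    have hy : 0 < (2 - α / 2) * δ := by positivity
    -- Up to `π / (2 - α/2)` this is strict concavity of the sine on the chord from `0`; beyond it
    -- the left side is nonpositive.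
    obtain ⟨-, hsc⟩ := strictConcaveOn_sin_Icc
    have hconc := hsc (Set.left_mem_Icc.mpr Real.pi_pos.le) ⟨hy.le, h2.le⟩ hy.ne hb1 hb (by ring)
    simp only [smul_eq_mul, mul_zero, Real.sin_zero, zero_add] at hconc
    rw [div_mul_eq_mul_div, div_lt_iff₀ hu, ← mul_assoc, div_mul_cancel₀ _ hu.ne'] at hconc
    linarith
  · have := sin_upper_nonpos hα₁ hα₂ h h1
    have h3 := mul_pos hu hvs
    nlinarith

theorem bifTwo_eq (hβ₁ : β ≤ 1) :
    (1 - β / 2) * bifTwo α β = (2 - α / 2) * bifOne α β := by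
  have : β - 2 ≠ 0 := by linarith
  rw [bifTwo, bifOne]
  field_simp
  ring

theorem bifOne_pos : 0 < bifOne α β := Real.rpow_pos_of_pos two_pos _

theorem bifOne_lt_bifTwo (hβ₀ : 0 < β) (hβ₁ : β ≤ 1) (hα₂ : α ≤ 2) :
    bifOne α β < bifTwo α β := by
  have h := bifTwo_eq (α := α) hβ₁
  have h1 := bifOne_pos (α := α) (β := β)
  have hv : 0 < 1 - β / 2 := by linarith
  refine lt_of_mul_lt_mul_left ?_ hv.le
  rw [h]
  exact mul_lt_mul_of_pos_right (by linarith) h1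

theorem chordPow_lt_bifOne (hβ₁ : β ≤ 1) (hα₁ : 1 < α) (h0 : 0 < δ) (h1 : δ ≤ Real.pi) :
    chordPow (α - β) δ < bifOne α β := by
  rw [bifOne, ← chordPow_zero_right]
  exact chordPow_strictAntiOn (by linarith) ⟨le_rfl, Real.pi_pos.le⟩ ⟨h0.le, h1⟩ h0

theorem abs_lt_pi_of_mem (h0 : 0 < δ) (h1 : δ < Real.pi) : |δ| < Real.pi := by
  rwa [abs_of_pos h0]

/-- The chord factor is below its value `a₁` at `δ = 0`, and the sine ratio is below its limit `u /
v` there, with `u = 2 - α/2` and `v = 1 - β/2`. The product of these two bounds is `a₂`. -/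
theorem chordPow_mul_sin_lt (hβ₀ : 0 < β) (hβ₁ : β ≤ 1) (hα₁ : 1 < α) (hα₂ : α ≤ 2)
    (h0 : 0 < δ) (h1 : δ < Real.pi) :
    chordPow (α - β) δ * Real.sin ((2 - α / 2) * δ) <
      bifTwo α β * Real.sin ((1 - β / 2) * δ) := by
  have hu : 0 < 2 - α / 2 := by linarith
  have hv : 0 < 1 - β / 2 := by linarith
  have hvs := sin_lower_pos hβ₀ hβ₁ h0 h1.le
  have hx := chordPow_lt_bifOne hβ₁ hα₁ h0 h1.le
  have hx0 := chordPow_pos (α - β) (abs_lt_pi_of_mem h0 h1)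
  have hs := mul_sin_lt_mul_sin hβ₀ hβ₁ hα₁ hα₂ h0 h1
  refine lt_of_mul_lt_mul_left ?_ hv.le
  rw [← mul_assoc _ (bifTwo α β), bifTwo_eq hβ₁]
  calc (1 - β / 2) * (chordPow (α - β) δ * Real.sin ((2 - α / 2) * δ))
      = chordPow (α - β) δ * ((1 - β / 2) * Real.sin ((2 - α / 2) * δ)) := by ring
    _ < chordPow (α - β) δ * ((2 - α / 2) * Real.sin ((1 - β / 2) * δ)) := by gcongr
    _ ≤ bifOne α β * ((2 - α / 2) * Real.sin ((1 - β / 2) * δ)) := by gcongr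
    _ = _ := by ring

theorem arcIm_pos_of_bifTwo_le (hβ₀ : 0 < β) (hβ₁ : β ≤ 1) (hα₁ : 1 < α) (hα₂ : α ≤ 2)
    (ha : bifTwo α β ≤ a) (h0 : 0 < δ) (h1 : δ < Real.pi) : 0 < arcIm α β a δ := by
  rw [arcIm_eq (abs_lt_pi_of_mem h0 h1)]
  refine mul_pos (chordPow_pos _ (abs_lt_pi_of_mem h0 h1)) ?_
  have := chordPow_mul_sin_lt hβ₀ hβ₁ hα₁ hα₂ h0 h1
  have h2 := mul_le_mul_of_nonneg_right ha (sin_lower_pos hβ₀ hβ₁ h0 h1.le).le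
  linarith

theorem arcIm_pos_of_pi_div_le (hβ₀ : 0 < β) (hβ₁ : β ≤ 1) (hα₁ : 1 < α) (hα₂ : α ≤ 2)
    (ha : 0 < a) (h0 : Real.pi / (2 - α / 2) ≤ δ) (h1 : δ < Real.pi) : 0 < arcIm α β a δ := by
  have hu : 0 < 2 - α / 2 := by linarith
  have hδ : 0 < δ := (div_pos Real.pi_pos hu).trans_le h0
  rw [arcIm_eq (abs_lt_pi_of_mem hδ h1)]
  refine mul_pos (chordPow_pos _ (abs_lt_pi_of_mem hδ h1)) ?_
  have h2 := mul_pos ha (sin_lower_pos hβ₀ hβ₁ hδ h1.le)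
  have h3 := chordPow_pos (α - β) (abs_lt_pi_of_mem hδ h1)
  have h4 := sin_upper_nonpos hα₁ hα₂ h0 h1
  nlinarith

/-- The coefficient `a` for which the boundary curve is real at the angle `δ`. -/
noncomputable def arcCoeff (α β δ : ℝ) : ℝ :=
  chordPow (α - β) δ * (Real.sin ((2 - α / 2) * δ) / Real.sin ((1 - β / 2) * δ))

theorem arcCoeff_mul_sin (hβ₀ : 0 < β) (hβ₁ : β ≤ 1) (h0 : 0 < δ) (h1 : δ ≤ Real.pi) :
    arcCoeff α β δ * Real.sin ((1 - β / 2) * δ) =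
      chordPow (α - β) δ * Real.sin ((2 - α / 2) * δ) := by
  rw [arcCoeff, mul_assoc, div_mul_cancel₀ _ (sin_lower_pos hβ₀ hβ₁ h0 h1).ne']

theorem arcIm_eq_zero_iff (hβ₀ : 0 < β) (hβ₁ : β ≤ 1) (h0 : 0 < δ) (h1 : δ < Real.pi) :
    arcIm α β a δ = 0 ↔ a = arcCoeff α β δ := by
  have hs := sin_lower_pos hβ₀ hβ₁ h0 h1.le
  rw [arcIm_eq (abs_lt_pi_of_mem h0 h1), mul_eq_zero,
    or_iff_right (chordPow_pos _ (abs_lt_pi_of_mem h0 h1)).ne', sub_eq_zero, arcCoeff,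
    ← mul_div_assoc, eq_div_iff hs.ne']

theorem arcCoeff_pos (hβ₀ : 0 < β) (hβ₁ : β ≤ 1) (hα₂ : α ≤ 2) (h0 : 0 < δ)
    (h1 : δ < Real.pi / (2 - α / 2)) : 0 < arcCoeff α β δ := by
  have h2 : δ < Real.pi := h1.trans_le (pi_div_le hα₂)
  exact mul_pos (chordPow_pos _ (abs_lt_pi_of_mem h0 h2))
    (div_pos (sin_upper_pos hα₂ h0 h1) (sin_lower_pos hβ₀ hβ₁ h0 h2.le))

theorem sin_ratio_strictAntiOn (hβ₀ : 0 < β) (hβ₁ : β ≤ 1) (hα₁ : 1 < α) (hα₂ : α ≤ 2) :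
    StrictAntiOn (fun δ => Real.sin ((2 - α / 2) * δ) / Real.sin ((1 - β / 2) * δ))
      (Set.Ioo 0 (Real.pi / (2 - α / 2))) := by
  set u := 2 - α / 2 with hu
  set v := 1 - β / 2 with hv
  have hu0 : 0 < u := by rw [hu]; linarith
  have hv0 : 0 < v := by rw [hv]; linarith
  have huv : v < u := by rw [hu, hv]; linarith
  have hsin : ∀ δ ∈ Set.Ioo 0 (Real.pi / u), 0 < Real.sin (u * δ) ∧ 0 < Real.sin (v * δ) :=
    fun δ hδ => ⟨sin_upper_pos hα₂ hδ.1 hδ.2,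
      sin_lower_pos hβ₀ hβ₁ hδ.1 (hδ.2.le.trans (pi_div_le hα₂))⟩
  have hds : ∀ c δ : ℝ, HasDerivAt (fun δ => Real.sin (c * δ)) (c * Real.cos (c * δ)) δ := by
    intro c δ
    simpa [mul_comm] using ((hasDerivAt_id δ).const_mul c).sin
  have hdc : ∀ c δ : ℝ, HasDerivAt (fun δ => Real.cos (c * δ)) (-(c * Real.sin (c * δ))) δ := by
    intro c δ
    simpa [mul_comm] using ((hasDerivAt_id δ).const_mul c).cos
  -- The numerator of the derivative of the quotient vanishes at `0` and has derivative `-(u² - v²)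
  -- sin (u δ) sin (v δ) < 0`, so it is negative on the interval.
  have hnum : StrictAntiOn (fun δ => u * Real.cos (u * δ) * Real.sin (v * δ) -
      Real.sin (u * δ) * (v * Real.cos (v * δ))) (Set.Ico 0 (Real.pi / u)) := by
    refine strictAntiOn_of_deriv_neg (convex_Ico _ _) (by fun_prop) fun δ hδ => ?_
    rw [interior_Ico] at hδ
    have hd := (((hdc u δ).const_mul u).mul (hds v δ)).sub
      ((hds u δ).mul ((hdc v δ).const_mul v))
    have hd' : HasDerivAt (fun δ => u * Real.cos (u * δ) * Real.sin (v * δ) -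
      Real.sin (u * δ) * (v * Real.cos (v * δ)))
      (-((u ^ 2 - v ^ 2) * (Real.sin (u * δ) * Real.sin (v * δ)))) δ := by
      refine hd.congr_deriv ?_
      ring
    rw [hd'.deriv, neg_lt_zero]
    have := hsin δ hδ
    exact mul_pos (by nlinarith) (mul_pos this.1 this.2)
  refine strictAntiOn_of_deriv_neg (convex_Ioo _ _) ?_ fun δ hδ => ?_
  · exact ContinuousOn.div (by fun_prop) (by fun_prop) fun δ hδ => (hsin δ hδ).2.ne'
  · rw [interior_Ioo] at hδ
    have hd : HasDerivAt (fun δ => Real.sin (u * δ) / Real.sin (v * δ)) _ δ :=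
      (hds u δ).div (hds v δ) (hsin δ hδ).2.ne'
    rw [hd.deriv]
    have := hnum ⟨le_rfl, by positivity⟩ ⟨hδ.1.le, hδ.2⟩ hδ.1
    simp at this
    exact div_neg_of_neg_of_pos (by linarith) (pow_pos (hsin δ hδ).2 2)

theorem arcCoeff_strictAntiOn (hβ₀ : 0 < β) (hβ₁ : β ≤ 1) (hα₁ : 1 < α) (hα₂ : α ≤ 2) :
    StrictAntiOn (arcCoeff α β) (Set.Ioo 0 (Real.pi / (2 - α / 2))) := by
  intro x hx y hy hxy
  have hyp : y < Real.pi := hy.2.trans_le (pi_div_le hα₂)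
  have h1 := sin_ratio_strictAntiOn hβ₀ hβ₁ hα₁ hα₂ hx hy hxy
  have h2 := chordPow_strictAntiOn (μ := α - β) (by linarith) ⟨hx.1.le, (hxy.trans hyp).le⟩
    ⟨hy.1.le, hyp.le⟩ hxy
  have h3 := chordPow_pos (α - β) (abs_lt_pi_of_mem hy.1 hyp)
  have h4 : 0 < Real.sin ((2 - α / 2) * x) / Real.sin ((1 - β / 2) * x) :=
    div_pos (sin_upper_pos hα₂ hx.1 hx.2) (sin_lower_pos hβ₀ hβ₁ hx.1 (hxy.trans hyp).le)
  calc arcCoeff α β y < chordPow (α - β) y *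
        (Real.sin ((2 - α / 2) * x) / Real.sin ((1 - β / 2) * x)) := mul_lt_mul_of_pos_left h1 h3
    _ < arcCoeff α β x := mul_lt_mul_of_pos_right h2 h4

theorem continuousOn_arcCoeff (hβ₀ : 0 < β) (hβ₁ : β ≤ 1) (hα₁ : 1 < α) :
    ContinuousOn (arcCoeff α β) (Set.Ioc 0 Real.pi) :=
  (continuous_chordPow (by linarith)).continuousOn.mul
    (ContinuousOn.div (by fun_prop) (by fun_prop)
      fun _ hδ => (sin_lower_pos hβ₀ hβ₁ hδ.1 hδ.2).ne')

/-- At a real point of the boundary curve the real part is to the left of both real endpoints. -/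
theorem arcRe_arcCoeff_neg (hβ₀ : 0 < β) (hβ₁ : β ≤ 1) (hα₁ : 1 < α) (hα₂ : α ≤ 2)
    (h0 : 0 < δ) (h1 : δ < Real.pi) : arcRe α β (arcCoeff α β δ) δ < 0 := by
  have hs := sin_lower_pos hβ₀ hβ₁ h0 h1.le
  have hx := chordPow_pos (α - β) (abs_lt_pi_of_mem h0 h1)
  have hd : 0 < Real.sin ((2 - α / 2) * δ - (1 - β / 2) * δ) := by
    rw [← sub_mul]
    refine Real.sin_pos_of_pos_of_lt_pi (mul_pos (by linarith) h0) ?_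
    nlinarith
  rw [arcRe_eq (abs_lt_pi_of_mem h0 h1)]
  refine mul_neg_of_pos_of_neg (chordPow_pos _ (abs_lt_pi_of_mem h0 h1)) ?_
  refine neg_of_mul_neg_right (a := Real.sin ((1 - β / 2) * δ)) ?_ hs.le
  -- Eliminating `arcCoeff` by its defining relation leaves a single sine of the difference of
  -- angles.
  have : Real.sin ((1 - β / 2) * δ) * (chordPow (α - β) δ * Real.cos ((2 - α / 2) * δ) -
      arcCoeff α β δ * Real.cos ((1 - β / 2) * δ)) =
      -(chordPow (α - β) δ * Real.sin ((2 - α / 2) * δ - (1 - β / 2) * δ)) := by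
    rw [Real.sin_sub]
    linear_combination (-Real.cos ((1 - β / 2) * δ)) * arcCoeff_mul_sin (α := α) hβ₀ hβ₁ h0 h1.le
  rw [this, neg_lt_zero]
  exact mul_pos hx hd

/-- Let `s = sin (v δ)` with `v = 1 - β/2`, let `D` be the difference of the two angles, `x` the
chord factor and `c = cos (δ/2)`. Multiplication by `s` reduces the claim to `x s cos D + x sin D
(cos (v δ) - c^β) < a₁ s`. It follows from `x < a₁`, `cos D ≤ 1` and `cos (v δ) ≤ c ≤ c^β`, where `v
≥ 1/2`. -/
theorem arcRe_arcCoeff_lt (hβ₀ : 0 < β) (hβ₁ : β ≤ 1) (hα₁ : 1 < α) (hα₂ : α ≤ 2)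
    (h0 : 0 < δ) (h1 : δ < Real.pi) :
    arcRe α β (arcCoeff α β δ) δ < 2 ^ α - arcCoeff α β δ * 2 ^ β := by
  have hs := sin_lower_pos hβ₀ hβ₁ h0 h1.le
  have hx := chordPow_pos (α - β) (abs_lt_pi_of_mem h0 h1)
  have hc0 : 0 < Real.cos (δ / 2) := by
    linarith [two_mul_cos_half_pos (abs_lt_pi_of_mem h0 h1)]
  have hc1 : Real.cos (δ / 2) ≤ 1 := Real.cos_le_one _
  set c := Real.cos (δ / 2) with hc
  set s := Real.sin ((1 - β / 2) * δ) with hsdef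
  set x := chordPow (α - β) δ with hxdef
  set D := (2 - α / 2) * δ - (1 - β / 2) * δ with hD
  have hd : 0 < Real.sin D := by
    rw [hD, ← sub_mul]
    refine Real.sin_pos_of_pos_of_lt_pi (mul_pos (by linarith) h0) ?_
    nlinarith
  have hxlt : x < bifOne α β := chordPow_lt_bifOne hβ₁ hα₁ h0 h1.le
  have hcos : Real.cos ((1 - β / 2) * δ) ≤ c ^ β := by
    calc Real.cos ((1 - β / 2) * δ) ≤ c := by
          refine Real.cos_le_cos_of_nonneg_of_le_pi (by linarith) ?_ (by nlinarith)
          nlinarith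
      _ = c ^ (1 : ℝ) := (Real.rpow_one c).symm
      _ ≤ c ^ β := Real.rpow_le_rpow_of_exponent_ge hc0 hc1 hβ₁
  have hY : chordPow β δ = 2 ^ β * c ^ β := Real.mul_rpow two_pos.le hc0.le
  have h2 : (2 : ℝ) ^ α = 2 ^ β * bifOne α β := by
    rw [bifOne, ← Real.rpow_add two_pos]; ring_nf
  have h2β : (0 : ℝ) < 2 ^ β := Real.rpow_pos_of_pos two_pos _
  have hsu : Real.sin ((2 - α / 2) * δ) = s * Real.cos D +
      Real.cos ((1 - β / 2) * δ) * Real.sin D := by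
    rw [hsdef, ← Real.sin_add, hD]; ring_nf
  have hA : arcCoeff α β δ * s = x * Real.sin ((2 - α / 2) * δ) :=
    arcCoeff_mul_sin hβ₀ hβ₁ h0 h1.le
  rw [arcRe_eq (abs_lt_pi_of_mem h0 h1), hY, h2]
  refine lt_of_mul_lt_mul_right ?_ hs.le
  have key : c ^ β * (x * Real.cos ((2 - α / 2) * δ) * s -
      Real.cos ((1 - β / 2) * δ) * (x * Real.sin ((2 - α / 2) * δ))) <
      bifOne α β * s - x * Real.sin ((2 - α / 2) * δ) := by
    have e1 : x * Real.cos ((2 - α / 2) * δ) * s -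
      Real.cos ((1 - β / 2) * δ) * (x * Real.sin ((2 - α / 2) * δ)) = -(x * Real.sin D) := by
      have := Real.sin_sub ((2 - α / 2) * δ) ((1 - β / 2) * δ)
      rw [← hD] at this
      rw [this]
      ring
    rw [e1, hsu]
    have e2 : x * (Real.sin D * (Real.cos ((1 - β / 2) * δ) - c ^ β)) ≤ 0 :=
      mul_nonpos_of_nonneg_of_nonpos hx.le
        (mul_nonpos_of_nonneg_of_nonpos hd.le (by linarith))
    have e3 : x * (s * Real.cos D) ≤ x * (s * 1) := by
      gcongr; exact Real.cos_le_one _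
    have e4 : x * s < bifOne α β * s := by gcongr
    nlinarith
  have := mul_lt_mul_of_pos_left key h2β
  calc _ = 2 ^ β * (c ^ β * (x * Real.cos ((2 - α / 2) * δ) * s -
      Real.cos ((1 - β / 2) * δ) * (arcCoeff α β δ * s))) := by ring
    _ < 2 ^ β * (bifOne α β * s - x * Real.sin ((2 - α / 2) * δ)) := by rw [hA]; exact this
    _ = _ := by rw [← hA]; ring

/-- The function `g` vanishes at `0`, where its slope is negative exactly because `a < a₂`. At `π /
(2 - α/2)` only the positive term survives, so the intermediate value theorem applies. -/
theorem exists_arcCoeff_eq (hβ₀ : 0 < β) (hβ₁ : β ≤ 1) (hα₁ : 1 < α) (hα₂ : α ≤ 2)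
    (ha₀ : 0 < a) (ha : a < bifTwo α β) :
    ∃ δ ∈ Set.Ioo 0 (Real.pi / (2 - α / 2)), a = arcCoeff α β δ := by
  have hu : 0 < 2 - α / 2 := by linarith
  have hv : 0 < 1 - β / 2 := by linarith
  set g : ℝ → ℝ := fun δ => a * Real.sin ((1 - β / 2) * δ) -
    chordPow (α - β) δ * Real.sin ((2 - α / 2) * δ) with hg
  have hgc : Continuous g := by
    have := continuous_chordPow (μ := α - β) (by linarith)
    fun_prop
  have hP : 0 < Real.pi / (2 - α / 2) := div_pos Real.pi_pos hu
  have hds : ∀ c : ℝ, HasDerivAt (fun δ => Real.sin (c * δ)) c 0 := by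
    intro c
    simpa using ((hasDerivAt_id (0 : ℝ)).const_mul c).sin
  have hchord : DifferentiableAt ℝ (chordPow (α - β)) 0 := by
    unfold chordPow
    refine DifferentiableAt.rpow_const (by fun_prop) (Or.inl ?_)
    simp
  have hder : HasDerivAt g (a * (1 - β / 2) - bifOne α β * (2 - α / 2)) 0 := by
    refine (((hds (1 - β / 2)).const_mul a).sub
      (hchord.hasDerivAt.mul (hds (2 - α / 2)))).congr_deriv ?_
    simp [chordPow_zero_right, bifOne]
  have hneg : a * (1 - β / 2) - bifOne α β * (2 - α / 2) < 0 := by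
    have := bifTwo_eq (α := α) hβ₁
    nlinarith
  obtain ⟨η, hη0, hηP, hηneg⟩ : ∃ η, 0 < η ∧ η < Real.pi / (2 - α / 2) ∧ g η < 0 := by
    have h1 := (hasDerivAt_iff_tendsto_slope_zero.mp hder).eventually_lt_const hneg
    have h2 : ∀ᶠ t in 𝓝[>] (0 : ℝ), t⁻¹ • (g (0 + t) - g 0) < 0 :=
      h1.filter_mono (nhdsWithin_mono 0 fun t (ht : 0 < t) => ht.ne')
    have h3 : ∀ᶠ t in 𝓝[>] (0 : ℝ), t < Real.pi / (2 - α / 2) :=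
      nhdsWithin_le_nhds (gt_mem_nhds hP)
    obtain ⟨t, h4, h5, h6⟩ := (h2.and (h3.and self_mem_nhdsWithin)).exists
    have h6' : 0 < t := h6
    refine ⟨t, h6', h5, ?_⟩
    have hg0 : g 0 = 0 := by simp [hg]
    rw [zero_add, hg0, sub_zero, smul_eq_mul] at h4
    exact neg_of_mul_neg_right h4 (inv_nonneg.mpr h6'.le)
  have hpos : 0 < g (Real.pi / (2 - α / 2)) := by
    have h1 : (2 - α / 2) * (Real.pi / (2 - α / 2)) = Real.pi := mul_div_cancel₀ _ hu.ne'
    simp only [hg]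
    rw [h1, Real.sin_pi, mul_zero, sub_zero]
    exact mul_pos ha₀ (sin_lower_pos hβ₀ hβ₁ hP (pi_div_le hα₂))
  obtain ⟨δ, hδ, hδ0⟩ := intermediate_value_Ioo hηP.le hgc.continuousOn ⟨hηneg, hpos⟩
  have hδpos : 0 < δ := hη0.trans hδ.1
  have hδpi : δ < Real.pi := hδ.2.trans_le (pi_div_le hα₂)
  refine ⟨δ, ⟨hδpos, hδ.2⟩, (arcIm_eq_zero_iff hβ₀ hβ₁ hδpos hδpi).mp ?_⟩
  rw [arcIm_eq (abs_lt_pi_of_mem hδpos hδpi)]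
  exact mul_eq_zero_of_right _ hδ0

end Trigonometry

/-! ### The curve at `θ = 0` and `θ = π`. -/

section Endpoint

variable {α β a : ℝ}

theorem gammaCurve_pi (α β a : ℝ) :
    gammaCurve α β a Real.pi = (1 + (2 ^ α - a * 2 ^ β), 0) := by
  have h1 := gammaRe_pi_sub α β a (δ := 0) (by simpa using Real.pi_pos.le)
  have h2 := gammaIm_pi_sub α β a (δ := 0) (by simpa using Real.pi_pos.le)
  rw [sub_zero] at h1 h2
  rw [gammaCurve, h1, h2, arcRe_zero, arcIm_zero]

theorem gammaCurve_zero (hα : α ≠ 0) (hβ : β ≠ 0) : gammaCurve α β a 0 = (1, 0) := by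
  simp [gammaCurve, gammaRe, gammaIm, Real.zero_rpow hα, Real.zero_rpow hβ]

theorem two_rpow_eq (α β : ℝ) : (2 : ℝ) ^ α = bifOne α β * 2 ^ β := by
  rw [bifOne, ← Real.rpow_add two_pos, sub_add_cancel]

theorem gammaCurve_zero_eq_pi_iff (hα : α ≠ 0) (hβ : β ≠ 0) :
    gammaCurve α β a 0 = gammaCurve α β a Real.pi ↔ a = bifOne α β := by
  have h2 : (0 : ℝ) < 2 ^ β := Real.rpow_pos_of_pos two_pos _
  rw [gammaCurve_zero hα hβ, gammaCurve_pi, Prod.mk.injEq, and_iff_left rfl, two_rpow_eq α β]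
  constructor
  · intro h
    have : (bifOne α β - a) * 2 ^ β = 0 := by linarith
    rcases mul_eq_zero.mp this with h3 | h3
    · linarith
    · exact absurd h3 h2.ne'
  · rintro rfl
    ring

theorem hasDerivAt_chordPow (μ : ℝ) {δ : ℝ} (h : |δ| < Real.pi) :
    HasDerivAt (chordPow μ) (-(μ / 2 * Real.tan (δ / 2) * chordPow μ δ)) δ := by
  have hr := two_mul_cos_half_pos h
  have hc : Real.cos (δ / 2) ≠ 0 := by
    intro h0
    simp [h0] at hr
  have h1 : HasDerivAt (fun δ => 2 * Real.cos (δ / 2)) (-Real.sin (δ / 2)) δ := by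
    refine (((hasDerivAt_id δ).div_const 2).cos.const_mul 2).congr_deriv ?_
    simp
    ring
  refine (h1.rpow_const (p := μ) (Or.inl hr.ne')).congr_deriv ?_
  rw [chordPow, Real.rpow_sub_one hr.ne', Real.tan_eq_sin_div_cos]
  field_simp

theorem hasDerivAt_sin_const_mul (c δ : ℝ) :
    HasDerivAt (fun δ => Real.sin (c * δ)) (c * Real.cos (c * δ)) δ := by
  simpa [mul_comm] using ((hasDerivAt_id δ).const_mul c).sin

theorem hasDerivAt_cos_const_mul (c δ : ℝ) :
    HasDerivAt (fun δ => Real.cos (c * δ)) (-(c * Real.sin (c * δ))) δ := by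
  simpa [mul_comm] using ((hasDerivAt_id δ).const_mul c).cos

theorem hasDerivAt_arcRe (α β a : ℝ) {δ : ℝ} (h : |δ| < Real.pi) :
    HasDerivAt (arcRe α β a)
      (-(α / 2 * Real.tan (δ / 2) * chordPow α δ) * Real.cos ((2 - α / 2) * δ) -
        (2 - α / 2) * chordPow α δ * Real.sin ((2 - α / 2) * δ) +
        a * (β / 2 * Real.tan (δ / 2) * chordPow β δ) * Real.cos ((1 - β / 2) * δ) +
        a * (1 - β / 2) * chordPow β δ * Real.sin ((1 - β / 2) * δ)) δ := by
  refine (((hasDerivAt_chordPow α h).mul (hasDerivAt_cos_const_mul (2 - α / 2) δ)).sub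
    (((hasDerivAt_chordPow β h).const_mul a).mul
      (hasDerivAt_cos_const_mul (1 - β / 2) δ))).congr_deriv ?_
  ring

theorem hasDerivAt_arcIm (α β a : ℝ) {δ : ℝ} (h : |δ| < Real.pi) :
    HasDerivAt (arcIm α β a)
      (-(a * (β / 2 * Real.tan (δ / 2) * chordPow β δ)) * Real.sin ((1 - β / 2) * δ) +
        a * (1 - β / 2) * chordPow β δ * Real.cos ((1 - β / 2) * δ) +
        α / 2 * Real.tan (δ / 2) * chordPow α δ * Real.sin ((2 - α / 2) * δ) -
        (2 - α / 2) * chordPow α δ * Real.cos ((2 - α / 2) * δ)) δ := by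
  refine ((((hasDerivAt_chordPow β h).const_mul a).mul
    (hasDerivAt_sin_const_mul (1 - β / 2) δ)).sub
    ((hasDerivAt_chordPow α h).mul (hasDerivAt_sin_const_mul (2 - α / 2) δ))).congr_deriv ?_
  ring

/-- The real part is even in `δ`, so only the imaginary component of the velocity can be nonzero. -/
theorem hasDerivAt_gammaCurve_pi (α β a : ℝ) :
    HasDerivAt (gammaCurve α β a)
      (0, -(a * (1 - β / 2) * 2 ^ β - (2 - α / 2) * 2 ^ α)) Real.pi := by
  have h0 : |Real.pi - Real.pi| < Real.pi := by simpa using Real.pi_pos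
  have hsub : HasDerivAt (fun θ : ℝ => Real.pi - θ) (-1) Real.pi := by
    simpa using (hasDerivAt_id Real.pi).const_sub Real.pi
  have h1 := ((hasDerivAt_arcRe α β a h0).comp Real.pi hsub).const_add 1
  have h2 := (hasDerivAt_arcIm α β a h0).comp Real.pi hsub
  have h3 := h1.prodMk h2
  have hev : gammaCurve α β a =ᶠ[𝓝 Real.pi] fun θ =>
      (1 + arcRe α β a (Real.pi - θ), arcIm α β a (Real.pi - θ)) := by
    filter_upwards [Ioo_mem_nhds Real.pi_pos (show Real.pi < 2 * Real.pi by linarith [Real.pi_pos])]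
      with θ hθ
    have habs : |Real.pi - θ| ≤ Real.pi := by
      rw [abs_le]; constructor <;> linarith [hθ.1, hθ.2]
    have e1 := gammaRe_pi_sub α β a habs
    have e2 := gammaIm_pi_sub α β a habs
    rw [sub_sub_cancel] at e1 e2
    rw [gammaCurve, e1, e2]
  refine (h3.congr_of_eventuallyEq hev).congr_deriv ?_
  simp [chordPow_zero_right]

theorem deriv_gammaCurve_pi_eq_zero_iff (hβ₁ : β ≤ 1) :
    deriv (gammaCurve α β a) Real.pi = 0 ↔ a = bifTwo α β := by
  have h2 : (0 : ℝ) < 2 ^ β := Real.rpow_pos_of_pos two_pos _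
  have hv : 0 < 1 - β / 2 := by linarith
  rw [(hasDerivAt_gammaCurve_pi α β a).deriv, Prod.mk_eq_zero, and_iff_right rfl, neg_eq_zero,
    two_rpow_eq α β]
  have : a * (1 - β / 2) * 2 ^ β - (2 - α / 2) * (bifOne α β * 2 ^ β) =
      2 ^ β * (1 - β / 2) * (a - bifTwo α β) := by
    linear_combination (2 : ℝ) ^ β * bifTwo_eq (α := α) hβ₁
  rw [this, mul_eq_zero, or_iff_right (by positivity), sub_eq_zero]

end Endpoint

/-! ### Real `b`: the interval of asymptotic stability. -/

/-- The characteristic function at real arguments. -/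
noncomputable def realChar (α β a b t : ℝ) : ℝ :=
  (1 - t) ^ α + a * (t * (1 - t) ^ β) - (b - 1) * t ^ 2

theorem charFun_ofReal (α β a b : ℝ) {t : ℝ} (ht : t ≤ 1) :
    charFun α β a b t = realChar α β a b t := by
  have h : 0 ≤ 1 - t := by linarith
  rw [charFun, realChar]
  push_cast
  rw [Complex.ofReal_cpow h, Complex.ofReal_cpow h]
  push_cast
  rfl

theorem continuous_realChar {α β : ℝ} (hα : 0 ≤ α) (hβ : 0 ≤ β) (a b : ℝ) :
    Continuous (realChar α β a b) := by
  have h : ∀ {μ : ℝ}, 0 ≤ μ → Continuous fun t : ℝ => (1 - t) ^ μ := fun hμ =>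
    Continuous.rpow_const (by fun_prop) fun _ => Or.inr hμ
  have h1 := h hα
  have h2 := h hβ
  unfold realChar
  fun_prop

theorem realChar_zero (α β a b : ℝ) : realChar α β a b 0 = 1 := by
  simp [realChar]

theorem realChar_one {α β : ℝ} (hα : α ≠ 0) (hβ : β ≠ 0) (a b : ℝ) :
    realChar α β a b 1 = 1 - b := by
  simp [realChar, Real.zero_rpow hα, Real.zero_rpow hβ]

theorem realChar_neg_one (α β a b : ℝ) :
    realChar α β a b (-1) = 1 + 2 ^ α - a * 2 ^ β - b := by
  rw [realChar]
  norm_num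
  ring

section RealParameter

variable {α β a : ℝ}

theorem hasInnerZero_of_one_lt (hα : 0 < α) (hβ : 0 < β) {b : ℝ} (hb : 1 < b) :
    HasInnerZero α β a b := by
  have hc := continuous_realChar hα.le hβ.le a b
  obtain ⟨t, ht, h0⟩ := intermediate_value_Ioo' zero_le_one hc.continuousOn
    (show (0 : ℝ) ∈ Set.Ioo (realChar α β a b 1) (realChar α β a b 0) by
      rw [realChar_zero, realChar_one hα.ne' hβ.ne']; constructor <;> linarith)
  refine ⟨t, ?_, by rw [charFun_ofReal α β a b ht.2.le, h0, Complex.ofReal_zero]⟩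
  rw [Complex.norm_real, Real.norm_of_nonneg ht.1.le]
  exact ht.2

theorem hasInnerZero_of_realChar_neg_one_neg (hα : 0 < α) (hβ : 0 < β) {b : ℝ}
    (hb : 1 + 2 ^ α - a * 2 ^ β < b) : HasInnerZero α β a b := by
  have hc := continuous_realChar hα.le hβ.le a b
  obtain ⟨t, ht, h0⟩ := intermediate_value_Ioo (show (-1 : ℝ) ≤ 0 by norm_num) hc.continuousOn
    (show (0 : ℝ) ∈ Set.Ioo (realChar α β a b (-1)) (realChar α β a b 0) by
      rw [realChar_zero, realChar_neg_one]; constructor <;> linarith)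
  refine ⟨t, ?_, by rw [charFun_ofReal α β a b (by linarith [ht.2]), h0, Complex.ofReal_zero]⟩
  rw [Complex.norm_real, Real.norm_of_nonpos ht.2.le]
  linarith [ht.1]

theorem charFun_neg_one_eq_zero {b : ℝ} (hb : b = 1 + 2 ^ α - a * 2 ^ β) :
    charFun α β a b (-1) = 0 := by
  have := charFun_ofReal α β a b (t := -1) (by norm_num)
  rw [realChar_neg_one, ← hb, sub_self] at this
  simpa using this

/-- Zeros on the unit circle for real `b`. -/
theorem real_circle_zero (hβ₀ : 0 < β) (hβ₁ : β ≤ 1) (hα₁ : 1 < α) (hα₂ : α ≤ 2) (ha : 0 < a)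
    {b : ℝ} {w : ℂ} (hw : ‖w‖ = 1) (h0 : charFun α β a b w = 0) :
    b = 1 ∨ b = 1 + 2 ^ α - a * 2 ^ β ∨
      ∃ δ ∈ Set.Ioo 0 (Real.pi / (2 - α / 2)), a = arcCoeff α β δ ∧ b = 1 + arcRe α β a δ := by
  rcases eq_or_ne w 1 with rfl | hw1
  · left
    rw [charFun_one (by linarith) hβ₀, sub_eq_zero] at h0
    exact_mod_cast h0.symm
  right
  have key : ∀ δ : ℝ, 0 < δ → δ < Real.pi → arcIm α β a δ = 0 → arcRe α β a δ = b - 1 →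
      ∃ δ ∈ Set.Ioo 0 (Real.pi / (2 - α / 2)), a = arcCoeff α β δ ∧ b = 1 + arcRe α β a δ := by
    intro δ h1 h2 h3 h4
    refine ⟨δ, ⟨h1, ?_⟩, (arcIm_eq_zero_iff hβ₀ hβ₁ h1 h2).mp h3, by linarith⟩
    by_contra hcon
    exact (arcIm_pos_of_pi_div_le hβ₀ hβ₁ hα₁ hα₂ ha (not_lt.mp hcon) h2).ne' h3
  obtain ⟨δ, hδ, rfl⟩ := exists_eq_neg_exp hw hw1
  rw [charFun_neg_exp_eq_zero_iff α β a b hδ] at h0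
  simp only [Complex.sub_re, Complex.ofReal_re, Complex.one_re, Complex.sub_im,
    Complex.ofReal_im, Complex.one_im, sub_zero] at h0
  obtain ⟨hre, him⟩ := h0
  rw [abs_lt] at hδ
  rcases lt_trichotomy δ 0 with h | rfl | h
  · right
    exact key (-δ) (by linarith) (by linarith) (by rw [arcIm_neg, him, neg_zero])
      (by rw [arcRe_neg, hre])
  · left
    rw [arcRe_zero] at hre
    linarith
  · right
    exact key δ h hδ.2 him hre

/-- This is `z^c + a (1 - z) = 0` for `z = 1 - w = ρ exp (i ψ)`, where `|w| ≤ 1` reads `ρ ≤ 2 cos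
ψ`; conjugation allows `ψ ≥ 0`. -/
theorem no_unit_disc_zero_real_form {c : ℝ} (hc0 : 0 < c) (hc2 : c < 2) (ha₀ : 0 < a)
    (ha : a < 2 ^ c) {ρ ψ : ℝ} (hρ : 0 < ρ) (hψ0 : 0 ≤ ψ) (hψ1 : ψ ≤ Real.pi / 2)
    (hle : ρ ≤ 2 * Real.cos ψ)
    (hre : ρ ^ c * Real.cos (c * ψ) + a * (1 - ρ * Real.cos ψ) = 0)
    (him : ρ ^ c * Real.sin (c * ψ) = a * (ρ * Real.sin ψ)) : False := by
  have hP : 0 < ρ ^ c := Real.rpow_pos_of_pos hρ c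
  rcases hψ0.eq_or_lt with rfl | hψ
  · simp at hre hle
    -- On the real axis `ρ^c ≥ 2^c (ρ/2)² ≥ 2^c (ρ - 1)`, which contradicts `ρ^c = a (ρ - 1)` when
    -- `a < 2^c`.
    have h1 : ρ ^ c = 2 ^ c * (ρ / 2) ^ c := by
      rw [← Real.mul_rpow two_pos.le (by positivity)]; congr 1; ring
    have h2 : (ρ / 2) ^ (2 : ℝ) ≤ (ρ / 2) ^ c :=
      Real.rpow_le_rpow_of_exponent_ge (by positivity) (by linarith) hc2.le
    rw [Real.rpow_two] at h2
    have h3 : 0 < (ρ / 2) ^ c := Real.rpow_pos_of_pos (by positivity) c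
    have h4 : ρ - 1 ≤ (ρ / 2) ^ c := by nlinarith [sq_nonneg (ρ / 2 - 1)]
    nlinarith
  · have hs : 0 < Real.sin ψ := Real.sin_pos_of_pos_of_lt_pi hψ (by linarith [Real.pi_pos])
    -- Eliminating `a` gives `sin (cψ) = ρ sin ((c-1)ψ) ≤ 2 cos ψ sin ((c-1)ψ)`, that is `sin
    -- ((2-c)ψ) ≤ 0`. This is impossible since `0 < (2-c)ψ < π`.
    have e1 : ρ ^ c * Real.sin (c * ψ - ψ) = a * Real.sin ψ := by
      rw [Real.sin_sub]
      linear_combination Real.cos ψ * him - Real.sin ψ * hre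
    have e2 : 0 < Real.sin (c * ψ - ψ) := by
      have : 0 < ρ ^ c * Real.sin (c * ψ - ψ) := by rw [e1]; positivity
      exact (pos_iff_pos_of_mul_pos this).mp hP
    have e3 : Real.sin (c * ψ) = ρ * Real.sin (c * ψ - ψ) := by
      have : ρ ^ c * Real.sin (c * ψ) = ρ ^ c * (ρ * Real.sin (c * ψ - ψ)) := by
        linear_combination him - ρ * e1
      exact mul_left_cancel₀ hP.ne' this
    have e4 : Real.sin (c * ψ) = Real.sin (c * ψ - ψ) * Real.cos ψ +
        Real.cos (c * ψ - ψ) * Real.sin ψ := by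
      rw [← Real.sin_add, sub_add_cancel]
    have e5 : Real.sin (ψ - (c * ψ - ψ)) = Real.sin ψ * Real.cos (c * ψ - ψ) -
        Real.cos ψ * Real.sin (c * ψ - ψ) := Real.sin_sub _ _
    have e6 : 0 < Real.sin (ψ - (c * ψ - ψ)) := by
      refine Real.sin_pos_of_pos_of_lt_pi ?_ ?_ <;> nlinarith
    have e7 : ρ * Real.sin (c * ψ - ψ) ≤ 2 * Real.cos ψ * Real.sin (c * ψ - ψ) := by gcongr
    nlinarith

/-- For `b = 1` and small `a`, the only zero in the closed disc is `1`. -/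
theorem charFun_one_ne_zero (hβ₀ : 0 < β) (hβ₁ : β ≤ 1) (hα₁ : 1 < α) (hα₂ : α ≤ 2)
    (ha₀ : 0 < a) (ha : a < bifOne α β) {w : ℂ} (hw : ‖w‖ ≤ 1) (hw1 : w ≠ 1) :
    charFun α β a 1 w ≠ 0 := by
  intro h0
  have hz : 1 - w ≠ 0 := sub_ne_zero.mpr hw1.symm
  have h1 : (1 - w) ^ ((α - β : ℝ) : ℂ) + a * w = 0 := by
    have h2 : (1 - w) ^ (α : ℂ) = (1 - w) ^ (β : ℂ) * (1 - w) ^ ((α - β : ℝ) : ℂ) := by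
      rw [← Complex.cpow_add _ _ hz]; push_cast; ring_nf
    have h3 : (1 - w) ^ (β : ℂ) * ((1 - w) ^ ((α - β : ℝ) : ℂ) + a * w) = 0 := by
      rw [charFun, h2, sub_self, zero_mul, sub_zero] at h0
      linear_combination h0
    exact (mul_eq_zero.mp h3).resolve_left
      (Complex.cpow_ne_zero_iff.mpr (Or.inl hz))
  set z := 1 - w with hzdef
  have hwz : w = 1 - z := by rw [hzdef]; ring
  set c := α - β with hc
  have hρ : 0 < ‖z‖ := norm_pos_iff.mpr hz
  have hre0 := Complex.norm_mul_cos_arg z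
  have him0 := Complex.norm_mul_sin_arg z
  have hnn : 0 ≤ z.re := by
    have := Complex.re_le_norm w
    rw [hzdef, Complex.sub_re, Complex.one_re]
    linarith
  have harg := Complex.abs_arg_le_pi_div_two_iff.mpr hnn
  have hre := congrArg Complex.re h1
  have him := congrArg Complex.im h1
  rw [hwz] at hre him
  simp only [Complex.add_re, Complex.add_im, Complex.cpow_ofReal_re, Complex.cpow_ofReal_im,
    Complex.re_ofReal_mul, Complex.im_ofReal_mul, Complex.sub_re, Complex.sub_im, Complex.one_re,
    Complex.one_im, Complex.zero_re, Complex.zero_im, ← hre0, ← him0] at hre him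
  rw [mul_comm (Complex.arg z) c] at hre him
  have hle : ‖z‖ ≤ 2 * Real.cos z.arg := by
    have h2 : ‖w‖ ^ 2 = (1 - z.re) ^ 2 + z.im ^ 2 := by
      rw [← Complex.normSq_eq_norm_sq, Complex.normSq_apply, hwz]
      simp
      ring
    have h3 : ‖z‖ ^ 2 = z.re ^ 2 + z.im ^ 2 := by
      rw [← Complex.normSq_eq_norm_sq, Complex.normSq_apply]
      ring
    have h4 : ‖w‖ ^ 2 ≤ 1 := pow_le_one₀ (norm_nonneg _) hw
    have h5 : ‖z‖ * ‖z‖ ≤ ‖z‖ * (2 * Real.cos z.arg) := by nlinarith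
    exact le_of_mul_le_mul_left h5 hρ
  refine no_unit_disc_zero_real_form (c := c) (by rw [hc]; linarith) (by rw [hc]; linarith) ha₀ ha hρ
    (abs_nonneg z.arg) harg (by rwa [Real.cos_abs]) ?_ ?_
  · rw [Real.cos_abs]
    rcases abs_cases z.arg with ⟨h, -⟩ | ⟨h, -⟩ <;> rw [h]
    · exact hre
    · rw [mul_neg, Real.cos_neg]; exact hre
  · rcases abs_cases z.arg with ⟨h, -⟩ | ⟨h, -⟩ <;> rw [h]
    · linarith
    · rw [mul_neg, Real.sin_neg, Real.sin_neg]; linarith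

theorem re_one_sub_cpow_nonneg (hβ₀ : 0 ≤ β) (hβ₁ : β ≤ 1) {w : ℂ} (hw : ‖w‖ ≤ 1) :
    0 ≤ ((1 - w) ^ (β : ℂ)).re := by
  rw [Complex.cpow_ofReal_re]
  refine mul_nonneg (Real.rpow_nonneg (norm_nonneg _) _) ?_
  have hnn : 0 ≤ (1 - w).re := by
    have := Complex.re_le_norm w
    rw [Complex.sub_re, Complex.one_re]
    linarith
  have harg := Complex.abs_arg_le_pi_div_two_iff.mpr hnn
  have h : |(1 - w).arg * β| ≤ Real.pi / 2 := by
    rw [abs_mul, abs_of_nonneg hβ₀]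
    nlinarith [abs_nonneg (1 - w).arg]
  rw [abs_le] at h
  exact Real.cos_nonneg_of_mem_Icc ⟨by linarith, h.2⟩

/-- For small `a` there are no zeros in the open disc when `b` is slightly less than `1`. -/
theorem eventually_not_hasInnerZero (hβ₀ : 0 < β) (hβ₁ : β ≤ 1) (hα₁ : 1 < α) (hα₂ : α ≤ 2)
    (ha₀ : 0 < a) (ha : a < bifOne α β) :
    ∀ᶠ b : ℝ in 𝓝[<] 1, ¬ HasInnerZero α β a b := by
  have hmain : ∀ᶠ b : ℝ in 𝓝 1, ∀ w ∈ Metric.closedBall (0 : ℂ) 1,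
      ‖w‖ < 1 → b < 1 → charFun α β a b w ≠ 0 := by
    refine (isCompact_closedBall (0 : ℂ) 1).eventually_forall_of_forall_eventually
      (P := fun (b : ℝ) w => ‖w‖ < 1 → b < 1 → charFun α β a b w ≠ 0) fun w₀ hw₀ => ?_
    rcases eq_or_ne w₀ 1 with rfl | hw1
    -- Near `w = 1` compactness alone fails, since `charFun` vanishes there for `b = 1`. A zero
    -- satisfies `(1 - w)^β = (b - 1) w² / E w`. The left side has nonnegative real part, while `E 1
    -- = a > 0` and `b < 1` make the right side's negative.
    · set E : ℂ → ℂ := fun w => (1 - w) ^ ((α - β : ℝ) : ℂ) + a * w with hE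
      have hEc : ContinuousWithinAt E (Metric.closedBall 0 1) 1 :=
        ((continuousOn_one_sub_cpow (ν := α - β) (by linarith)) 1 hw₀).add
          (by fun_prop)
      have hE1 : E 1 = a := by
        have : α - β ≠ 0 := by linarith
        simp only [hE, sub_self, mul_one]
        rw [Complex.zero_cpow (by exact_mod_cast this), zero_add]
      have haC : (a : ℂ) ≠ 0 := by exact_mod_cast ha₀.ne'
      have hh : ContinuousWithinAt (fun w => (w ^ 2 / E w).re) (Metric.closedBall 0 1) 1 :=
        Complex.continuous_re.continuousAt.comp_continuousWithinAt
          (ContinuousWithinAt.div (by fun_prop) hEc (by rw [hE1]; exact haC))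
      have hpos : ∀ᶠ w in 𝓝[Metric.closedBall 0 1] (1 : ℂ), 0 < (w ^ 2 / E w).re := by
        refine hh.eventually_const_lt ?_
        change 0 < (1 ^ 2 / E 1).re
        rw [hE1, one_pow, one_div, ← Complex.ofReal_inv, Complex.ofReal_re]
        positivity
      rw [eventually_nhdsWithin_iff] at hpos
      have hpos2 : ∀ᶠ p : ℝ × ℂ in 𝓝 (1, 1), p.2 ∈ Metric.closedBall (0 : ℂ) 1 →
          0 < (p.2 ^ 2 / E p.2).re :=
        (continuous_snd.tendsto ((1 : ℝ), (1 : ℂ))).eventually hpos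
      filter_upwards [hpos2] with p hp hpn hb h0
      have hpp := hp (by simpa using hpn.le)
      have hEne : E p.2 ≠ 0 := fun h => by simp [h] at hpp
      have hz : 1 - p.2 ≠ 0 := fun h => by
        rw [← sub_eq_zero.mp h] at hpn
        simp at hpn
      have h2 : (1 - p.2) ^ (α : ℂ) = (1 - p.2) ^ (β : ℂ) * (1 - p.2) ^ ((α - β : ℝ) : ℂ) := by
        rw [← Complex.cpow_add _ _ hz]; push_cast; ring_nf
      have h3 : (1 - p.2) ^ (β : ℂ) = ((p.1 - 1 : ℝ) : ℂ) * (p.2 ^ 2 / E p.2) := by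
        rw [mul_div_assoc', eq_div_iff hEne]
        rw [charFun, h2] at h0
        simp only [hE, Complex.ofReal_sub p.1, Complex.ofReal_one]
        linear_combination h0
      have h4 := re_one_sub_cpow_nonneg hβ₀.le hβ₁ hpn.le
      rw [h3, Complex.re_ofReal_mul] at h4
      nlinarith
    · have hcont := (continuousOn_charFun_uncurry (α := α) (by linarith) hβ₀)
      have h1 : ContinuousWithinAt (fun p : ℝ × ℂ => charFun α β a p.1 p.2)
          (Set.univ ×ˢ Metric.closedBall 0 1) (1, w₀) :=
        (hcont.comp (f := fun x : ℝ × ℂ => ((a, (x.1 : ℂ)), x.2)) (by fun_prop)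
          fun x hx => ⟨trivial, hx.2⟩) (1, w₀) ⟨trivial, hw₀⟩
      have h2 := h1.eventually_ne (b₂ := 0) (by
        simpa using charFun_one_ne_zero hβ₀ hβ₁ hα₁ hα₂ ha₀ ha (by simpa using hw₀) hw1)
      rw [eventually_nhdsWithin_iff] at h2
      filter_upwards [h2] with p hp hpn _
      exact hp ⟨trivial, by simpa using hpn.le⟩
  filter_upwards [nhdsWithin_le_nhds hmain, self_mem_nhdsWithin] with b hb hb1
  rintro ⟨w, hw, h0⟩
  exact hb w (by simpa using hw.le) hw hb1 h0

/-- For real `b` between the leftmost real point of the curve and its right real endpoints, there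
are no zeros in the open disc. -/
theorem not_hasInnerZero_of_mem (hβ₀ : 0 < β) (hβ₁ : β ≤ 1) (hα₁ : 1 < α) (hα₂ : α ≤ 2)
    {δ : ℝ} (hδ : δ ∈ Set.Ioo 0 (Real.pi / (2 - α / 2))) (ha : a = arcCoeff α β δ) {b : ℝ}
    (hb0 : 1 + arcRe α β a δ < b) (hb1 : b < min 1 (1 + 2 ^ α - a * 2 ^ β)) :
    ¬ HasInnerZero α β a b := by
  set L : ℝ → ℝ := fun δ => 1 + arcRe α β (arcCoeff α β δ) δ with hL
  set R : ℝ → ℝ := fun δ => min 1 (1 + 2 ^ α - arcCoeff α β δ * 2 ^ β) with hR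
  set I := Set.Ioo 0 (Real.pi / (2 - α / 2)) with hI
  have hlt : ∀ {x}, x ∈ I → x < Real.pi := fun hx => hx.2.trans_le (pi_div_le hα₂)
  have hLR : ∀ {x}, x ∈ I → L x < R x := fun {x} hx => lt_min
    (by have := arcRe_arcCoeff_neg hβ₀ hβ₁ hα₁ hα₂ hx.1 (hlt hx); simp only [hL]; linarith)
    (by have := arcRe_arcCoeff_lt hβ₀ hβ₁ hα₁ hα₂ hx.1 (hlt hx); simp only [hL]; linarith)
  have hAc : ContinuousOn (arcCoeff α β) I :=
    (continuousOn_arcCoeff hβ₀ hβ₁ hα₁).mono fun x hx => ⟨hx.1, (hlt hx).le⟩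
  have hLc : ContinuousOn L I := by
    have h1 := (continuous_chordPow (μ := α) (by linarith)).continuousOn (s := I)
    have h2 := (continuous_chordPow (μ := β) hβ₀.le).continuousOn (s := I)
    simp only [hL, arcRe]
    fun_prop
  have hRc : ContinuousOn R I := by
    refine ContinuousOn.inf continuousOn_const ?_
    fun_prop
  set Φ : ℝ × ℝ → ℝ × ℂ := fun p =>
    (arcCoeff α β p.1, (((1 - p.2) * L p.1 + p.2 * R p.1 : ℝ) : ℂ)) with hΦ
  -- The whole region between crossing point and right endpoint, over all `a` in the range of
  -- `arcCoeff`. It is a continuous image of a rectangle in crossing angle and relative position,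
  -- hence connected.
  set S : Set (ℝ × ℂ) := Φ '' (I ×ˢ Set.Ioo 0 1) with hS
  have hSpre : IsPreconnected S := by
    refine (isPreconnected_Ioo.prod isPreconnected_Ioo).image Φ ?_
    have hA' := hAc.comp (t := I) continuousOn_fst fun p (hp : p ∈ I ×ˢ Set.Ioo (0 : ℝ) 1) => hp.1
    have hL' := hLc.comp (t := I) continuousOn_fst fun p (hp : p ∈ I ×ˢ Set.Ioo (0 : ℝ) 1) => hp.1
    have hR' := hRc.comp (t := I) continuousOn_fst fun p (hp : p ∈ I ×ˢ Set.Ioo (0 : ℝ) 1) => hp.1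
    refine hA'.prodMk (Complex.continuous_ofReal.comp_continuousOn ?_)
    exact ((continuousOn_const.sub continuousOn_snd).mul hL').add (continuousOn_snd.mul hR')
  have hmem : ∀ {x y : ℝ}, x ∈ I → L x < y → y < R x → (arcCoeff α β x, (y : ℂ)) ∈ S := by
    intro x y hx h1 h2
    have h3 : 0 < R x - L x := by linarith [hLR hx]
    refine ⟨(x, (y - L x) / (R x - L x)), ⟨hx, div_pos (by linarith) h3, ?_⟩, ?_⟩
    · rw [div_lt_one h3]; linarith
    · simp only [hΦ, Prod.mk.injEq, true_and, Complex.ofReal_inj]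
      field_simp
      ring
  have hcirc : ∀ p ∈ S, ∀ w, ‖w‖ = 1 → charFun α β p.1 p.2 w ≠ 0 := by
    rintro _ ⟨⟨x, t⟩, ⟨hx, ht⟩, rfl⟩ w hw h0
    simp only at hx ht
    have hlr := hLR hx
    have hy1 : L x < (1 - t) * L x + t * R x := by nlinarith [ht.1, ht.2]
    have hy2 : (1 - t) * L x + t * R x < R x := by nlinarith [ht.1, ht.2]
    rcases real_circle_zero hβ₀ hβ₁ hα₁ hα₂ (arcCoeff_pos hβ₀ hβ₁ hα₂ hx.1 hx.2) hw h0 with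
      h | h | ⟨x', hx', h1, h2⟩
    · exact absurd h (hy2.trans_le (min_le_left _ _)).ne
    · exact absurd h (hy2.trans_le (min_le_right _ _)).ne
    · have : x = x' := (arcCoeff_strictAntiOn hβ₀ hβ₁ hα₁ hα₂).injOn hx hx' h1
      subst this
      exact hy1.ne' h2
  intro hin
  -- The reference parameter `a₁/2` lies below `a₁`, so its right endpoint is `1` and the local
  -- analysis just left of `b = 1` applies.
  obtain ⟨η, hη, hηa⟩ := exists_arcCoeff_eq (a := bifOne α β / 2) hβ₀ hβ₁ hα₁ hα₂
    (half_pos bifOne_pos) ((half_lt_self bifOne_pos).trans (bifOne_lt_bifTwo hβ₀ hβ₁ hα₂))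
  have hRη : R η = 1 := by
    refine min_eq_left ?_
    rw [← hηa, two_rpow_eq α β]
    have h2 : (0 : ℝ) < 2 ^ β := Real.rpow_pos_of_pos two_pos _
    have := mul_pos (bifOne_pos (α := α) (β := β)) h2
    linarith
  have hp : (a, (b : ℂ)) ∈ S := by
    rw [ha] at hb0 hb1 ⊢
    exact hmem hδ hb0 hb1
  have hev := eventually_not_hasInnerZero hβ₀ hβ₁ hα₁ hα₂ (half_pos bifOne_pos)
    (half_lt_self (bifOne_pos (α := α) (β := β)))
  have hLη : L η < 1 := hRη ▸ hLR hη
  obtain ⟨y, hy, hy1, hy2⟩ := (hev.and (Ioo_mem_nhdsLT hLη)).exists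
  refine hy ?_
  have := hasInnerZero_of_isPreconnected (by linarith) hβ₀ hSpre hcirc hp
    (hmem hη hy1 (hRη.symm ▸ hy2)) hin
  rwa [← hηa] at this

theorem isPreconnected_ofReal_Iio (a c : ℝ) :
    IsPreconnected ((fun y : ℝ => (a, (y : ℂ))) '' Set.Iio c) :=
  isPreconnected_Iio.image _ (by fun_prop)

/-- To the left of the leftmost real point of the curve there are zeros in the open disc. -/
theorem hasInnerZero_of_lt_arcRe (hβ₀ : 0 < β) (hβ₁ : β ≤ 1) (hα₁ : 1 < α) (hα₂ : α ≤ 2)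
    {δ : ℝ} (hδ : δ ∈ Set.Ioo 0 (Real.pi / (2 - α / 2))) (ha : a = arcCoeff α β δ) {b : ℝ}
    (hb : b < 1 + arcRe α β a δ) : HasInnerZero α β a b := by
  have ha₀ : 0 < a := ha ▸ arcCoeff_pos hβ₀ hβ₁ hα₂ hδ.1 hδ.2
  have hδpi := hδ.2.trans_le (pi_div_le hα₂)
  obtain ⟨M, hM⟩ := exists_hasInnerZero_of_lt_norm α β a
  set y : ℝ := min b (-|M| - 1) with hy
  have hyM : HasInnerZero α β a y := by
    refine hM _ ?_
    have h1 : y ≤ -|M| - 1 := min_le_right _ _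
    rw [Complex.norm_real, Real.norm_of_nonpos (by linarith [abs_nonneg M])]
    linarith [le_abs_self M]
  have hneg := arcRe_arcCoeff_neg hβ₀ hβ₁ hα₁ hα₂ hδ.1 hδpi
  have hneg2 := arcRe_arcCoeff_lt hβ₀ hβ₁ hα₁ hα₂ hδ.1 hδpi
  rw [← ha] at hneg hneg2
  refine hasInnerZero_of_isPreconnected (by linarith) hβ₀
    (isPreconnected_ofReal_Iio a (1 + arcRe α β a δ)) ?_
    (p := (a, (y : ℂ))) (q := (a, (b : ℂ))) ⟨y, (min_le_left _ _).trans_lt hb, rfl⟩ ⟨b, hb, rfl⟩ hyM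
  rintro _ ⟨x, hx, rfl⟩ w hw h0
  have hx' : x < 1 + arcRe α β a δ := hx
  rcases real_circle_zero hβ₀ hβ₁ hα₁ hα₂ ha₀ hw h0 with h | h | ⟨δ', hδ', h1, h2⟩
  · linarith
  · linarith
  · have : δ = δ' := (arcCoeff_strictAntiOn hβ₀ hβ₁ hα₁ hα₂).injOn hδ hδ' (ha ▸ h1)
    subst this
    linarith

/-- The set of real stable parameters. -/
theorem setOf_isAsympStableSystem_eq (hβ₀ : 0 < β) (hβ₁ : β ≤ 1) (hα₁ : 1 < α) (hα₂ : α ≤ 2)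
    {δ : ℝ} (hδ : δ ∈ Set.Ioo 0 (Real.pi / (2 - α / 2))) (ha : a = arcCoeff α β δ) :
    {b : ℝ | IsAsympStableSystem α β a (b : ℂ)} =
      Set.Ioo (1 + arcRe α β a δ) (min 1 (1 + 2 ^ α - a * 2 ^ β)) := by
  have ha₀ : 0 < a := ha ▸ arcCoeff_pos hβ₀ hβ₁ hα₂ hδ.1 hδ.2
  have hδpi := hδ.2.trans_le (pi_div_le hα₂)
  have hα₀ : 0 < α := by linarith
  have inner : ∀ {b : ℂ}, HasInnerZero α β a b → ¬ IsAsympStableSystem α β a b := by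
    rintro b ⟨w, hw, h0⟩ h
    exact not_isStableSystem_of_charFun_eq_zero hβ₀ hβ₁ hα₁ hα₂ hw h0 h.1
  ext b
  constructor
  · intro hst
    refine ⟨?_, lt_min ?_ ?_⟩ <;> by_contra hcon <;> rw [not_lt] at hcon
    · rcases hcon.lt_or_eq with h | h
      · exact inner (hasInnerZero_of_lt_arcRe hβ₀ hβ₁ hα₁ hα₂ hδ ha h) hst
      · have habs := abs_lt_pi_of_mem hδ.1 hδpi
        have h0 := (charFun_neg_exp_eq_zero_iff α β a b habs).mpr ⟨by simp [h],
          by simpa using (arcIm_eq_zero_iff hβ₀ hβ₁ hδ.1 hδpi).mpr ha⟩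
        refine not_isAsympStableSystem_of_charFun_eq_zero hβ₀ hβ₁ hα₁ hα₂ ?_ ?_ h0 hst
        · rw [norm_neg, Complex.norm_exp_ofReal_mul_I]
        · intro h1
          have h2 := congrArg Complex.im h1
          rw [Complex.neg_im, Complex.exp_ofReal_mul_I_im, Complex.one_im] at h2
          linarith [Real.sin_pos_of_pos_of_lt_pi hδ.1 hδpi]
    · rcases hcon.lt_or_eq with h | h
      · exact inner (hasInnerZero_of_one_lt hα₀ hβ₀ h) hst
      · rw [← h] at hst
        exact not_isAsympStableSystem_one hβ₀ hα₁ (by simpa using hst)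
    · rcases hcon.lt_or_eq with h | h
      · exact inner (hasInnerZero_of_realChar_neg_one_neg hα₀ hβ₀ h) hst
      · exact not_isAsympStableSystem_of_charFun_eq_zero hβ₀ hβ₁ hα₁ hα₂ (w := -1) (by simp)
          (by norm_num) (charFun_neg_one_eq_zero h.symm) hst
  · rintro ⟨h1, h2⟩
    refine isAsympStableSystem_of_charFun_ne_zero hβ₀ hβ₁ hα₁ hα₂ fun w hw h0 => ?_
    rcases hw.lt_or_eq with hw | hw
    · exact not_hasInnerZero_of_mem hβ₀ hβ₁ hα₁ hα₂ hδ ha h1 h2 ⟨w, hw, h0⟩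
    · rcases real_circle_zero hβ₀ hβ₁ hα₁ hα₂ ha₀ hw h0 with h | h | ⟨δ', hδ', h3, h4⟩
      · exact absurd h (h2.trans_le (min_le_left _ _)).ne
      · exact absurd h (h2.trans_le (min_le_right _ _)).ne
      · have : δ = δ' := (arcCoeff_strictAntiOn hβ₀ hβ₁ hα₁ hα₂).injOn hδ hδ' (ha ▸ h3)
        subst this
        exact h1.ne' h4

end RealParameter

/-! ### The range `a ≥ a₂`: disappearance of the stable region. -/

section LargeCoefficient

variable {α β a : ℝ}

theorem hasInnerZero_one (hα₀ : 0 < α) (hβ₀ : 0 < β) (ha : bifOne α β < a) :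
    HasInnerZero α β a 1 := by
  have h := hasInnerZero_of_realChar_neg_one_neg (a := a) (b := 1) hα₀ hβ₀ (by
    rw [two_rpow_eq α β]
    have h2 : (0 : ℝ) < 2 ^ β := Real.rpow_pos_of_pos two_pos _
    nlinarith)
  simpa using h

/-- The angular velocity of the boundary curve around `1` is positive. -/
theorem angular_velocity_pos (hβ₀ : 0 < β) (hβ₁ : β ≤ 1) (hα₁ : 1 < α) (hα₂ : α ≤ 2)
    {δ : ℝ} (h : |δ| < Real.pi) (h1 : chordPow (α - β) δ < a)
    (h2 : (2 - α / 2) * chordPow (α - β) δ < (1 - β / 2) * a) :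
    0 < deriv (arcRe α β a) δ * arcIm α β a δ - arcRe α β a δ * deriv (arcIm α β a) δ := by
  rw [(hasDerivAt_arcRe α β a h).deriv, (hasDerivAt_arcIm α β a h).deriv, arcRe, arcIm,
    chordPow_split α β h]
  have hY := chordPow_pos β h
  have hx := chordPow_pos (α - β) h
  set x := chordPow (α - β) δ
  set Y := chordPow β δ
  set T := Real.tan (δ / 2)
  set p := (2 - α / 2) * δ with hp
  set q := (1 - β / 2) * δ with hq
  have hTs : 0 ≤ T * Real.sin (p - q) := by
    have hpq : p - q = (1 - (α - β) / 2) * δ := by rw [hp, hq]; ring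
    rw [abs_lt] at h
    rw [hpq]
    rcases le_total 0 δ with h0 | h0
    · refine mul_nonneg (Real.tan_nonneg_of_nonneg_of_le_pi_div_two (by linarith) (by linarith))
        (Real.sin_nonneg_of_nonneg_of_le_pi (mul_nonneg (by linarith) h0) ?_)
      nlinarith
    · refine mul_nonneg_of_nonpos_of_nonpos
        (Real.tan_nonpos_of_nonpos_of_neg_pi_div_two_le (by linarith) (by linarith))
        (Real.sin_nonpos_of_nonpos_of_neg_pi_le
          (mul_nonpos_of_nonneg_of_nonpos (by linarith) h0) ?_)
      nlinarith
  have hcos : Real.cos (p - q) ≤ 1 := Real.cos_le_one _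
  have hsp := Real.sin_sq_add_cos_sq p
  have hsq := Real.sin_sq_add_cos_sq q
  have ha : 0 < a := hx.trans h1
  have hmain : 0 < (2 - α / 2) * x ^ 2 + (1 - β / 2) * a ^ 2 + a * x * ((α - β) / 2 *
      (T * Real.sin (p - q)) - ((2 - α / 2) + (1 - β / 2)) * Real.cos (p - q)) := by
    -- At `cos (p - q) = 1` and without the tangent term, the bracket factors into this product; the
    -- remaining contributions `e2` and `e3` are nonnegative.
    have e1 : 0 < ((1 - β / 2) * a - (2 - α / 2) * x) * (a - x) :=
      mul_pos (by linarith) (by linarith)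
    have e2 : 0 ≤ a * x * ((α - β) / 2 * (T * Real.sin (p - q))) :=
      mul_nonneg (by positivity) (mul_nonneg (by linarith) hTs)
    have e3 : 0 ≤ a * x * (((2 - α / 2) + (1 - β / 2)) * (1 - Real.cos (p - q))) :=
      mul_nonneg (by positivity) (mul_nonneg (by linarith) (by linarith))
    linarith
  refine (mul_pos (pow_pos hY 2) hmain).trans_eq ?_
  rw [Real.sin_sub, Real.cos_sub]
  linear_combination (-(2 - α / 2) * x ^ 2 * Y ^ 2) * hsp - ((1 - β / 2) * a ^ 2 * Y ^ 2) * hsq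

theorem chordPow_abs (μ δ : ℝ) : chordPow μ |δ| = chordPow μ δ := by
  rcases abs_cases δ with ⟨h, -⟩ | ⟨h, -⟩ <;> rw [h]
  simp [chordPow, neg_div]

theorem angular_velocity_pos_of_ne_zero (hβ₀ : 0 < β) (hβ₁ : β ≤ 1) (hα₁ : 1 < α) (hα₂ : α ≤ 2)
    (ha : bifTwo α β ≤ a) {δ : ℝ} (h : |δ| < Real.pi) (h' : δ ≠ 0 ∨ bifTwo α β < a) :
    0 < deriv (arcRe α β a) δ * arcIm α β a δ - arcRe α β a δ * deriv (arcIm α β a) δ := by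
  have hlt := bifOne_lt_bifTwo (α := α) hβ₀ hβ₁ hα₂
  have heq := bifTwo_eq (α := α) hβ₁
  have hu : 0 < 2 - α / 2 := by linarith
  have hv : 0 < 1 - β / 2 := by linarith
  rcases eq_or_ne δ 0 with rfl | hδ
  · have ha' := h'.resolve_left (fun h => h rfl)
    have hx : chordPow (α - β) 0 = bifOne α β := chordPow_zero_right _
    refine angular_velocity_pos hβ₀ hβ₁ hα₁ hα₂ h (by linarith) ?_
    rw [hx, ← heq]
    gcongr
  · have hx : chordPow (α - β) δ < bifOne α β := by
      rw [← chordPow_abs]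
      exact chordPow_lt_bifOne hβ₁ hα₁ (abs_pos.mpr hδ) h.le
    refine angular_velocity_pos hβ₀ hβ₁ hα₁ hα₂ h (by linarith) ?_
    calc (2 - α / 2) * chordPow (α - β) δ < (2 - α / 2) * bifOne α β := by gcongr
      _ = (1 - β / 2) * bifTwo α β := heq.symm
      _ ≤ (1 - β / 2) * a := by gcongr

/-- The quotient is the cotangent of the direction from `1` to the curve point; its derivative is
the angular velocity over `arcIm²`. -/
theorem arcRe_div_arcIm_strictMonoOn (hβ₀ : 0 < β) (hβ₁ : β ≤ 1) (hα₁ : 1 < α) (hα₂ : α ≤ 2)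
    (ha : bifTwo α β ≤ a) :
    StrictMonoOn (fun δ => arcRe α β a δ / arcIm α β a δ) (Set.Ioo 0 Real.pi) := by
  have hder : ∀ δ ∈ Set.Ioo 0 Real.pi, HasDerivAt (fun δ => arcRe α β a δ / arcIm α β a δ)
      ((deriv (arcRe α β a) δ * arcIm α β a δ - arcRe α β a δ * deriv (arcIm α β a) δ) /
        arcIm α β a δ ^ 2) δ := fun δ hδ => by
    have habs := abs_lt_pi_of_mem hδ.1 hδ.2
    exact (hasDerivAt_arcRe α β a habs).differentiableAt.hasDerivAt.div
      (hasDerivAt_arcIm α β a habs).differentiableAt.hasDerivAt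
      (arcIm_pos_of_bifTwo_le hβ₀ hβ₁ hα₁ hα₂ ha hδ.1 hδ.2).ne'
  refine strictMonoOn_of_deriv_pos (convex_Ioo _ _)
    (fun δ hδ => (hder δ hδ).continuousAt.continuousWithinAt) fun δ hδ => ?_
  rw [interior_Ioo] at hδ
  rw [(hder δ hδ).deriv]
  exact div_pos (angular_velocity_pos_of_ne_zero hβ₀ hβ₁ hα₁ hα₂ ha
    (abs_lt_pi_of_mem hδ.1 hδ.2) (Or.inl hδ.1.ne'))
    (pow_pos (arcIm_pos_of_bifTwo_le hβ₀ hβ₁ hα₁ hα₂ ha hδ.1 hδ.2) 2)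

theorem arcIm_neg_of_neg (hβ₀ : 0 < β) (hβ₁ : β ≤ 1) (hα₁ : 1 < α) (hα₂ : α ≤ 2)
    (ha : bifTwo α β ≤ a) {δ : ℝ} (h0 : -Real.pi < δ) (h1 : δ < 0) : arcIm α β a δ < 0 := by
  have := arcIm_pos_of_bifTwo_le hβ₀ hβ₁ hα₁ hα₂ ha (δ := -δ) (by linarith) (by linarith)
  rw [arcIm_neg] at this
  linarith

/-- Every ray emanating from `1` meets the boundary curve at most once. -/
theorem ray_inter_arc_unique (hβ₀ : 0 < β) (hβ₁ : β ≤ 1) (hα₁ : 1 < α) (hα₂ : α ≤ 2)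
    (ha : bifTwo α β ≤ a) {x y δ₁ δ₂ s₁ s₂ : ℝ} (h₁ : |δ₁| < Real.pi) (h₂ : |δ₂| < Real.pi)
    (hs₁ : 0 < s₁) (hs₂ : 0 < s₂) (hx₁ : arcRe α β a δ₁ = s₁ * x) (hy₁ : arcIm α β a δ₁ = s₁ * y)
    (hx₂ : arcRe α β a δ₂ = s₂ * x) (hy₂ : arcIm α β a δ₂ = s₂ * y) : δ₁ = δ₂ := by
  have upper : ∀ {x y δ₁ δ₂ s₁ s₂ : ℝ}, 0 < δ₁ → δ₁ < Real.pi → 0 < δ₂ → δ₂ < Real.pi →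
      0 < s₁ → 0 < s₂ → arcRe α β a δ₁ = s₁ * x → arcIm α β a δ₁ = s₁ * y →
      arcRe α β a δ₂ = s₂ * x → arcIm α β a δ₂ = s₂ * y → δ₁ = δ₂ := by
    intro x y δ₁ δ₂ s₁ s₂ a1 a2 b1 b2 hs₁ hs₂ e1 e2 e3 e4
    refine (arcRe_div_arcIm_strictMonoOn hβ₀ hβ₁ hα₁ hα₂ ha).injOn ⟨a1, a2⟩ ⟨b1, b2⟩ ?_
    simp only [e1, e2, e3, e4]
    rw [mul_div_mul_left _ _ hs₁.ne', mul_div_mul_left _ _ hs₂.ne']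
  have pos : ∀ {δ}, |δ| < Real.pi → 0 < δ → 0 < arcIm α β a δ := fun h h0 =>
    arcIm_pos_of_bifTwo_le hβ₀ hβ₁ hα₁ hα₂ ha h0 (abs_lt.mp h).2
  have neg : ∀ {δ}, |δ| < Real.pi → δ < 0 → arcIm α β a δ < 0 := fun h h0 =>
    arcIm_neg_of_neg hβ₀ hβ₁ hα₁ hα₂ ha (abs_lt.mp h).1 h0
  have sgn : ∀ {δ s : ℝ}, |δ| < Real.pi → 0 < s → arcIm α β a δ = s * y →
      (0 < y → 0 < δ) ∧ (y < 0 → δ < 0) ∧ (y = 0 → δ = 0) := by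
    intro δ s h hs e
    rcases lt_trichotomy δ 0 with h0 | rfl | h0
    · have h3 := neg h h0
      rw [e] at h3
      have : y < 0 := neg_of_mul_neg_right h3 hs.le
      exact ⟨fun h => absurd h this.not_gt, fun _ => h0, fun h => absurd h this.ne⟩
    · rw [arcIm_zero] at e
      have : y = 0 := (mul_eq_zero.mp e.symm).resolve_left hs.ne'
      exact ⟨fun h => absurd this h.ne', fun h => absurd this h.ne, fun _ => rfl⟩
    · have h3 := pos h h0
      rw [e] at h3
      have : 0 < y := (pos_iff_pos_of_mul_pos h3).mp hs
      exact ⟨fun _ => h0, fun h => absurd h this.not_gt, fun h => absurd h this.ne'⟩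
  obtain ⟨p1, n1, z1⟩ := sgn h₁ hs₁ hy₁
  obtain ⟨p2, n2, z2⟩ := sgn h₂ hs₂ hy₂
  rcases lt_trichotomy y 0 with hy | hy | hy
  · have := upper (x := x) (y := -y) (δ₁ := -δ₁) (δ₂ := -δ₂) (by linarith [n1 hy])
      (by linarith [(abs_lt.mp h₁).1]) (by linarith [n2 hy]) (by linarith [(abs_lt.mp h₂).1])
      hs₁ hs₂ (by rw [arcRe_neg, hx₁]) (by rw [arcIm_neg, hy₁]; ring) (by rw [arcRe_neg, hx₂])
      (by rw [arcIm_neg, hy₂]; ring)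
    linarith
  · rw [z1 hy, z2 hy]
  · exact upper (p1 hy) (abs_lt.mp h₁).2 (p2 hy) (abs_lt.mp h₂).2 hs₁ hs₂ hx₁ hy₁ hx₂ hy₂

/-- Zeros on the unit circle for parameters on a ray emanating from `1`. -/
theorem circle_zero_of_ray (hα₀ : 0 < α) (hβ₀ : 0 < β) {g : ℂ} (hg : g ≠ 0) {s : ℝ} (hs : 0 < s)
    {w : ℂ} (hw : ‖w‖ = 1) (h0 : charFun α β a (1 + s * g) w = 0) :
    ∃ δ : ℝ, |δ| < Real.pi ∧ w = -Complex.exp (δ * Complex.I) ∧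
      arcRe α β a δ = s * g.re ∧ arcIm α β a δ = s * g.im := by
  rcases eq_or_ne w 1 with rfl | hw1
  · rw [charFun_one hα₀ hβ₀, sub_add_cancel_left, neg_eq_zero, mul_eq_zero] at h0
    exact absurd h0 (by simp [hg, hs.ne'])
  obtain ⟨δ, hδ, rfl⟩ := exists_eq_neg_exp hw hw1
  rw [charFun_neg_exp_eq_zero_iff α β a _ hδ, add_sub_cancel_left, Complex.re_ofReal_mul,
    Complex.im_ofReal_mul] at h0
  exact ⟨δ, hδ, rfl, h0⟩

theorem isPreconnected_ray (a : ℝ) (g : ℂ) {I : Set ℝ} (hI : IsPreconnected I) :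
    IsPreconnected ((fun s : ℝ => (a, 1 + (s : ℂ) * g)) '' I) :=
  hI.image _ (by fun_prop)

/-- Transport of zeros along a part of a ray which does not meet the boundary curve. -/
theorem hasInnerZero_ray (hα₀ : 0 < α) (hβ₀ : 0 < β) {g : ℂ} (hg : g ≠ 0) {I : Set ℝ}
    (hI : IsPreconnected I) (hI0 : ∀ s ∈ I, 0 < s)
    (hfree : ∀ s ∈ I, ∀ δ : ℝ, |δ| < Real.pi → arcRe α β a δ = s * g.re →
      arcIm α β a δ ≠ s * g.im) {s t : ℝ} (hs : s ∈ I) (ht : t ∈ I)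
    (h : HasInnerZero α β a (1 + s * g)) : HasInnerZero α β a (1 + t * g) := by
  refine hasInnerZero_of_isPreconnected hα₀ hβ₀ (isPreconnected_ray a g hI) ?_
    (p := (a, 1 + (s : ℂ) * g)) (q := (a, 1 + (t : ℂ) * g)) ⟨s, hs, rfl⟩ ⟨t, ht, rfl⟩ h
  rintro _ ⟨r, hr, rfl⟩ w hw h0
  obtain ⟨δ, hδ, -, h1, h2⟩ := circle_zero_of_ray hα₀ hβ₀ hg (hI0 r hr) hw h0
  exact hfree r hr δ hδ h1 h2

theorem eventually_hasInnerZero_near_one (hα₀ : 0 < α) (hβ₀ : 0 < β) (ha : bifOne α β < a)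
    (g : ℂ) : ∀ᶠ s : ℝ in 𝓝[>] 0, HasInnerZero α β a (1 + s * g) := by
  have h := eventually_hasInnerZero hα₀ hβ₀ (hasInnerZero_one hα₀ hβ₀ ha)
  have hc : Tendsto (fun s : ℝ => 1 + (s : ℂ) * g) (𝓝 0) (𝓝 1) := by
    have : Continuous fun s : ℝ => 1 + (s : ℂ) * g := by fun_prop
    simpa using this.tendsto 0
  exact nhdsWithin_le_nhds (hc.eventually h)

theorem exists_hasInnerZero_far (α β a : ℝ) {g : ℂ} (hg : g ≠ 0) :
    ∃ s : ℝ, 1 ≤ s ∧ HasInnerZero α β a (1 + s * g) := by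
  obtain ⟨M, hM⟩ := exists_hasInnerZero_of_lt_norm α β a
  have hg' : 0 < ‖g‖ := norm_pos_iff.mpr hg
  refine ⟨max 1 ((|M| + 2) / ‖g‖), le_max_left _ _, hM _ ?_⟩
  set s := max 1 ((|M| + 2) / ‖g‖) with hs
  have hs0 : 0 < s := lt_max_of_lt_left one_pos
  have h1 : |M| + 2 ≤ s * ‖g‖ := by
    rw [← div_le_iff₀ hg']
    exact le_max_right _ _
  have h2 : s * ‖g‖ ≤ ‖1 + (s : ℂ) * g‖ + 1 := by
    have := norm_sub_le (1 + (s : ℂ) * g) 1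
    rw [add_sub_cancel_left, norm_mul, Complex.norm_real, Real.norm_of_nonneg hs0.le,
      norm_one] at this
    exact this
  linarith [le_abs_self M]

/-- Off the boundary curve there is a zero in the open disc. -/
theorem hasInnerZero_of_not_mem_arc (hβ₀ : 0 < β) (hβ₁ : β ≤ 1) (hα₁ : 1 < α) (hα₂ : α ≤ 2)
    (ha : bifTwo α β ≤ a) {g : ℂ} (hg : g ≠ 0)
    (hfree : ∀ δ : ℝ, |δ| < Real.pi → arcRe α β a δ = g.re → arcIm α β a δ ≠ g.im) :
    HasInnerZero α β a (1 + g) := by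
  have hα₀ : 0 < α := by linarith
  have h1a := (bifOne_lt_bifTwo (α := α) hβ₀ hβ₁ hα₂).trans_le ha
  suffices h : HasInnerZero α β a (1 + ((1 : ℝ) : ℂ) * g) by simpa using h
  -- The ray meets the curve at most once. If it does so before `s = 1`, the part `[1, ∞)` is free
  -- and zeros come from infinity; otherwise `(0, 1]` is free and they come from near `b = 1`.
  by_cases hex : ∃ s : ℝ, 0 < s ∧ s < 1 ∧ ∃ δ : ℝ, |δ| < Real.pi ∧ arcRe α β a δ = s * g.re ∧
      arcIm α β a δ = s * g.im
  · obtain ⟨s, hs0, hs1, δ, hδ, hr, hi⟩ := hex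
    obtain ⟨t, ht, hz⟩ := exists_hasInnerZero_far α β a hg
    refine hasInnerZero_ray hα₀ hβ₀ hg (I := Set.Ici 1) isPreconnected_Ici
      (fun s hs => one_pos.trans_le hs) ?_ ht (Set.mem_Ici.mpr le_rfl) hz
    intro r hr1 δ' hδ' hr' hi'
    have hr1' : (1 : ℝ) ≤ r := hr1
    have heq := ray_inter_arc_unique hβ₀ hβ₁ hα₁ hα₂ ha hδ hδ' hs0 (by linarith) hr hi hr' hi'
    subst heq
    have e1 : (r - s) * g.re = 0 := by linarith
    have e2 : (r - s) * g.im = 0 := by linarith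
    have hne : r - s ≠ 0 := by linarith
    exact hg (Complex.ext ((mul_eq_zero.mp e1).resolve_left hne)
      ((mul_eq_zero.mp e2).resolve_left hne))
  · push Not at hex
    have hev := eventually_hasInnerZero_near_one hα₀ hβ₀ h1a g
    obtain ⟨s, hz, hs0, hs1⟩ := (hev.and (Ioo_mem_nhdsGT one_pos)).exists
    refine hasInnerZero_ray hα₀ hβ₀ hg (I := Set.Ioc 0 1) isPreconnected_Ioc (fun s hs => hs.1) ?_
      (s := s) ⟨hs0, hs1.le⟩ ⟨one_pos, le_rfl⟩ hz
    rintro r ⟨hr0, hr1⟩ δ hδ hr hi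
    rcases hr1.lt_or_eq with h | rfl
    · exact hex r hr0 h δ hδ hr hi
    · exact hfree δ hδ (by simpa using hr) (by simpa using hi)

/-- Radial derivative of the boundary map. -/
theorem exists_hasDerivAt_re_neg (hβ₀ : 0 < β) (hβ₁ : β ≤ 1) (hα₁ : 1 < α) (hα₂ : α ≤ 2)
    (ha : bifTwo α β < a) {δ : ℝ} (hδ : |δ| < Real.pi) {g : ℂ}
    (hr : arcRe α β a δ = g.re) (hi : arcIm α β a δ = g.im) {w₀ : ℂ}
    (hw₀ : w₀ = -Complex.exp (δ * Complex.I)) :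
    ∃ f' : ℂ, HasDerivAt (fun w => charFun α β a 1 w / w ^ 2) f' w₀ ∧
      charFun α β a 1 w₀ / w₀ ^ 2 = g ∧ (w₀ * f' / g).re < 0 := by
  have hw0 : w₀ ≠ 0 := by rw [hw₀]; exact neg_ne_zero.mpr (Complex.exp_ne_zero _)
  have hval : ∀ δ : ℝ, |δ| < Real.pi → charFun α β a 1 (-Complex.exp (δ * Complex.I)) /
      (-Complex.exp (δ * Complex.I)) ^ 2 = arcRe α β a δ + arcIm α β a δ * Complex.I := by
    intro δ hδ
    have he : Complex.exp ((2 * δ : ℝ) * Complex.I) = (-Complex.exp (δ * Complex.I)) ^ 2 := by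
      rw [neg_sq, ← Complex.exp_nat_mul]; push_cast; ring_nf
    rw [charFun_neg_exp α β a 1 hδ, he, mul_div_cancel_left₀ _
      (pow_ne_zero 2 (neg_ne_zero.mpr (Complex.exp_ne_zero _)))]
    ring
  have hvel := angular_velocity_pos_of_ne_zero hβ₀ hβ₁ hα₁ hα₂ ha.le hδ (Or.inr ha)
  have hw1 : w₀ ≠ 1 := by
    intro h
    have h1 := hval δ hδ
    rw [← hw₀, h, charFun_one (by linarith) hβ₀] at h1
    simp [Complex.ext_iff] at h1
    rw [h1.1.symm, h1.2.symm] at hvel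
    simp at hvel
  have hnorm : ‖w₀‖ = 1 := by rw [hw₀, norm_neg, Complex.norm_exp_ofReal_mul_I]
  have hd : DifferentiableAt ℂ (fun w => charFun α β a 1 w / w ^ 2) w₀ :=
    (differentiableAt_charFun α β a 1 hnorm.le hw1).div (by fun_prop) (pow_ne_zero 2 hw0)
  set f' := deriv (fun w => charFun α β a 1 w / w ^ 2) w₀ with hf'
  have hgval : charFun α β a 1 w₀ / w₀ ^ 2 = g := by
    rw [hw₀, hval δ hδ, hr, hi, Complex.re_add_im]
  have hexp : HasDerivAt (fun δ : ℝ => -Complex.exp (δ * Complex.I)) (w₀ * Complex.I) δ := by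
    have h1 : HasDerivAt (fun z : ℂ => -Complex.exp (z * Complex.I)) (w₀ * Complex.I) (δ : ℂ) := by
      refine ((((hasDerivAt_id (δ : ℂ)).mul_const Complex.I).cexp).neg).congr_deriv ?_
      rw [hw₀]
      simp
    exact h1.comp_ofReal
  have hD : HasDerivAt (fun w => charFun α β a 1 w / w ^ 2) f' (-Complex.exp (δ * Complex.I)) := by
    rw [← hw₀]
    exact hd.hasDerivAt
  have h1 : HasDerivAt (fun δ : ℝ => charFun α β a 1 (-Complex.exp (δ * Complex.I)) /
      (-Complex.exp (δ * Complex.I)) ^ 2) (f' * (w₀ * Complex.I)) δ :=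
    HasDerivAt.comp (h := fun δ : ℝ => -Complex.exp (δ * Complex.I)) δ hD hexp
  set R' := deriv (arcRe α β a) δ
  set I' := deriv (arcIm α β a) δ
  have h2 : HasDerivAt (fun δ : ℝ => (arcRe α β a δ : ℂ) + arcIm α β a δ * Complex.I)
      (R' + I' * Complex.I) δ :=
    (hasDerivAt_arcRe α β a hδ).differentiableAt.hasDerivAt.ofReal_comp.add
      ((hasDerivAt_arcIm α β a hδ).differentiableAt.hasDerivAt.ofReal_comp.mul_const Complex.I)
  have hev : (fun δ : ℝ => charFun α β a 1 (-Complex.exp (δ * Complex.I)) /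
      (-Complex.exp (δ * Complex.I)) ^ 2) =ᶠ[𝓝 δ]
      fun δ : ℝ => (arcRe α β a δ : ℂ) + arcIm α β a δ * Complex.I := by
    filter_upwards [continuous_abs.continuousAt.eventually_lt continuousAt_const hδ] with x hx
    exact hval x hx
  have h3 := h1.unique (h2.congr_of_eventuallyEq hev)
  refine ⟨f', hd.hasDerivAt, hgval, ?_⟩
  -- The chain rule along the circle expresses the radial derivative as the tangential one rotated
  -- by `-i`. Dividing by `g` then turns the angular velocity into the real part, with a minus sign.
  have h4 : w₀ * f' = I' - R' * Complex.I := by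
    have hI : Complex.I * Complex.I = -1 := Complex.I_mul_I
    linear_combination (-Complex.I) * h3 + (w₀ * f' - I') * hI
  have hgne : 0 < Complex.normSq g := by
    rw [Complex.normSq_pos]
    rintro rfl
    rw [hr, hi] at hvel
    simp at hvel
  have h5 : (w₀ * f' / g).re = -(R' * arcIm α β a δ - arcRe α β a δ * I') / Complex.normSq g := by
    rw [h4, Complex.div_re, hr, hi]
    simp
    ring
  rw [h5]
  exact div_neg_of_neg_of_pos (by linarith) hgne

/-- On the boundary curve there is a zero in the open disc beyond the second bifurcation value. -/
theorem hasInnerZero_of_mem_arc (hβ₀ : 0 < β) (hβ₁ : β ≤ 1) (hα₁ : 1 < α) (hα₂ : α ≤ 2)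
    (ha : bifTwo α β < a) {g : ℂ} (hg : g ≠ 0) {δ : ℝ} (hδ : |δ| < Real.pi)
    (hr : arcRe α β a δ = g.re) (hi : arcIm α β a δ = g.im) :
    HasInnerZero α β a (1 + g) := by
  have hα₀ : 0 < α := by linarith
  have h1a := (bifOne_lt_bifTwo (α := α) hβ₀ hβ₁ hα₂).trans ha
  by_contra hno
  have hinside : ∀ s ∈ Set.Ioo (0 : ℝ) 1, HasInnerZero α β a (1 + s * g) := by
    intro t ht
    have hev := eventually_hasInnerZero_near_one hα₀ hβ₀ h1a g
    obtain ⟨s, hz, hs⟩ := (hev.and (Ioo_mem_nhdsGT one_pos)).exists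
    refine hasInnerZero_ray hα₀ hβ₀ hg (I := Set.Ioo 0 1) isPreconnected_Ioo (fun s hs => hs.1) ?_
      hs ht hz
    rintro r ⟨hr0, hr1⟩ δ' hδ' hr' hi'
    have heq := ray_inter_arc_unique hβ₀ hβ₁ hα₁ hα₂ ha.le hδ' hδ hr0 one_pos hr' hi'
      (by rw [one_mul, hr]) (by rw [one_mul, hi])
    subst heq
    have e1 : (r - 1) * g.re = 0 := by linarith
    have e2 : (r - 1) * g.im = 0 := by linarith
    have hne : r - 1 ≠ 0 := by linarith
    exact hg (Complex.ext ((mul_eq_zero.mp e1).resolve_left hne)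
      ((mul_eq_zero.mp e2).resolve_left hne))
  -- If `1 + g` had no inner zero, the inner zeros for `s < 1` would have to accumulate at circle
  -- zeros of `1 + g` as `s → 1`. The radial derivative excludes inner zeros near those points, and
  -- continuity together with compactness excludes them elsewhere.
  have hmain : ∀ᶠ s : ℝ in 𝓝 1, ∀ w ∈ Metric.closedBall (0 : ℂ) 1,
      ‖w‖ < 1 → s < 1 → charFun α β a (1 + s * g) w ≠ 0 := by
    refine (isCompact_closedBall (0 : ℂ) 1).eventually_forall_of_forall_eventually
      (P := fun (s : ℝ) w => ‖w‖ < 1 → s < 1 → charFun α β a (1 + s * g) w ≠ 0) fun w₀ hw₀ => ?_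
    have hw₀' : ‖w₀‖ ≤ 1 := by simpa using hw₀
    by_cases h0 : charFun α β a (1 + g) w₀ = 0
    · have hnorm : ‖w₀‖ = 1 := by
        rcases hw₀'.lt_or_eq with h | h
        · exact absurd ⟨w₀, h, h0⟩ hno
        · exact h
      obtain ⟨δ', hδ', hw', hr', hi'⟩ := circle_zero_of_ray (a := a) hα₀ hβ₀ hg one_pos hnorm
        (by simpa using h0)
      rw [one_mul] at hr' hi'
      obtain ⟨f', hf', hval, hneg⟩ := exists_hasDerivAt_re_neg hβ₀ hβ₁ hα₁ hα₂ ha hδ' hr' hi' hw'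
      have hloc := eventually_ne_of_re_neg hf' hnorm (by rw [hval]; exact hneg)
      have hw0 : w₀ ≠ 0 := fun h => by simp [h] at hnorm
      have hloc2 : ∀ᶠ p : ℝ × ℂ in 𝓝 (1, w₀), p.2 ≠ 0 ∧ (‖p.2‖ < 1 → ∀ τ : ℝ, 0 < τ →
          charFun α β a 1 p.2 / p.2 ^ 2 ≠ (1 - τ) * (charFun α β a 1 w₀ / w₀ ^ 2)) :=
        (continuous_snd.tendsto ((1 : ℝ), w₀)).eventually ((eventually_ne_nhds hw0).and hloc)
      filter_upwards [hloc2] with p hp hpn hs hz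
      refine hp.2 hpn (1 - p.1) (by linarith) ?_
      rw [hval, div_eq_iff (pow_ne_zero 2 hp.1)]
      rw [charFun] at hz ⊢
      push_cast
      linear_combination hz
    · have h1 : ContinuousWithinAt (fun p : ℝ × ℂ => charFun α β a (1 + p.1 * g) p.2)
          (Set.univ ×ˢ Metric.closedBall 0 1) (1, w₀) :=
        ((continuousOn_charFun_uncurry hα₀ hβ₀).comp
          (f := fun x : ℝ × ℂ => ((a, 1 + (x.1 : ℂ) * g), x.2)) (by fun_prop)
          fun x hx => ⟨trivial, hx.2⟩) (1, w₀) ⟨trivial, hw₀⟩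
      have h2 := h1.eventually_ne (b₂ := 0) (by simpa using h0)
      rw [eventually_nhdsWithin_iff] at h2
      filter_upwards [h2] with p hp hpn _
      exact hp ⟨trivial, by simpa using hpn.le⟩
  have hmain' : ∀ᶠ s : ℝ in 𝓝[<] 1, ∀ w ∈ Metric.closedBall (0 : ℂ) 1,
      ‖w‖ < 1 → s < 1 → charFun α β a (1 + s * g) w ≠ 0 := nhdsWithin_le_nhds hmain
  obtain ⟨s, hs, hs01⟩ := (hmain'.and (Ioo_mem_nhdsLT (zero_lt_one (α := ℝ)))).exists
  obtain ⟨w, hw, hz⟩ := hinside s hs01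
  exact hs w (by simpa using hw.le) hw hs01.2 hz

/-- Beyond the second bifurcation value the equation is never stable. -/
theorem not_isStableSystem_of_bifTwo_lt (hβ₀ : 0 < β) (hβ₁ : β ≤ 1) (hα₁ : 1 < α) (hα₂ : α ≤ 2)
    (ha : bifTwo α β < a) (b : ℂ) : ¬ IsStableSystem α β a b := by
  have h : HasInnerZero α β a b := by
    rcases eq_or_ne b 1 with rfl | hb
    · exact hasInnerZero_one (by linarith) hβ₀ ((bifOne_lt_bifTwo hβ₀ hβ₁ hα₂).trans ha)
    have hg : b - 1 ≠ 0 := sub_ne_zero.mpr hb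
    rw [← add_sub_cancel 1 b]
    by_cases hex : ∃ δ : ℝ, |δ| < Real.pi ∧ arcRe α β a δ = (b - 1).re ∧
        arcIm α β a δ = (b - 1).im
    · obtain ⟨δ, hδ, hr, hi⟩ := hex
      exact hasInnerZero_of_mem_arc hβ₀ hβ₁ hα₁ hα₂ ha hg hδ hr hi
    · push Not at hex
      exact hasInnerZero_of_not_mem_arc hβ₀ hβ₁ hα₁ hα₂ ha.le hg hex
  obtain ⟨w, hw, h0⟩ := h
  exact not_isStableSystem_of_charFun_eq_zero hβ₀ hβ₁ hα₁ hα₂ hw h0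

/-- From the second bifurcation value on the equation is never asymptotically stable. -/
theorem not_isAsympStableSystem_of_bifTwo_le (hβ₀ : 0 < β) (hβ₁ : β ≤ 1) (hα₁ : 1 < α)
    (hα₂ : α ≤ 2) (ha : bifTwo α β ≤ a) (b : ℂ) : ¬ IsAsympStableSystem α β a b := by
  rcases eq_or_ne b 1 with rfl | hb
  · exact not_isAsympStableSystem_one hβ₀ hα₁
  have hg : b - 1 ≠ 0 := sub_ne_zero.mpr hb
  by_cases hex : ∃ δ : ℝ, |δ| < Real.pi ∧ arcRe α β a δ = (b - 1).re ∧
      arcIm α β a δ = (b - 1).im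
  -- On the curve a circle zero already rules out decay. The radial argument is not available at `a
  -- = a₂`, where the velocity of the curve vanishes at `δ = 0`.
  · obtain ⟨δ, hδ, h⟩ := hex
    have h0 := (charFun_neg_exp_eq_zero_iff α β a b hδ).mpr h
    refine not_isAsympStableSystem_of_charFun_eq_zero hβ₀ hβ₁ hα₁ hα₂ ?_ ?_ h0
    · rw [norm_neg, Complex.norm_exp_ofReal_mul_I]
    · intro h1
      rw [h1, charFun_one (by linarith) hβ₀, sub_eq_zero] at h0
      exact hb h0.symm
  · push Not at hex
    have h := hasInnerZero_of_not_mem_arc hβ₀ hβ₁ hα₁ hα₂ ha hg hex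
    rw [add_sub_cancel] at h
    obtain ⟨w, hw, h0⟩ := h
    exact fun hst => not_isStableSystem_of_charFun_eq_zero hβ₀ hβ₁ hα₁ hα₂ hw h0 hst.1

end LargeCoefficient

/-! ### Assembly of the result. -/

theorem mainTheorem2 (α β a : ℝ) (hβ₀ : 0 < β) (hβ₁ : β ≤ 1) (hα₁ : 1 < α) (hα₂ : α ≤ 2)
    (ha : 0 < a) :
    -- location of the two bifurcation values
    (gammaCurve α β a 0 = gammaCurve α β a Real.pi ↔ a = bifOne α β) ∧
    (DifferentiableAt ℝ (gammaCurve α β a) Real.pi ∧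
      (deriv (gammaCurve α β a) Real.pi = 0 ↔ a = bifTwo α β)) ∧
    bifOne α β < bifTwo α β ∧
    -- the stable region in the complex plane vanishes at the second value
    (bifTwo α β ≤ a → ∀ b : ℂ, ¬ IsAsympStableSystem α β a b) ∧
    (bifTwo α β < a → ∀ b : ℂ, ¬ IsStableSystem α β a b) ∧
    -- the stable interval for real `b` and its right endpoint
    (a < bifTwo α β →
      ∃ θ ∈ Set.Ioo 0 Real.pi,
        (∀ θ' ∈ Set.Ioo 0 Real.pi, gammaIm α β a θ' = 0 ↔ θ' = θ) ∧
        (a < bifOne α β →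
          gammaRe α β a θ < 1 ∧
          {b : ℝ | IsAsympStableSystem α β a (b : ℂ)} = Set.Ioo (gammaRe α β a θ) 1) ∧
        (bifOne α β ≤ a →
          gammaRe α β a θ < 1 + 2 ^ α - a * 2 ^ β ∧
          {b : ℝ | IsAsympStableSystem α β a (b : ℂ)} =
            Set.Ioo (gammaRe α β a θ) (1 + 2 ^ α - a * 2 ^ β))) := by
  refine ⟨gammaCurve_zero_eq_pi_iff (by linarith) hβ₀.ne',
    ⟨(hasDerivAt_gammaCurve_pi α β a).differentiableAt, deriv_gammaCurve_pi_eq_zero_iff hβ₁⟩,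
    bifOne_lt_bifTwo hβ₀ hβ₁ hα₂, not_isAsympStableSystem_of_bifTwo_le hβ₀ hβ₁ hα₁ hα₂,
    not_isStableSystem_of_bifTwo_lt hβ₀ hβ₁ hα₁ hα₂, fun ha₂ => ?_⟩
  obtain ⟨δ, hδ, haδ⟩ := exists_arcCoeff_eq hβ₀ hβ₁ hα₁ hα₂ ha ha₂
  have hδpi : δ < Real.pi := hδ.2.trans_le (pi_div_le hα₂)
  have hRe := gammaRe_pi_sub α β a (abs_lt_pi_of_mem hδ.1 hδpi).le
  have hset := setOf_isAsympStableSystem_eq hβ₀ hβ₁ hα₁ hα₂ hδ haδ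
  have hneg := arcRe_arcCoeff_neg hβ₀ hβ₁ hα₁ hα₂ hδ.1 hδpi
  have hlt := arcRe_arcCoeff_lt hβ₀ hβ₁ hα₁ hα₂ hδ.1 hδpi
  rw [← haδ] at hneg hlt
  have h2 : (0 : ℝ) < 2 ^ β := Real.rpow_pos_of_pos two_pos _
  refine ⟨Real.pi - δ, ⟨by linarith, by linarith [hδ.1]⟩, fun θ hθ => ?_, fun h => ?_, fun h => ?_⟩
  · have h0 : 0 < Real.pi - θ := by linarith [hθ.2]
    have h1 : Real.pi - θ < Real.pi := by linarith [hθ.1]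
    have hIm := gammaIm_pi_sub α β a (abs_lt_pi_of_mem h0 h1).le
    rw [sub_sub_cancel] at hIm
    rw [hIm]
    constructor
    · intro hz
      have hmem : Real.pi - θ ∈ Set.Ioo 0 (Real.pi / (2 - α / 2)) := by
        refine ⟨h0, ?_⟩
        by_contra hcon
        exact (arcIm_pos_of_pi_div_le hβ₀ hβ₁ hα₁ hα₂ ha (not_lt.mp hcon) h1).ne' hz
      have hz' := (arcIm_eq_zero_iff hβ₀ hβ₁ h0 h1).mp hz
      have := (arcCoeff_strictAntiOn hβ₀ hβ₁ hα₁ hα₂).injOn hδ hmem (haδ ▸ hz')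
      linarith
    · rintro rfl
      rw [sub_sub_cancel]
      exact (arcIm_eq_zero_iff hβ₀ hβ₁ hδ.1 hδpi).mpr haδ
  -- Since `2^α = a₁ 2^β`, the comparison of `a` with `a₁` decides which of `1` and `1 + 2^α - a
  -- 2^β` is the smaller endpoint.
  · rw [hset, hRe, min_eq_left]
    · exact ⟨by linarith, rfl⟩
    · rw [two_rpow_eq α β]
      nlinarith
  · rw [hset, hRe, min_eq_right]
    · exact ⟨by linarith, rfl⟩
    · rw [two_rpow_eq α β]
      nlinarith
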